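/- **Setting.** An instance consists of $n\ge 1$ jobs; job $l$ has a release time $r_l$, a deadline $d_l$ and a workload $w_l>0$. The instance has agreeable deadlines: $l<m$ implies $r_l\le r_m$ and $d_l\le d_m$. The cost parameters are $\alpha\in[2,3]$, a wake-up cost $L>0$ and a ground dissipation $g>0$. A schedule on a set of times $T$ for a set of jobs $J$ consists of functions $\mathrm{mode}:T\to\{\mathrm{on},\mathrm{off}\}$, $\mathrm{speed}:T\to[0,\infty)$, $\mathrm{job}:T\to\{\mathrm{none}\}\cup J$ that are constant, around each $t\in T$, on the part in $T$ of some interval $[t',u)\ni t$, such that $\mathrm{speed}(t)>0$ implies $\mathrm{mode}(t)=\mathrm{on}$; $\mathrm{speed}(t)=0$ if and only if $\mathrm{job}(t)=\mathrm{none}$; $\mathrm{job}(t)=l$ implies $t\in[r_l,d_l)$; and $\int_{\mathrm{job}(t)=l}\mathrm{speed}(t)\,dt=w_l$ for all $l\in J$. Its speed cost is $\int_T \mathrm{speed}(t)^\alpha\,dt$. A schedule of the complete instance has $T=\mathbb R$, $J=\{1,\dots,n\}$ and mode cost $L(q+1)+g\,|\mathrm{on}|$, where $|\mathrm{on}|$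 is the total length of the on-time and $q$ is the number of maximal intervals on which the mode is on. Put $d_0=r_1-L/g$ and $r_{n+1}=d_n+L/g$. For $1\le i\le n+1$ and $i-1\le j\le n$, the subinstance $(i,j)$ has the interval $I=[d_{i-1},r_{j+1})$ (empty, of length $|I|=0$, if $r_{j+1}\le d_{i-1}$) and the jobs $J=\{i,\dots,j\}$; its schedules are those with $T=I$, and their mode cost is $kL+g\,|\mathrm{on}|$, where $k$ is the number of maximal intervals of $I$ on which the mode is off. $O_{i,j}$ is the minimum (infimum) of speed cost plus mode cost over the schedules of $(i,j)$, and $Y_{i,j}$ is the minimum (infimum) of the speed cost plus $g|I|$; both are $+\infty$ if $(i,j)$ has no schedule. Let $s^\star=(g/(\alpha-1))^{1/\alpha}$ and $g^\star=(g+(s^\star)^\alpha)/s^\star$. For a subinstance $(i,j)$ with $i\le j$ let $r'_l=\max(r_l,d_{i-1})$ and $d'_l=\min(d_l,r_{j+1})$. The density of $[x,y)\subseteq I$, $x<y$, is $\frac1{y-x}\sum w_l$ over the jobs $l\in\{i,\dots,j\}$ with $[r'_l,d'_l)\subseteq[x,y)$. Call $(i,j)$ *sparse* if $I\neq\emptyset$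 and every such $[x,y)$ has density less than $s^\star$. For $a,k\in\{i,\dots,j\}$ let $f(a)$ be the largest $b\in\{a,\dots,j\}$ with $r'_a+(w_a+\dots+w_m)/s^\star\ge r'_{m+1}$ for all $a\le m<b$, let $h(k)$ be the largest $c\in\{k,\dots,j\}$ with $d'_c-(w_\ell+\dots+w_c)/s^\star\le d'_{\ell-1}$ for all $k<\ell\le c$, and let $f^{-1}(b)$ be the smallest $a\in\{i,\dots,j\}$ with $f(a)=b$. **Theorem.** 1. For $1\le i\le n+1$: $O_{i,i-1}=\min\{L,\;g\max(0,r_i-d_{i-1})\}$. 2. Let $1\le i\le j\le n$ and let $(i,j)$ be sparse. Then the minimum $O_{i,j}$ is attained by a schedule, and with $k=f^{-1}(j)$ $$O_{i,j}=\min\begin{cases}Y_{i,j}\\ L+g^\star(w_i+\dots+w_{h(i)})+O_{h(i)+1,j}\\ Y_{i,k-1}+g^\star(w_k+\dots+w_j)+L\\ \min\limits_{a}\;Y_{i,a-1}+g^\star(w_a+\dots+w_b)+L+g^\star(w_{b+1}+\dots+w_c)+O_{c+1,j},\end{cases}$$ where the inner minimum is over all $a\in\{i,\dots,j\}$ such that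 $b=f(a)$ satisfies $b<j$ and $a=f^{-1}(b)$, with $c=h(b+1)$ (it is $+\infty$ if there is no such $a$). Moreover the nonempty subinstances to which the recursion refers through $O$ are sparse again: if $a\in\{i,\dots,j\}$ and $h(a)<j$, then $(h(a)+1,j)$ is sparse. 3. The minimum (infimum) total cost of the complete instance equals $O_{1,n}$; if $(1,n)$ is sparse, some schedule of the complete instance attains it. -/

import Mathlib

open MeasureTheory
open scoped ENNReal NNReal

noncomputable section

namespace SpeedScaling

/-- An instance with agreeable deadlines: jobs `1, …, n`, job `l` having release time `r l`,
deadline `d l` and workload `w l` (values at other indices are irrelevant), numbered so that release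
times and deadlines are non-decreasing; together with the exponent `α`, the wake-up cost `L` and
the ground dissipation energy `g`. -/
structure AgreeableInstance where
  n : ℕ
  r : ℕ → ℝ
  d : ℕ → ℝ
  w : ℕ → ℝ
  α : ℝ
  L : ℝ
  g : ℝ
  one_le_n : 1 ≤ n
  w_pos : ∀ l, 1 ≤ l → l ≤ n → 0 < w l
  r_mono : ∀ l m, 1 ≤ l → l < m → m ≤ n → r l ≤ r m
  d_mono : ∀ l m, 1 ≤ l → l < m → m ≤ n → d l ≤ d m
  two_le_α : 2 ≤ α
  α_le_three : α ≤ 3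
  L_pos : 0 < L
  g_pos : 0 < g

/-- The mode of the machine. -/
inductive Mode where
  | on
  | off

/-- The inclusion-wise maximal (nonempty) intervals contained in a set of times. -/
def maxIntervals (U : Set ℝ) : Set (Set ℝ) := Set.ordConnectedComponent U '' U

namespace AgreeableInstance

variable (P : AgreeableInstance)

/-- A schedule, over the set of times `T`, of the jobs in `J`, where the window of each job `l` is
restricted to `[r l, d l) ∩ T`. Only the values of the three functions on `T` matter. -/
structure Schedule (T : Set ℝ) (J : Finset ℕ) where
  mode : ℝ → Mode
  speed : ℝ → ℝ≥0
  job : ℝ → Option ℕ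
  on_of_speed_pos : ∀ t ∈ T, 0 < speed t → mode t = Mode.on
  speed_eq_zero_iff : ∀ t ∈ T, speed t = 0 ↔ job t = none
  job_window : ∀ t ∈ T, ∀ l, job t = some l → l ∈ J ∧ t ∈ Set.Ico (P.r l) (P.d l)
  work : ∀ l ∈ J, ∫⁻ t in {t | t ∈ T ∧ job t = some l}, (speed t : ℝ≥0∞) = ENNReal.ofReal (P.w l)
  piecewise_constant : ∀ t ∈ T, ∃ a b, a ≤ t ∧ t < b ∧ ∀ x ∈ Set.Ico a b ∩ T,
    mode x = mode t ∧ speed x = speed t ∧ job x = job t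

namespace Schedule

variable {P} {T : Set ℝ} {J : Finset ℕ}

/-- The times of `T` at which the machine is on. -/
def onSet (S : P.Schedule T J) : Set ℝ := {t | t ∈ T ∧ S.mode t = Mode.on}

/-- The times of `T` at which the machine is shut down. -/
def offSet (S : P.Schedule T J) : Set ℝ := {t | t ∈ T ∧ S.mode t = Mode.off}

/-- The speed cost `∫ speed(t)^α dt`. -/
def speedCost (S : P.Schedule T J) : ℝ≥0∞ := ∫⁻ t in T, (S.speed t : ℝ≥0∞) ^ P.α

/-- The mode cost for a subinstance: `k L + g |on|`, with `k` the number of shutdown intervals. -/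
def modeCost (S : P.Schedule T J) : ℝ≥0∞ :=
  ((maxIntervals S.offSet).encard : ℝ≥0∞) * ENNReal.ofReal P.L
    + ENNReal.ofReal P.g * volume S.onSet

/-- The mode cost for the complete instance: `L (s + 1) + g |on|`, with `s` the number of
maximal intervals on which the machine is on. -/
def fullModeCost (S : P.Schedule T J) : ℝ≥0∞ :=
  ENNReal.ofReal P.L * (((maxIntervals S.onSet).encard : ℝ≥0∞) + 1)
    + ENNReal.ofReal P.g * volume S.onSet

end Schedule

/-- A schedule of the complete instance. -/
abbrev FullSchedule : Type := P.Schedule Set.univ (Finset.Icc 1 P.n)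

/-- The minimum total cost of the complete instance (`+∞` if it is infeasible). -/
def opt : ℝ≥0∞ := ⨅ S : P.FullSchedule, S.speedCost + S.fullModeCost

/-- The deadlines, extended by `d 0 = r 1 - L / g`. -/
def dl (m : ℕ) : ℝ := if m = 0 then P.r 1 - P.L / P.g else P.d m

/-- The release times, extended by `r (n + 1) = d n + L / g`. -/
def rel (m : ℕ) : ℝ := if m = P.n + 1 then P.d P.n + P.L / P.g else P.r m

/-- A schedule of the subinstance `(i, j)`: jobs `i, …, j` on the interval
`[d (i - 1), r (j + 1))`. -/
abbrev SubSchedule (i j : ℕ) : Type :=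
  P.Schedule (Set.Ico (P.dl (i - 1)) (P.rel (j + 1))) (Finset.Icc i j)

/-- `O i j`: the minimum speed cost plus mode cost of the subinstance `(i, j)`
(`+∞` if it is infeasible). -/
def O (i j : ℕ) : ℝ≥0∞ := ⨅ S : P.SubSchedule i j, S.speedCost + S.modeCost

/-- `Y i j`: the minimum speed cost of the subinstance `(i, j)` plus `g` times the length of its
interval (`+∞` if it is infeasible). -/
def Y (i j : ℕ) : ℝ≥0∞ :=
  (⨅ S : P.SubSchedule i j, S.speedCost) + ENNReal.ofReal (P.g * (P.rel (j + 1) - P.dl (i - 1)))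

/-- The critical speed. -/
def sStar : ℝ := (P.g / (P.α - 1)) ^ (1 / P.α)

/-- The energy per unit of work at critical speed. -/
def gStar : ℝ := (P.g + P.sStar ^ P.α) / P.sStar

/-- The energy `g* (w a + ⋯ + w b)` for executing jobs `a, …, b` at critical speed. -/
def critCost (a b : ℕ) : ℝ≥0∞ := ENNReal.ofReal (P.gStar * ∑ l ∈ Finset.Icc a b, P.w l)

/-- The release time of job `l`, restricted to the interval of the subinstances `(i, _)`. -/
def rRestr (i l : ℕ) : ℝ := max (P.r l) (P.dl (i - 1))

/-- The deadline of job `l`, restricted to the interval of the subinstances `(_, j)`. -/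
def dRestr (j l : ℕ) : ℝ := min (P.d l) (P.rel (j + 1))

open Classical in
/-- The density of `[x, y)` in the subinstance `(i, j)`. -/
def density (i j : ℕ) (x y : ℝ) : ℝ :=
  (∑ l ∈ Finset.Icc i j with Set.Ico (P.rRestr i l) (P.dRestr j l) ⊆ Set.Ico x y, P.w l) / (y - x)

/-- The interval of the subinstance `(i, j)` is nonempty and contains no dense interval. -/
def Sparse (i j : ℕ) : Prop :=
  P.dl (i - 1) < P.rel (j + 1) ∧
    ∀ x y, P.dl (i - 1) ≤ x → x < y → y ≤ P.rel (j + 1) → P.density i j x y < P.sStar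

open Classical in
/-- `f a`, for the subinstance `(i, j)`: the largest `b ≤ j` such that
`r a + (w a + ⋯ + w k) / s* ≥ r (k + 1)` for all `a ≤ k < b`, with restricted release times. -/
def f (i j a : ℕ) : ℕ :=
  Nat.findGreatest (fun b => a ≤ b ∧ ∀ k, a ≤ k → k < b →
    P.rRestr i (k + 1) ≤ P.rRestr i a + (∑ l ∈ Finset.Icc a k, P.w l) / P.sStar) j

open Classical in
/-- `h k`, for the subinstance `(i, j)`: the largest `c ≤ j` such that
`d c - (w l + ⋯ + w c) / s* ≤ d (l - 1)` for all `k < l ≤ c`, with restricted deadlines. (It does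
not depend on `i`.) -/
def h (j k : ℕ) : ℕ :=
  Nat.findGreatest (fun c => k ≤ c ∧ ∀ l, k < l → l ≤ c →
    P.dRestr j c - (∑ m ∈ Finset.Icc l c, P.w m) / P.sStar ≤ P.dRestr j (l - 1)) j

/-- `f⁻¹ b`, for the subinstance `(i, j)`: the smallest `a ∈ {i, …, j}` with `f a = b`. -/
def fInv (i j b : ℕ) : ℕ := sInf {a | i ≤ a ∧ a ≤ j ∧ P.f i j a = b}

end AgreeableInstance

end SpeedScaling

end

/-!
The deadlines being agreeable, jobs may be processed in the order of their numbers, and a schedule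
then amounts to a speed function together with the amount `V t` of work processed before time `t`.
With `cw l` the total workload of the jobs preceding `l`, the job windows become the conditions
`V t ≤ cw l` up to the release of `l` and `cw (l + 1) ≤ V t` from the deadline of `l` on
(`Schedule.exists_flow`, `Feasible.exists_schedule`). All exchange arguments are carried out on `V`.

The constant `g*` is the energy per unit of work at the critical speed `s*`. It is the minimum of
`(s ^ α + g) / s` and at the same time the derivative of `s ^ α` at `s*`. Hence every unit of
work costs at least `g*` (`Schedule.ofReal_gStar_mul_le`), and raising the speed to `s*` while the
machine is on costs at most `g*` per unit of additional work (`IsFlow.ofReal_rpow_mul_le`).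

In a sparse subinstance, the block `a, …, f a` can be run at critical speed as early as possible and
the block `k, …, h k` as late as possible. Each term of the recursion but the first thus bounds the
cost of a schedule that is off before, between or after such blocks
(`Sparse.hasSched_off_first`, `Sparse.hasSched_off_between`, `Sparse.hasSched_off_last`), which
gives the upper bound.

For the lower bound (`recValue_le`), consider the first shutdown of a schedule, at time `u`. If there
is none, the schedule costs at least `Y i j`. If nothing has been processed before `u`, the second
term applies. Otherwise let `a, …, b` be the block of the earliest schedule that contains the job
processed last before `u` (`exists_block_start`).
* Before `u`: all jobs preceding `a` could be completed at critical speed by the release of `a`. If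
  some of their work is done later, it is moved to before that release, by speeding up to `s*` there.
  Hence these jobs cost at least `Y i (a - 1)`, and the other work done before `u` costs `g*` per
  unit (`Y_add_le_energy`).
* After `u`: let `c` be the last job of the block starting with `b + 1`, or with `i` in the case of
  the second term, in the latest schedule. Work on jobs after `c` that is done before the deadline
  of `c` can be moved to just after that deadline, where the machine runs at critical speed until it
  has caught up (`O_le_energy_add`). The shutdown at `u` ends before that deadline and is paid for
  by the additional `L` (`O_add_le_energy_of_first_off`).

The value `Y` is attained, since it suffices to minimise a continuous function on the compact set of
possible amounts of work at the release times and deadlines (`exists_min_speedCost`). Cutting after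
a block of the latest schedule preserves sparsity (`Sparse.of_h`), so that by induction on the
number of jobs the recursion holds and `O` is attained (`Sparse.hasSched_O`).

Finally, the subinstance `(1, n)` extends the time between the first release and the last deadline by
two intervals of length `L / g`, in which staying on costs as much as a wake-up. Its schedules may
therefore be assumed to be off there (`Schedule.exists_turnOff`), and then they have exactly one more
shutdown than on-intervals, which matches the cost of the complete instance (`opt_eq_O`).
-/


open MeasureTheory
open scoped ENNReal NNReal

noncomputable section

namespace SpeedScaling

/-! ### Counting maximal intervals -/

/-- The comparison principle for numbers of components: a map between two sets of points that
never merges two components of the source yields an injection between the components met. -/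
theorem encard_image_ordConnectedComponent_le {U V X Y : Set ℝ} (φ : ℝ → ℝ)
    (hφ : ∀ x ∈ U, φ x ∈ V) (hUX : U ⊆ X)
    (h : ∀ x ∈ U, ∀ y ∈ U, x < y → φ y ∈ Set.ordConnectedComponent Y (φ x) → Set.Icc x y ⊆ X)
    (hVY : V ⊆ Y) :
    (Set.ordConnectedComponent X '' U).encard ≤ (Set.ordConnectedComponent Y '' V).encard := by
  have key : ∀ C ∈ Set.ordConnectedComponent X '' U, ∃ x ∈ U, Set.ordConnectedComponent X x = C :=
    fun C hC => hC
  choose! p hpU hp using key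
  refine Set.encard_le_encard_of_injOn
    (f := fun C => Set.ordConnectedComponent Y (φ (p C))) ?_ ?_
  · intro C hC
    exact ⟨φ (p C), hφ _ (hpU C hC), rfl⟩
  · intro C hC D hD hCD
    simp only at hCD
    rw [← hp C hC, ← hp D hD]
    apply Set.ordConnectedComponent_eq
    have h1 : φ (p D) ∈ Set.ordConnectedComponent Y (φ (p C)) := by
      rw [hCD, Set.self_mem_ordConnectedComponent]
      exact hVY (hφ _ (hpU D hD))
    have h2 : φ (p C) ∈ Set.ordConnectedComponent Y (φ (p D)) := by
      rw [← hCD, Set.self_mem_ordConnectedComponent]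
      exact hVY (hφ _ (hpU C hC))
    rcases lt_trichotomy (p C) (p D) with hlt | heq | hlt
    · rw [Set.uIcc_of_le hlt.le]
      exact h _ (hpU C hC) _ (hpU D hD) hlt h1
    · rw [heq, Set.uIcc_self, Set.singleton_subset_iff]
      exact hUX (hpU D hD)
    · rw [Set.uIcc_of_ge hlt.le]
      exact h _ (hpU D hD) _ (hpU C hC) hlt h2

theorem encard_maxIntervals_union_le (U V : Set ℝ) :
    (maxIntervals (U ∪ V)).encard ≤ (maxIntervals U).encard + (maxIntervals V).encard := by
  unfold maxIntervals
  rw [Set.image_union]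
  refine (Set.encard_union_le _ _).trans (add_le_add ?_ ?_)
  · refine encard_image_ordConnectedComponent_le id (fun x hx => hx) Set.subset_union_left ?_
      subset_rfl
    intro x _ y _ hxy h
    rw [id, id, Set.mem_ordConnectedComponent, Set.uIcc_of_le hxy.le] at h
    exact h.trans Set.subset_union_left
  · refine encard_image_ordConnectedComponent_le id (fun x hx => hx) Set.subset_union_right ?_
      subset_rfl
    intro x _ y _ hxy h
    rw [id, id, Set.mem_ordConnectedComponent, Set.uIcc_of_le hxy.le] at h
    exact h.trans Set.subset_union_right

/-- Within an interval, each component of a set leaves at most one component. -/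
theorem encard_maxIntervals_inter_le (X : Set ℝ) {K : Set ℝ} (hK : K.OrdConnected) :
    (maxIntervals (X ∩ K)).encard ≤ (Set.ordConnectedComponent X '' (X ∩ K)).encard := by
  refine encard_image_ordConnectedComponent_le id (fun x hx => hx) subset_rfl ?_
    Set.inter_subset_left
  intro x hx y hy hxy h
  rw [id, id, Set.mem_ordConnectedComponent, Set.uIcc_of_le hxy.le] at h
  exact Set.subset_inter h (hK.out hx.2 hy.2)

/-- The parts of a set to the left and to the right of a gap have separate components. -/
theorem encard_maxIntervals_inter_add_le {X K K' : Set ℝ} (hK : K.OrdConnected)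
    (hK' : K'.OrdConnected)
    (hsep : ∀ x ∈ X ∩ K, ∀ y ∈ X ∩ K', x ≤ y ∧ ∃ z ∈ Set.Icc x y, z ∉ X) :
    (maxIntervals (X ∩ K)).encard + (maxIntervals (X ∩ K')).encard ≤ (maxIntervals X).encard := by
  refine (add_le_add (encard_maxIntervals_inter_le X hK)
    (encard_maxIntervals_inter_le X hK')).trans ?_
  rw [← Set.encard_union_eq]
  · exact Set.encard_le_encard (Set.union_subset (Set.image_mono Set.inter_subset_left)
      (Set.image_mono Set.inter_subset_left))
  · rw [Set.disjoint_left]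
    rintro _ ⟨x, hx, rfl⟩ ⟨y, hy, hxy⟩
    obtain ⟨hle, z, hz, hzX⟩ := hsep x hx y hy
    have : y ∈ Set.ordConnectedComponent X x := by
      rw [← hxy, Set.self_mem_ordConnectedComponent]; exact hy.1
    rw [Set.mem_ordConnectedComponent, Set.uIcc_of_le hle] at this
    exact hzX (this hz)

theorem encard_maxIntervals_inter_le_self (X : Set ℝ) {K : Set ℝ} (hK : K.OrdConnected) :
    (maxIntervals (X ∩ K)).encard ≤ (maxIntervals X).encard :=
  (encard_maxIntervals_inter_le X hK).trans
    (Set.encard_le_encard (Set.image_mono Set.inter_subset_left))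

theorem encard_maxIntervals_le_one {K : Set ℝ} (hK : K.OrdConnected) :
    (maxIntervals K).encard ≤ 1 := by
  rw [Set.encard_le_one_iff]
  rintro _ _ ⟨x, hx, rfl⟩ ⟨y, hy, rfl⟩
  exact Set.ordConnectedComponent_eq (hK.uIcc_subset hx hy)

theorem one_le_encard_maxIntervals {U : Set ℝ} (hU : U.Nonempty) :
    1 ≤ (maxIntervals U).encard :=
  Set.one_le_encard_iff_nonempty.2 (hU.image _)

theorem encard_maxIntervals_empty : (maxIntervals ∅).encard = 0 := by
  simp [maxIntervals]

/-- Adding to a set an interval that meets it creates no new component. -/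
theorem encard_maxIntervals_union_le_of_meets {U K : Set ℝ} (hK : K.OrdConnected) {p : ℝ}
    (hpU : p ∈ U) (hpK : p ∈ K) :
    (maxIntervals (U ∪ K)).encard ≤ (maxIntervals U).encard := by
  classical
  refine encard_image_ordConnectedComponent_le (fun x => if x ∈ U then x else p) ?_ subset_rfl ?_
    subset_rfl
  · intro x _
    by_cases h : x ∈ U <;> simp [h, hpU]
  · have aux : ∀ x ∈ U ∪ K, Set.uIcc x (if x ∈ U then x else p) ⊆ U ∪ K := by
      intro x hx
      by_cases h : x ∈ U
      · simp [h]
      · simp only [h, if_false]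
        exact (hK.uIcc_subset (hx.resolve_left h) hpK).trans Set.subset_union_right
    intro x hx y hy hxy h
    rw [Set.mem_ordConnectedComponent] at h
    rw [← Set.uIcc_of_le hxy.le]
    refine Set.uIcc_subset_uIcc_union_uIcc.trans (Set.union_subset (aux x hx) ?_)
    refine Set.uIcc_subset_uIcc_union_uIcc.trans
      (Set.union_subset (h.trans Set.subset_union_left) ?_)
    rw [Set.uIcc_comm]
    exact aux y hy

/-- If every point of `U` is followed, after points of `U` only, by a point of `V`, then `V` has at
least as many components as `U`. -/
theorem encard_maxIntervals_le_of_followed {U V : Set ℝ} (hUV : Disjoint U V)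
    (hnext : ∀ x ∈ U, ∃ y ∈ V, x < y ∧ Set.Ico x y ⊆ U) :
    (maxIntervals U).encard ≤ (maxIntervals V).encard := by
  choose! φ hφV hlt hsub using hnext
  refine encard_image_ordConnectedComponent_le φ hφV subset_rfl ?_ subset_rfl
  intro x hx y hy hxy h
  rw [Set.mem_ordConnectedComponent] at h
  have hy' : y < φ x := by
    by_contra hcon
    rw [not_lt] at hcon
    have : y ∈ Set.uIcc (φ x) (φ y) := by
      rw [Set.uIcc_of_le (hcon.trans (hlt y hy).le)]
      exact ⟨hcon, (hlt y hy).le⟩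
    exact Set.disjoint_left.1 hUV hy (h this)
  exact fun z hz => hsub x hx ⟨hz.1, hz.2.trans_lt hy'⟩

/-! ### Right-constant functions and flows -/

/-- `f` is constant to the right of each point of `[x, y)`. -/
def RightConstOn {β : Type*} (f : ℝ → β) (x y : ℝ) : Prop :=
  ∀ t ∈ Set.Ico x y, ∃ b, t < b ∧ ∀ z ∈ Set.Ico t b, z < y → f z = f t

namespace RightConstOn

variable {β : Type*} {f f' : ℝ → β} {x y x' y' : ℝ}

theorem measurableSet_preimage (hf : RightConstOn f x y) (B : Set β) :
    MeasurableSet {t | t ∈ Set.Ico x y ∧ f t ∈ B} := by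
  apply MeasurableSet.of_mem_nhdsGT
  rintro t ⟨ht, htB⟩
  obtain ⟨b, hb, h⟩ := hf t ht
  filter_upwards [Ioo_mem_nhdsGT (lt_min hb ht.2)] with z hz
  have h1 : z < b := hz.2.trans_le (min_le_left _ _)
  have h2 : z < y := hz.2.trans_le (min_le_right _ _)
  exact ⟨⟨ht.1.trans hz.1.le, h2⟩, by rw [h z ⟨hz.1.le, h1⟩ h2]; exact htB⟩

theorem aemeasurable [MeasurableSpace β] (hf : RightConstOn f x y) :
    AEMeasurable f (volume.restrict (Set.Ico x y)) := by
  rcases isEmpty_or_nonempty β with hβ | ⟨⟨c⟩⟩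
  · exact (hβ.false (f 0)).elim
  classical
  refine ⟨fun t => if t ∈ Set.Ico x y then f t else c, ?_, ?_⟩
  · intro B _
    have : (fun t => if t ∈ Set.Ico x y then f t else c) ⁻¹' B =
        {t | t ∈ Set.Ico x y ∧ f t ∈ B} ∪ ({t | t ∉ Set.Ico x y ∧ c ∈ B}) := by
      ext t
      by_cases h : t ∈ Set.Ico x y <;> simp [-Set.mem_Ico, h]
    rw [this]
    refine (hf.measurableSet_preimage B).union ?_
    by_cases hc : c ∈ B
    · simp only [hc, and_true]
      exact (measurableSet_Ico (a := x) (b := y)).compl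
    · simp [hc]
  · filter_upwards [ae_restrict_mem measurableSet_Ico] with t ht
    simp only [ht, if_true]

theorem mono (hf : RightConstOn f x y) (hx : x ≤ x') (hy : y' ≤ y) : RightConstOn f x' y' := by
  intro t ht
  obtain ⟨b, hb, h⟩ := hf t ⟨hx.trans ht.1, ht.2.trans_le hy⟩
  exact ⟨b, hb, fun z hz hzy => h z hz (hzy.trans_le hy)⟩

theorem const (c : β) : RightConstOn (fun _ => c) x y :=
  fun t _ => ⟨t + 1, by linarith, fun _ _ _ => rfl⟩

/-- Right-constant functions on adjacent intervals combine to one. -/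
theorem glue {τ : ℝ} (hf : RightConstOn f x τ) (hf' : RightConstOn f' τ y) :
    RightConstOn (fun t => if t < τ then f t else f' t) x y := by
  intro t ht
  by_cases h : t < τ
  · obtain ⟨b, hb, hc⟩ := hf t ⟨ht.1, h⟩
    refine ⟨min b τ, lt_min hb h, fun z hz hzy => ?_⟩
    have h1 : z < b := hz.2.trans_le (min_le_left _ _)
    have h2 : z < τ := hz.2.trans_le (min_le_right _ _)
    simp only [h, h2, if_true]
    exact hc z ⟨hz.1, h1⟩ h2
  · obtain ⟨b, hb, hc⟩ := hf' t ⟨not_lt.1 h, ht.2⟩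
    refine ⟨b, hb, fun z hz hzy => ?_⟩
    have h2 : ¬ z < τ := not_lt.2 ((not_lt.1 h).trans hz.1)
    simp only [h, h2, if_false]
    exact hc z hz hzy

/-- There is a first time after `t` at which `f` takes the value `f s`. -/
theorem exists_next (hf : RightConstOn f x y) {t s : ℝ} (ht : x ≤ t) (hts : t ≤ s) (hs : s < y) :
    ∃ u ∈ Set.Icc t s, f u = f s ∧ ∀ z ∈ Set.Ico t u, f z ≠ f s := by
  set A : Set ℝ := {z | z ∈ Set.Icc t s ∧ f z = f s} with hA
  have hsA : s ∈ A := ⟨⟨hts, le_rfl⟩, rfl⟩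
  have hbdd : BddBelow A := ⟨t, fun z hz => hz.1.1⟩
  have hu1 : t ≤ sInf A := le_csInf ⟨s, hsA⟩ fun z hz => hz.1.1
  have hu2 : sInf A ≤ s := csInf_le hbdd hsA
  refine ⟨sInf A, ⟨hu1, hu2⟩, ?_, fun z hz hzs => ?_⟩
  · obtain ⟨b, hb, hc⟩ := hf (sInf A) ⟨ht.trans hu1, hu2.trans_lt hs⟩
    obtain ⟨z, hz, hzb⟩ := exists_lt_of_csInf_lt ⟨s, hsA⟩ hb
    rw [← hc z ⟨csInf_le hbdd hz, hzb⟩ (hz.1.2.trans_lt hs)]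
    exact hz.2
  · exact not_le.2 hz.2 (csInf_le hbdd ⟨⟨hz.1, hz.2.le.trans hu2⟩, hzs⟩)

end RightConstOn

/-- A flow on `[x, y)`: a speed function together with the amount of work `V t` that has been
processed before time `t` (normalised up to an additive constant). -/
structure IsFlow (x y : ℝ) (σ : ℝ → ℝ≥0) (V : ℝ → ℝ) : Prop where
  rightConst : RightConstOn σ x y
  mass : ∀ s t, x ≤ s → s ≤ t → t ≤ y →
    ∫⁻ z in Set.Ico s t, (σ z : ℝ≥0∞) = ENNReal.ofReal (V t - V s)
  mono : MonotoneOn V (Set.Icc x y)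
  cont : ContinuousOn V (Set.Icc x y)

theorem lintegral_Ico_add {s t u : ℝ} (f : ℝ → ℝ≥0∞) (hst : s ≤ t) (htu : t ≤ u) :
    ∫⁻ z in Set.Ico s u, f z = (∫⁻ z in Set.Ico s t, f z) + ∫⁻ z in Set.Ico t u, f z := by
  rw [← Set.Ico_union_Ico_eq_Ico hst htu, lintegral_union measurableSet_Ico]
  rw [Set.disjoint_left]
  intro z hz hz'
  exact absurd hz.2 (not_lt.2 hz'.1)

theorem lintegral_Ico_eq_zero {s t : ℝ} (f : ℝ → ℝ≥0∞) (hst : t ≤ s) :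
    ∫⁻ z in Set.Ico s t, f z = 0 := by
  rw [Set.Ico_eq_empty (not_lt.2 hst)]; simp

namespace IsFlow

variable {x y x' y' : ℝ} {σ σ' : ℝ → ℝ≥0} {V V' : ℝ → ℝ}

theorem restrict (hF : IsFlow x y σ V) (hx : x ≤ x') (hy : y' ≤ y) : IsFlow x' y' σ V where
  rightConst := hF.rightConst.mono hx hy
  mass s t hs hst ht := hF.mass s t (hx.trans hs) hst (ht.trans hy)
  mono := hF.mono.mono (Set.Icc_subset_Icc hx hy)
  cont := hF.cont.mono (Set.Icc_subset_Icc hx hy)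

theorem const (x y : ℝ) (c : ℝ≥0) (v p : ℝ) :
    IsFlow x y (fun _ => c) (fun t => v + c * (t - p)) where
  rightConst := RightConstOn.const c
  mass s t _ hst _ := by
    rw [setLIntegral_const, Real.volume_Ico, ← ENNReal.ofReal_coe_nnreal,
      ← ENNReal.ofReal_mul c.coe_nonneg]
    congr 1
    ring
  mono := by
    intro s _ t _ hst
    have := mul_le_mul_of_nonneg_left hst c.coe_nonneg
    simp only
    linarith
  cont := by fun_prop

theorem glue {τ : ℝ} (hF : IsFlow x τ σ V) (hF' : IsFlow τ y σ' V') (hV : V τ = V' τ)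
    (hx : x ≤ τ) (hy : τ ≤ y) :
    IsFlow x y (fun t => if t < τ then σ t else σ' t) (fun t => if t ≤ τ then V t else V' t) := by
  have hr : ∀ t, τ ≤ t → (if t ≤ τ then V t else V' t) = V' t := by
    intro t ht
    rcases ht.eq_or_lt with rfl | h
    · simp [hV]
    · simp [not_le.2 h]
  have hl : ∀ t, t ≤ τ → (if t ≤ τ then V t else V' t) = V t := fun t ht => by simp [ht]
  have int_l : ∀ s t, t ≤ τ → ∫⁻ z in Set.Ico s t, ((if z < τ then σ z else σ' z : ℝ≥0) : ℝ≥0∞)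
      = ∫⁻ z in Set.Ico s t, (σ z : ℝ≥0∞) := by
    intro s t ht
    refine setLIntegral_congr_fun measurableSet_Ico fun z hz => ?_
    simp [hz.2.trans_le ht]
  have int_r : ∀ s t, τ ≤ s → ∫⁻ z in Set.Ico s t, ((if z < τ then σ z else σ' z : ℝ≥0) : ℝ≥0∞)
      = ∫⁻ z in Set.Ico s t, (σ' z : ℝ≥0∞) := by
    intro s t ht
    refine setLIntegral_congr_fun measurableSet_Ico fun z hz => ?_
    simp [not_lt.2 (ht.trans hz.1)]
  refine ⟨hF.rightConst.glue hF'.rightConst, ?_, ?_, ?_⟩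
  · intro s t hs hst ht
    rcases le_total t τ with h1 | h1
    · rw [int_l _ _ h1, hl t h1, hl s (hst.trans h1), hF.mass s t hs hst h1]
    · rcases le_total τ s with h2 | h2
      · rw [int_r _ _ h2, hr t h1, hr s h2, hF'.mass s t h2 hst ht]
      · rw [lintegral_Ico_add _ h2 h1, int_l _ _ le_rfl, int_r _ _ le_rfl, hr t h1, hl s h2,
          hF.mass s τ hs h2 le_rfl, hF'.mass τ t le_rfl h1 ht, ← ENNReal.ofReal_add, hV]
        · congr 1; ring
        · exact sub_nonneg.2 (hF.mono ⟨hs, h2⟩ ⟨hx, le_rfl⟩ h2)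
        · exact sub_nonneg.2 (hF'.mono ⟨le_rfl, hy⟩ ⟨h1, ht⟩ h1)
  · intro s hs t ht hst
    simp only
    rcases le_total t τ with h1 | h1
    · rw [hl t h1, hl s (hst.trans h1)]
      exact hF.mono ⟨hs.1, hst.trans h1⟩ ⟨ht.1, h1⟩ hst
    · rcases le_total τ s with h2 | h2
      · rw [hr t h1, hr s h2]
        exact hF'.mono ⟨h2, hs.2⟩ ⟨h1, ht.2⟩ hst
      · rw [hr t h1, hl s h2]
        refine (hF.mono ⟨hs.1, h2⟩ ⟨hx, le_rfl⟩ h2).trans ?_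
        rw [hV]
        exact hF'.mono ⟨le_rfl, hy⟩ ⟨h1, ht.2⟩ h1
  · rw [← Set.Icc_union_Icc_eq_Icc hx hy]
    refine ContinuousOn.union_of_isClosed (hF.cont.congr fun t ht => hl t ht.2)
      (hF'.cont.congr fun t ht => hr t ht.1) isClosed_Icc isClosed_Icc

/-- The amount of processed work grows strictly from a time of positive speed on. -/
theorem lt_of_pos (hF : IsFlow x y σ V) {t q : ℝ} (ht : t ∈ Set.Ico x y) (hσ : σ t ≠ 0)
    (htq : t < q) (hq : q ≤ y) : V t < V q := by
  obtain ⟨b, hb, h⟩ := hF.rightConst t ht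
  set z := min b q with hz
  have htz : t < z := lt_min hb htq
  have hzq : z ≤ q := min_le_right _ _
  have h1 : ∫⁻ u in Set.Ico t z, (σ u : ℝ≥0∞) = ENNReal.ofReal (V z - V t) :=
    hF.mass t z ht.1 htz.le (hzq.trans hq)
  have h2 : ∫⁻ u in Set.Ico t z, (σ u : ℝ≥0∞) = ∫⁻ u in Set.Ico t z, (σ t : ℝ≥0∞) := by
    refine setLIntegral_congr_fun measurableSet_Ico fun u hu => ?_
    rw [h u ⟨hu.1, hu.2.trans_le (min_le_left _ _)⟩ (hu.2.trans_le (hzq.trans hq))]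
  rw [h2, setLIntegral_const, Real.volume_Ico] at h1
  have h3 : 0 < ENNReal.ofReal (V z - V t) := by
    rw [← h1]
    refine ENNReal.mul_pos (by simpa using hσ) ?_
    simpa using htz
  have h4 : V z ≤ V q :=
    hF.mono ⟨ht.1.trans htz.le, hzq.trans hq⟩ ⟨ht.1.trans htq.le, hq⟩ hzq
  have := ENNReal.ofReal_pos.1 h3
  linarith

end IsFlow

/-- The inequality between the convex function `s ^ α` and its tangent at `c`. -/
theorem rpow_add_tangent_le {α : ℝ} (hα : 2 ≤ α) (c s : ℝ≥0) :
    (c : ℝ) ^ α + α * (c : ℝ) ^ (α - 1) * s ≤ (s : ℝ) ^ α + α * (c : ℝ) ^ (α - 1) * c := by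
  rcases eq_or_ne c 0 with rfl | hc
  · have h1 : (0 : ℝ) ^ α = 0 := Real.zero_rpow (by linarith)
    have h2 : (0 : ℝ) ^ (α - 1) = 0 := Real.zero_rpow (by linarith)
    simp only [NNReal.coe_zero, h1, h2]
    have : 0 ≤ (s : ℝ) ^ α := by positivity
    linarith
  · have hc0 : (0 : ℝ) < c := by exact_mod_cast pos_iff_ne_zero.2 hc
    have hs0 : (0 : ℝ) ≤ s := s.coe_nonneg
    have h1 := one_add_mul_self_le_rpow_one_add (s := (s : ℝ) / c - 1)
      (by have : 0 ≤ (s : ℝ) / c := by positivity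
          linarith) (p := α) (by linarith)
    rw [add_sub_cancel, Real.div_rpow hs0 hc0.le, le_div_iff₀ (by positivity)] at h1
    have h2 : (c : ℝ) ^ α = (c : ℝ) ^ (α - 1) * c := by
      rw [← Real.rpow_add_one hc0.ne']; congr 1; ring
    have h3 : (1 + α * ((s : ℝ) / c - 1)) * (c : ℝ) ^ α
        = (c : ℝ) ^ α + α * (c : ℝ) ^ (α - 1) * s - α * (c : ℝ) ^ (α - 1) * c := by
      rw [h2]; field_simp; ring
    linarith

namespace IsFlow

variable {x y x' y' : ℝ} {σ σ' : ℝ → ℝ≥0} {V V' : ℝ → ℝ}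

/-- If the average speed is at most `c`, then the speed cost is, up to a linear term, at least the
one of constant speed `c`. -/
theorem ofReal_rpow_mul_le {α : ℝ} (hα : 2 ≤ α) (hF : IsFlow x y σ V) (hxy : x ≤ y) (c : ℝ≥0)
    (hc : V y - V x ≤ c * (y - x)) :
    ENNReal.ofReal ((c : ℝ) ^ α * (y - x)) ≤ (∫⁻ z in Set.Ico x y, (σ z : ℝ≥0∞) ^ α) +
      ENNReal.ofReal (α * (c : ℝ) ^ (α - 1) * (c * (y - x) - (V y - V x))) := by
  set k : ℝ := α * (c : ℝ) ^ (α - 1) with hk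
  have hk0 : 0 ≤ k := by positivity
  have hα0 : 0 ≤ α := by linarith
  have hV : 0 ≤ V y - V x := sub_nonneg.2 (hF.mono ⟨le_rfl, hxy⟩ ⟨hxy, le_rfl⟩ hxy)
  have hpt : ∀ z, ENNReal.ofReal ((c : ℝ) ^ α) + ENNReal.ofReal k * (σ z : ℝ≥0∞) ≤
      (σ z : ℝ≥0∞) ^ α + ENNReal.ofReal (k * c) := by
    intro z
    rw [← ENNReal.ofReal_coe_nnreal (p := σ z), ENNReal.ofReal_rpow_of_nonneg (σ z).coe_nonneg hα0,
      ← ENNReal.ofReal_mul hk0, ← ENNReal.ofReal_add (by positivity) (by positivity),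
      ← ENNReal.ofReal_add (by positivity) (by positivity)]
    exact ENNReal.ofReal_le_ofReal (rpow_add_tangent_le hα c (σ z))
  have hint := lintegral_mono (μ := volume.restrict (Set.Ico x y)) hpt
  rw [lintegral_add_left measurable_const, lintegral_add_right _ measurable_const,
    lintegral_const_mul' _ _ ENNReal.ofReal_ne_top, hF.mass x y le_rfl hxy le_rfl,
    setLIntegral_const, setLIntegral_const, Real.volume_Ico, ← ENNReal.ofReal_mul hk0,
    ← ENNReal.ofReal_mul (by positivity), ← ENNReal.ofReal_mul (by positivity)] at hint
  have hsplit : ENNReal.ofReal (k * c * (y - x)) = ENNReal.ofReal (k * (V y - V x)) +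
      ENNReal.ofReal (k * (c * (y - x) - (V y - V x))) := by
    rw [← ENNReal.ofReal_add (by positivity) (mul_nonneg hk0 (by linarith))]
    congr 1; ring
  rw [hsplit, add_comm (ENNReal.ofReal (k * (V y - V x))), ← add_assoc] at hint
  exact (ENNReal.add_le_add_iff_right ENNReal.ofReal_ne_top).1 hint

end IsFlow

/-! ### Schedules and flows -/

namespace AgreeableInstance

variable (P : AgreeableInstance)

/-- The total workload of the jobs preceding job `m`. -/
def cw (m : ℕ) : ℝ := ∑ l ∈ Finset.range m, P.w l

theorem cw_succ (m : ℕ) : P.cw (m + 1) = P.cw m + P.w m := Finset.sum_range_succ _ _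

theorem sum_Ico_w {a b : ℕ} (h : a ≤ b) : ∑ l ∈ Finset.Ico a b, P.w l = P.cw b - P.cw a :=
  Finset.sum_Ico_eq_sub _ h

theorem sum_Icc_w {a b : ℕ} (h : a ≤ b + 1) :
    ∑ l ∈ Finset.Icc a b, P.w l = P.cw (b + 1) - P.cw a := by
  rw [← Finset.Ico_add_one_right_eq_Icc, P.sum_Ico_w h]

theorem cw_lt_succ {l : ℕ} (h1 : 1 ≤ l) (hn : l ≤ P.n) : P.cw l < P.cw (l + 1) := by
  rw [cw_succ]
  linarith [P.w_pos l h1 hn]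

theorem cw_mono {a b : ℕ} (h1 : 1 ≤ a) (hab : a ≤ b) (hb : b ≤ P.n + 1) : P.cw a ≤ P.cw b := by
  induction b, hab using Nat.le_induction with
  | base => exact le_rfl
  | succ k hk ih => exact (ih (by omega)).trans (P.cw_lt_succ (by omega) (by omega)).le

theorem cw_lt {a b : ℕ} (h1 : 1 ≤ a) (hab : a < b) (hb : b ≤ P.n + 1) : P.cw a < P.cw b :=
  (P.cw_lt_succ h1 (by omega)).trans_le (P.cw_mono (by omega) hab hb)

theorem r_le {a b : ℕ} (h1 : 1 ≤ a) (hab : a ≤ b) (hb : b ≤ P.n) : P.r a ≤ P.r b := by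
  rcases hab.eq_or_lt with rfl | h
  · exact le_rfl
  · exact P.r_mono a b h1 h hb

theorem d_le {a b : ℕ} (h1 : 1 ≤ a) (hab : a ≤ b) (hb : b ≤ P.n) : P.d a ≤ P.d b := by
  rcases hab.eq_or_lt with rfl | h
  · exact le_rfl
  · exact P.d_mono a b h1 h hb

/-- The amount of processed work `V` of a flow on `[x, y)`, counted from the total workload of the
jobs preceding `a`, allows the jobs `a, …, m - 1` to be processed in the order of their numbers
within their windows. -/
structure Feasible (x y : ℝ) (a m : ℕ) (V : ℝ → ℝ) : Prop where
  left : V x = P.cw a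
  right : V y = P.cw m
  rel : ∀ l, a ≤ l → l < m → ∀ t ∈ Set.Icc x y, t ≤ P.r l → V t ≤ P.cw l
  dead : ∀ l, a ≤ l → l < m → ∀ t ∈ Set.Icc x y, P.d l ≤ t → P.cw (l + 1) ≤ V t

variable {P} {x y : ℝ} {J : Finset ℕ}

namespace Schedule

theorem rightConst_speed (S : P.Schedule (Set.Ico x y) J) : RightConstOn S.speed x y := by
  intro t ht
  obtain ⟨a, b, ha, hb, h⟩ := S.piecewise_constant t ht
  exact ⟨b, hb, fun z hz hzy =>
    (h z ⟨⟨ha.trans hz.1, hz.2⟩, ⟨ht.1.trans hz.1, hzy⟩⟩).2.1⟩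

theorem rightConst_mode (S : P.Schedule (Set.Ico x y) J) : RightConstOn S.mode x y := by
  intro t ht
  obtain ⟨a, b, ha, hb, h⟩ := S.piecewise_constant t ht
  exact ⟨b, hb, fun z hz hzy =>
    (h z ⟨⟨ha.trans hz.1, hz.2⟩, ⟨ht.1.trans hz.1, hzy⟩⟩).1⟩

theorem rightConst_job (S : P.Schedule (Set.Ico x y) J) : RightConstOn S.job x y := by
  intro t ht
  obtain ⟨a, b, ha, hb, h⟩ := S.piecewise_constant t ht
  exact ⟨b, hb, fun z hz hzy =>
    (h z ⟨⟨ha.trans hz.1, hz.2⟩, ⟨ht.1.trans hz.1, hzy⟩⟩).2.2⟩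

theorem measurableSet_job (S : P.Schedule (Set.Ico x y) J) (l : ℕ) :
    MeasurableSet {t | t ∈ Set.Ico x y ∧ S.job t = some l} :=
  S.rightConst_job.measurableSet_preimage {some l}

theorem measurableSet_onSet (S : P.Schedule (Set.Ico x y) J) : MeasurableSet S.onSet :=
  S.rightConst_mode.measurableSet_preimage {Mode.on}

/-- The work processed before time `t` is the sum of the work on the single jobs. -/
theorem lintegral_speed_eq_sum (S : P.Schedule (Set.Ico x y) J) {t : ℝ} (ht : t ≤ y) :
    ∫⁻ z in Set.Ico x t, (S.speed z : ℝ≥0∞) =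
      ∑ l ∈ J, ∫⁻ z in {z | z ∈ Set.Ico x y ∧ S.job z = some l} ∩ Set.Ico x t,
        (S.speed z : ℝ≥0∞) := by
  have hsub : Set.Ico x t ⊆ Set.Ico x y := Set.Ico_subset_Ico_right ht
  have h1 : ∫⁻ z in Set.Ico x t, (S.speed z : ℝ≥0∞) =
      ∫⁻ z in Set.Ico x t, ∑ l ∈ J, Set.indicator {z | z ∈ Set.Ico x y ∧ S.job z = some l}
        (fun z => (S.speed z : ℝ≥0∞)) z := by
    refine setLIntegral_congr_fun measurableSet_Ico fun z hz => ?_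
    simp only [Set.indicator_apply, Set.mem_ofPred_eq, hsub hz, true_and]
    rcases hj : S.job z with _ | k
    · have := (S.speed_eq_zero_iff z (hsub hz)).2 hj
      simp [this]
    · have hk := (S.job_window z (hsub hz) k hj).1
      simp [Finset.sum_ite_eq, hk]
  rw [h1, lintegral_finsetSum']
  · refine Finset.sum_congr rfl fun l _ => ?_
    rw [setLIntegral_indicator (S.measurableSet_job l)]
  · intro l _
    refine AEMeasurable.indicator ?_ (S.measurableSet_job l)
    exact ((S.rightConst_speed.mono le_rfl ht).aemeasurable).coe_nnreal_ennreal

/-- The flow underlying a schedule; it satisfies the release and deadline bounds. -/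
theorem exists_flow {a m : ℕ} (S : P.Schedule (Set.Ico x y) (Finset.Ico a m)) (h1 : 1 ≤ a)
    (ham : a ≤ m) (hm : m ≤ P.n + 1) (hxy : x ≤ y) :
    ∃ V, IsFlow x y S.speed V ∧ P.Feasible x y a m V := by
  have hw : ∀ l ∈ Finset.Ico a m, 0 ≤ P.w l := fun l hl => by
    rw [Finset.mem_Ico] at hl
    exact (P.w_pos l (by omega) (by omega)).le
  have htot : ∫⁻ z in Set.Ico x y, (S.speed z : ℝ≥0∞) = ENNReal.ofReal (P.cw m - P.cw a) := by
    rw [S.lintegral_speed_eq_sum le_rfl, ← P.sum_Ico_w ham, ENNReal.ofReal_sum_of_nonneg hw]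
    refine Finset.sum_congr rfl fun l hl => ?_
    rw [← S.work l hl]
    congr 2
    exact Set.inter_eq_left.2 fun z hz => hz.1
  have hint : IntegrableOn (fun z => (S.speed z : ℝ)) (Set.Icc x y) := by
    rw [integrableOn_Icc_iff_integrableOn_Ico]
    refine ⟨(S.rightConst_speed.aemeasurable.coe_nnreal_real).aestronglyMeasurable, ?_⟩
    rw [hasFiniteIntegral_iff_ofReal (Filter.Eventually.of_forall fun z => NNReal.coe_nonneg _)]
    simp only [ENNReal.ofReal_coe_nnreal]
    rw [htot]
    exact ENNReal.ofReal_lt_top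
  have hII : ∀ s t, x ≤ s → s ≤ t → t ≤ y →
      IntervalIntegrable (fun z => (S.speed z : ℝ)) volume s t := by
    intro s t hs hst ht
    rw [intervalIntegrable_iff_integrableOn_Icc_of_le hst]
    exact hint.mono_set (Set.Icc_subset_Icc hs ht)
  set V : ℝ → ℝ := fun t => P.cw a + ∫ z in x..t, (S.speed z : ℝ) with hV
  have hVsub : ∀ s t, x ≤ s → s ≤ t → t ≤ y → V t - V s = ∫ z in s..t, (S.speed z : ℝ) := by
    intro s t hs hst ht
    rw [hV]
    simp only
    rw [← intervalIntegral.integral_add_adjacent_intervals (hII x s le_rfl hs (hst.trans ht))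
      (hII s t hs hst ht)]
    ring
  have hmass : ∀ s t, x ≤ s → s ≤ t → t ≤ y →
      ∫⁻ z in Set.Ico s t, (S.speed z : ℝ≥0∞) = ENNReal.ofReal (V t - V s) := by
    intro s t hs hst ht
    rw [hVsub s t hs hst ht, intervalIntegral.integral_of_le hst, ← integral_Ico_eq_integral_Ioc,
      ofReal_integral_eq_lintegral_ofReal]
    · simp only [ENNReal.ofReal_coe_nnreal]
    · exact hint.mono_set (Set.Ico_subset_Icc_self.trans (Set.Icc_subset_Icc hs ht))
    · exact Filter.Eventually.of_forall fun z => NNReal.coe_nonneg _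
  have hmono : MonotoneOn V (Set.Icc x y) := by
    intro s hs t ht hst
    rw [← sub_nonneg, hVsub s t hs.1 hst ht.2]
    exact intervalIntegral.integral_nonneg hst fun z _ => NNReal.coe_nonneg _
  have hVx : V x = P.cw a := by simp [hV]
  have hle : P.cw a ≤ P.cw m := P.cw_mono h1 ham hm
  have hVt : ∀ t ∈ Set.Icc x y, ENNReal.ofReal (V t - P.cw a) =
      ∑ l ∈ Finset.Ico a m, ∫⁻ z in {z | z ∈ Set.Ico x y ∧ S.job z = some l} ∩ Set.Ico x t,
        (S.speed z : ℝ≥0∞) := by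
    intro t ht
    rw [← S.lintegral_speed_eq_sum ht.2, hmass x t le_rfl ht.1 ht.2, hVx]
  refine ⟨V, ⟨S.rightConst_speed, hmass, hmono, ?_⟩, hVx, ?_, ?_, ?_⟩
  · have := intervalIntegral.continuousOn_primitive_interval (μ := volume) (a := x) (b := y)
      (f := fun z => (S.speed z : ℝ)) (by rwa [Set.uIcc_of_le hxy])
    rw [Set.uIcc_of_le hxy] at this
    exact continuousOn_const.add this
  · have h := hmass x y le_rfl hxy le_rfl
    rw [htot, hVx] at h
    have h2 : P.cw a ≤ V y := by rw [← hVx]; exact hmono ⟨le_rfl, hxy⟩ ⟨hxy, le_rfl⟩ hxy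
    have := (ENNReal.ofReal_eq_ofReal_iff (sub_nonneg.2 hle) (sub_nonneg.2 h2)).1 h
    linarith
  · intro l hal hlm t ht htr
    have h := hVt t ht
    -- before the release of `l`, no job from `l` on is processed
    have hz : ∀ k ∈ Finset.Ico a m, k ∉ Finset.Ico a l →
        ∫⁻ z in {z | z ∈ Set.Ico x y ∧ S.job z = some k} ∩ Set.Ico x t,
          (S.speed z : ℝ≥0∞) = 0 := by
      intro k hk hkl
      rw [Finset.mem_Ico] at hk hkl
      have : {z | z ∈ Set.Ico x y ∧ S.job z = some k} ∩ Set.Ico x t = ∅ := by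
        ext z
        simp only [Set.mem_inter_iff, Set.mem_ofPred_eq, Set.mem_empty_iff_false, iff_false, not_and]
        rintro ⟨hz, hjob⟩ hzt
        have h3 := (S.job_window z hz k hjob).2.1
        have h4 := P.r_le (a := l) (b := k) (by omega) (by omega) (by omega)
        linarith [hzt.2]
      rw [this]; simp
    rw [← Finset.sum_subset (Finset.Ico_subset_Ico_right hlm.le) hz] at h
    have h5 : ENNReal.ofReal (V t - P.cw a) ≤ ENNReal.ofReal (P.cw l - P.cw a) := by
      rw [h, ← P.sum_Ico_w hal, ENNReal.ofReal_sum_of_nonneg fun k hk => hw k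
        (Finset.Ico_subset_Ico_right hlm.le hk)]
      refine Finset.sum_le_sum fun k hk => ?_
      rw [← S.work k (Finset.Ico_subset_Ico_right hlm.le hk)]
      exact lintegral_mono_set Set.inter_subset_left
    have h6 := (ENNReal.ofReal_le_ofReal_iff
      (sub_nonneg.2 (P.cw_mono h1 hal (by omega)))).1 h5
    linarith
  · intro l hal hlm t ht htd
    have h := hVt t ht
    -- from the deadline of `l` on, the jobs up to `l` are completed
    have h5 : ENNReal.ofReal (P.cw (l + 1) - P.cw a) ≤ ENNReal.ofReal (V t - P.cw a) := by
      rw [h, ← P.sum_Ico_w (by omega : a ≤ l + 1), ENNReal.ofReal_sum_of_nonneg fun k hk => hw k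
        (Finset.Ico_subset_Ico_right hlm hk)]
      refine (Finset.sum_le_sum fun k hk => ?_).trans
        (Finset.sum_le_sum_of_subset (Finset.Ico_subset_Ico_right hlm))
      rw [← S.work k (Finset.Ico_subset_Ico_right hlm hk)]
      refine lintegral_mono_set fun z hz => ⟨hz, hz.1.1, ?_⟩
      rw [Finset.mem_Ico] at hk
      have h3 := (S.job_window z hz.1 k hz.2).2.2
      have h4 := P.d_le (a := k) (b := l) (by omega) (by omega) (by omega)
      linarith
    have h2 : P.cw a ≤ V t := by rw [← hVx]; exact hmono ⟨le_rfl, hxy⟩ ht ht.1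
    have h6 := (ENNReal.ofReal_le_ofReal_iff (sub_nonneg.2 h2)).1 h5
    linarith

end Schedule

/-- A feasible flow is realised by the schedule that processes the jobs in the order of their
numbers. -/
theorem Feasible.exists_schedule {a m : ℕ} {σ : ℝ → ℝ≥0} {V : ℝ → ℝ} {μ : ℝ → Mode}
    (hV : P.Feasible x y a m V) (hF : IsFlow x y σ V) (h1 : 1 ≤ a) (ham : a ≤ m)
    (hm : m ≤ P.n + 1) (hxy : x ≤ y) (hμ : RightConstOn μ x y)
    (hon : ∀ t ∈ Set.Ico x y, 0 < σ t → μ t = Mode.on) :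
    ∃ S : P.Schedule (Set.Ico x y) (Finset.Ico a m), S.speed = σ ∧ S.mode = μ := by
  classical
  -- at time `t`, the job `l` with `cw l ≤ V t < cw (l + 1)` is processed
  set J : ℝ → ℕ := fun t => Nat.findGreatest (fun l => P.cw l ≤ V t) (m - 1) with hJ
  have hlo : ∀ t ∈ Set.Icc x y, P.cw a ≤ V t := fun t ht => by
    rw [← hV.left]; exact hF.mono ⟨le_rfl, hxy⟩ ht ht.1
  have hpos : ∀ t ∈ Set.Ico x y, σ t ≠ 0 → V t < P.cw m := fun t ht hσ => by
    rw [← hV.right]; exact hF.lt_of_pos ht hσ ht.2 le_rfl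
  have hJspec : ∀ t ∈ Set.Ico x y, σ t ≠ 0 →
      a ≤ J t ∧ J t < m ∧ P.cw (J t) ≤ V t ∧ V t < P.cw (J t + 1) := by
    intro t ht hσ
    have h2 := hlo t ⟨ht.1, ht.2.le⟩
    have h3 := hpos t ht hσ
    have ham' : a < m := by
      rcases ham.eq_or_lt with rfl | h
      · linarith
      · exact h
    have h4 : a ≤ J t := Nat.le_findGreatest (by omega) h2
    have h5 : J t ≤ m - 1 := Nat.findGreatest_le _
    refine ⟨h4, by omega, Nat.findGreatest_spec (P := fun l => P.cw l ≤ V t) (m := a)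
      (by omega) h2, ?_⟩
    by_cases h6 : J t + 1 ≤ m - 1
    · have := Nat.findGreatest_is_greatest (P := fun l => P.cw l ≤ V t) (k := J t + 1)
        (n := m - 1) (Nat.lt_succ_self _) h6
      exact not_le.1 this
    · have : J t + 1 = m := by omega
      rw [this]; exact h3
  have huniq : ∀ t k l, a ≤ k → k < m → a ≤ l → l < m → P.cw k ≤ V t → V t < P.cw (k + 1) →
      P.cw l ≤ V t → V t < P.cw (l + 1) → k = l := by
    intro t k l hk hkm hl hlm h2 h3 h4 h5
    rcases lt_trichotomy k l with h | h | h
    · have := P.cw_mono (a := k + 1) (b := l) (by omega) h (by omega)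
      linarith
    · exact h
    · have := P.cw_mono (a := l + 1) (b := k) (by omega) h (by omega)
      linarith
  set job : ℝ → Option ℕ := fun t => if σ t = 0 then none else some (J t) with hjob
  have hjob_iff : ∀ t ∈ Set.Ico x y, ∀ l, a ≤ l → l < m → (job t = some l ↔
      σ t ≠ 0 ∧ P.cw l ≤ V t ∧ V t < P.cw (l + 1)) := by
    intro t ht l hl hlm
    by_cases hσ : σ t = 0
    · simp [hjob, hσ]
    · obtain ⟨q1, q2, q3, q4⟩ := hJspec t ht hσ
      simp only [hjob, hσ, if_false, Option.some.injEq, ne_eq, not_false_eq_true, true_and]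
      constructor
      · rintro rfl; exact ⟨q3, q4⟩
      · rintro ⟨h2, h3⟩
        exact huniq t _ _ q1 q2 hl hlm q3 q4 h2 h3
  refine ⟨⟨μ, σ, job, hon, ?_, ?_, ?_, ?_⟩, rfl, rfl⟩
  · intro t _
    by_cases hσ : σ t = 0 <;> simp [hjob, hσ]
  · intro t ht l hl
    have hσ : σ t ≠ 0 := by
      intro h; simp [hjob, h] at hl
    have hlJ : J t = l := by simpa [hjob, hσ] using hl
    obtain ⟨q1, q2, q3, q4⟩ := hJspec t ht hσ
    rw [hlJ] at q1 q2 q3 q4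
    refine ⟨Finset.mem_Ico.2 ⟨q1, q2⟩, ?_, ?_⟩
    · -- just after `t`, some work of job `l` has been processed
      by_contra hcon
      rw [not_le] at hcon
      set z := min (P.r l) y with hz
      have htz : t < z := lt_min hcon ht.2
      have h2 := hF.lt_of_pos ht hσ htz (min_le_right _ _)
      have h3 := hV.rel l q1 q2 z ⟨ht.1.trans htz.le, min_le_right _ _⟩ (min_le_left _ _)
      linarith
    · by_contra hcon
      rw [not_lt] at hcon
      have h3 := hV.dead l q1 q2 t ⟨ht.1, ht.2.le⟩ hcon
      linarith
  · intro l hl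
    rw [Finset.mem_Ico] at hl
    have e1 : P.cw a ≤ P.cw l := P.cw_mono h1 hl.1 (by omega)
    have e2 : P.cw (l + 1) ≤ P.cw m := P.cw_mono (by omega) hl.2 hm
    have e3 : P.cw l < P.cw (l + 1) := P.cw_lt_succ (by omega) (by omega)
    have hIVT := intermediate_value_Icc hxy hF.cont
    rw [hV.left, hV.right] at hIVT
    obtain ⟨p, hp, hVp⟩ := hIVT ⟨e1, (e3.le.trans e2)⟩
    obtain ⟨q, hq, hVq⟩ := hIVT ⟨e1.trans e3.le, e2⟩
    have hpq : p ≤ q := by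
      by_contra hcon
      have := hF.mono hq hp (not_le.1 hcon).le
      linarith
    -- job `l` is processed while `V` increases from `cw l` to `cw (l + 1)`
    have hset : {t | t ∈ Set.Ico x y ∧ job t = some l} =
        {t | t ∈ Set.Ico x y ∧ σ t ∈ ({0}ᶜ : Set ℝ≥0)} ∩ Set.Ico p q := by
      ext t
      simp only [Set.mem_ofPred_eq, Set.mem_inter_iff, Set.mem_compl_iff, Set.mem_singleton_iff]
      constructor
      · rintro ⟨ht, hj⟩
        obtain ⟨hσ, h2, h3⟩ := (hjob_iff t ht l hl.1 hl.2).1 hj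
        refine ⟨⟨ht, hσ⟩, ?_, ?_⟩
        · by_contra hcon
          have := hF.lt_of_pos ht hσ (not_le.1 hcon) hp.2
          linarith
        · by_contra hcon
          have := hF.mono hq ⟨ht.1, ht.2.le⟩ (not_lt.1 hcon)
          linarith
      · rintro ⟨⟨ht, hσ⟩, hpq'⟩
        refine ⟨ht, (hjob_iff t ht l hl.1 hl.2).2 ⟨hσ, ?_, ?_⟩⟩
        · rw [← hVp]; exact hF.mono hp ⟨ht.1, ht.2.le⟩ hpq'.1
        · rw [← hVq]; exact hF.lt_of_pos ht hσ hpq'.2 hq.2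
    rw [hset, ← setLIntegral_indicator (hF.rightConst.measurableSet_preimage _)]
    have : ∫⁻ t in Set.Ico p q, Set.indicator {t | t ∈ Set.Ico x y ∧ σ t ∈ ({0}ᶜ : Set ℝ≥0)}
        (fun t => (σ t : ℝ≥0∞)) t = ∫⁻ t in Set.Ico p q, (σ t : ℝ≥0∞) := by
      refine setLIntegral_congr_fun measurableSet_Ico fun t ht => ?_
      have htT : t ∈ Set.Ico x y := ⟨hp.1.trans ht.1, ht.2.trans_le hq.2⟩
      by_cases hσ : σ t = 0 <;> simp [hσ, htT.1, htT.2]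
    rw [this, hF.mass p q hp.1 hpq hq.2, hVp, hVq, cw_succ]
    congr 1; ring
  · intro t ht
    obtain ⟨b1, hb1, hc1⟩ := hμ t ht
    obtain ⟨b2, hb2, hc2⟩ := hF.rightConst t ht
    by_cases hσ : σ t = 0
    · refine ⟨t, min b1 b2, le_rfl, lt_min hb1 hb2, fun z hz => ?_⟩
      have hz1 := hc1 z ⟨hz.1.1, hz.1.2.trans_le (min_le_left _ _)⟩ hz.2.2
      have hz2 := hc2 z ⟨hz.1.1, hz.1.2.trans_le (min_le_right _ _)⟩ hz.2.2
      exact ⟨hz1, hz2, by simp [hjob, hz2, hσ]⟩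
    · obtain ⟨q1, q2, q3, q4⟩ := hJspec t ht hσ
      -- by continuity of `V`, the processed job does not change immediately after `t`
      have hnear : ∃ b3, t < b3 ∧ ∀ z ∈ Set.Ico t b3, z < y → V z < P.cw (J t + 1) := by
        have hev : ∀ᶠ z in nhdsWithin t (Set.Icc x y), V z < P.cw (J t + 1) :=
          (hF.cont t ⟨ht.1, ht.2.le⟩).eventually (gt_mem_nhds q4)
        rw [eventually_nhdsWithin_iff, Metric.eventually_nhds_iff] at hev
        obtain ⟨ε, hε, h⟩ := hev
        refine ⟨t + ε, by linarith, fun z hz hzy => h ?_ ⟨ht.1.trans hz.1, hzy.le⟩⟩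
        rw [Real.dist_eq, abs_lt]
        constructor <;> linarith [hz.1, hz.2]
      obtain ⟨b3, hb3, hc3⟩ := hnear
      refine ⟨t, min b1 (min b2 b3), le_rfl, lt_min hb1 (lt_min hb2 hb3), fun z hz => ?_⟩
      have hz1 := hc1 z ⟨hz.1.1, hz.1.2.trans_le (min_le_left _ _)⟩ hz.2.2
      have hz2 := hc2 z ⟨hz.1.1, hz.1.2.trans_le ((min_le_right _ _).trans (min_le_left _ _))⟩
        hz.2.2
      have hz3 := hc3 z ⟨hz.1.1, hz.1.2.trans_le ((min_le_right _ _).trans (min_le_right _ _))⟩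
        hz.2.2
      refine ⟨hz1, hz2, ?_⟩
      have hjt : job t = some (J t) := by simp [hjob, hσ]
      rw [hjt, hjob_iff z hz.2 _ q1 q2]
      refine ⟨by rw [hz2]; exact hσ, q3.trans ?_, hz3⟩
      exact hF.mono ⟨ht.1, ht.2.le⟩ ⟨hz.2.1, hz.2.2.le⟩ hz.1.1

end AgreeableInstance

/-! ### Costs of schedules and gluing of schedules -/

namespace AgreeableInstance

variable (P : AgreeableInstance)

/-- There is a schedule on the set of times `T` for the jobs in `J` of speed cost plus mode cost at
most `c`. -/
def HasSched (T : Set ℝ) (J : Finset ℕ) (c : ℝ≥0∞) : Prop :=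
  ∃ S : P.Schedule T J, S.speedCost + S.modeCost ≤ c

theorem sStar_pos : 0 < P.sStar := by
  have := P.two_le_α
  have := P.g_pos
  exact Real.rpow_pos_of_pos (div_pos P.g_pos (by linarith)) _

theorem sStar_rpow : P.sStar ^ P.α = P.g / (P.α - 1) := by
  have h := P.two_le_α
  have := P.g_pos
  have : 0 ≤ P.g / (P.α - 1) := (div_pos P.g_pos (by linarith)).le
  rw [sStar, ← Real.rpow_mul this, one_div, inv_mul_cancel₀ (by linarith), Real.rpow_one]

theorem gStar_mul_sStar : P.gStar * P.sStar = P.g + P.sStar ^ P.α :=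
  div_mul_cancel₀ _ P.sStar_pos.ne'

theorem gStar_nonneg : 0 ≤ P.gStar := by
  have := P.sStar_pos
  have := P.g_pos
  unfold gStar
  positivity

/-- The energy per unit of work at critical speed is the marginal energy there. -/
theorem gStar_eq : P.gStar = P.α * P.sStar ^ (P.α - 1) := by
  have h := P.two_le_α
  have hs := P.sStar_pos
  have h1 : P.sStar ^ (P.α - 1) * P.sStar = P.sStar ^ P.α := by
    rw [← Real.rpow_add_one hs.ne']; congr 1; ring
  have h2 : P.α * P.sStar ^ (P.α - 1) * P.sStar = P.gStar * P.sStar := by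
    rw [gStar_mul_sStar, mul_assoc, h1, sStar_rpow]
    have : P.α - 1 ≠ 0 := by linarith
    field_simp
    ring
  exact (mul_right_cancel₀ hs.ne' h2).symm

/-- The critical speed as a nonnegative real. -/
def sCrit : ℝ≥0 := ⟨P.sStar, P.sStar_pos.le⟩

theorem coe_sCrit : (P.sCrit : ℝ) = P.sStar := rfl

/-- The critical speed minimises the energy per unit of work. -/
theorem gStar_mul_le (s : ℝ≥0) : P.gStar * s ≤ (s : ℝ) ^ P.α + P.g := by
  have h := rpow_add_tangent_le P.two_le_α P.sCrit s
  rw [coe_sCrit, ← gStar_eq, gStar_mul_sStar] at h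
  linarith

variable {P} {x y : ℝ} {J : Finset ℕ}

namespace Schedule

theorem mode_eq_off_of_ne {μ : Mode} (h : μ ≠ Mode.on) : μ = Mode.off := by
  cases μ <;> simp_all

/-- Every unit of work costs at least `g*`, even if only the on-time is charged. -/
theorem ofReal_gStar_mul_le {V : ℝ → ℝ} (S : P.Schedule (Set.Ico x y) J)
    (hF : IsFlow x y S.speed V) {s t : ℝ} (hs : x ≤ s) (hst : s ≤ t) (ht : t ≤ y) :
    ENNReal.ofReal (P.gStar * (V t - V s)) ≤ (∫⁻ z in Set.Ico s t, (S.speed z : ℝ≥0∞) ^ P.α) +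
      ENNReal.ofReal P.g * volume (S.onSet ∩ Set.Ico s t) := by
  have hα0 : 0 ≤ P.α := by linarith [P.two_le_α]
  rw [ENNReal.ofReal_mul P.gStar_nonneg, ← hF.mass s t hs hst ht,
    ← lintegral_const_mul' _ _ ENNReal.ofReal_ne_top, ← setLIntegral_const,
    ← setLIntegral_indicator S.measurableSet_onSet,
    ← lintegral_add_right _ (measurable_const.indicator S.measurableSet_onSet)]
  refine setLIntegral_mono' measurableSet_Ico fun z hz => ?_
  have hzT : z ∈ Set.Ico x y := ⟨hs.trans hz.1, hz.2.trans_le ht⟩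
  by_cases h0 : S.speed z = 0
  · simp [h0]
  · have hon : z ∈ S.onSet := ⟨hzT, S.on_of_speed_pos z hzT (pos_iff_ne_zero.2 h0)⟩
    rw [Set.indicator_of_mem hon, ← ENNReal.ofReal_coe_nnreal (p := S.speed z),
      ENNReal.ofReal_rpow_of_nonneg (S.speed z).coe_nonneg hα0, ← ENNReal.ofReal_mul P.gStar_nonneg,
      ← ENNReal.ofReal_add (by positivity) P.g_pos.le]
    exact ENNReal.ofReal_le_ofReal (P.gStar_mul_le _)

/-- Running two schedules one after the other. -/
def glue {τ : ℝ} {J J' : Finset ℕ} (hx : x ≤ τ) (hy : τ ≤ y) (hJ : Disjoint J J')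
    (S : P.Schedule (Set.Ico x τ) J) (S' : P.Schedule (Set.Ico τ y) J') :
    P.Schedule (Set.Ico x y) (J ∪ J') where
  mode t := if t < τ then S.mode t else S'.mode t
  speed t := if t < τ then S.speed t else S'.speed t
  job t := if t < τ then S.job t else S'.job t
  on_of_speed_pos := by
    intro t ht
    by_cases h : t < τ
    · simpa [h] using S.on_of_speed_pos t ⟨ht.1, h⟩
    · simpa [h] using S'.on_of_speed_pos t ⟨not_lt.1 h, ht.2⟩
  speed_eq_zero_iff := by
    intro t ht
    by_cases h : t < τ
    · simpa [h] using S.speed_eq_zero_iff t ⟨ht.1, h⟩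
    · simpa [h] using S'.speed_eq_zero_iff t ⟨not_lt.1 h, ht.2⟩
  job_window := by
    intro t ht l hl
    by_cases h : t < τ
    · simp only [h, if_true] at hl
      have := S.job_window t ⟨ht.1, h⟩ l hl
      exact ⟨Finset.mem_union_left _ this.1, this.2⟩
    · simp only [h, if_false] at hl
      have := S'.job_window t ⟨not_lt.1 h, ht.2⟩ l hl
      exact ⟨Finset.mem_union_right _ this.1, this.2⟩
  work := by
    intro l hl
    rcases Finset.mem_union.1 hl with h1 | h1
    · have hset : {t | t ∈ Set.Ico x y ∧ (if t < τ then S.job t else S'.job t) = some l} =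
          {t | t ∈ Set.Ico x τ ∧ S.job t = some l} := by
        ext t
        by_cases h : t < τ
        · simp [h, h.trans_le hy]
        · simp only [Set.mem_ofPred_eq, Set.mem_Ico, h, if_false, and_false, false_and, iff_false]
          rintro ⟨ht, hl'⟩
          exact Finset.disjoint_left.1 hJ h1 (S'.job_window t ⟨not_lt.1 h, ht.2⟩ l hl').1
      rw [hset, ← S.work l h1]
      refine setLIntegral_congr_fun (S.measurableSet_job l) fun t ht => ?_
      simp [ht.1.2]
    · have hset : {t | t ∈ Set.Ico x y ∧ (if t < τ then S.job t else S'.job t) = some l} =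
          {t | t ∈ Set.Ico τ y ∧ S'.job t = some l} := by
        ext t
        by_cases h : t < τ
        · simp only [Set.mem_ofPred_eq, Set.mem_Ico, h, if_true, not_le.2 h, false_and, iff_false]
          rintro ⟨ht, hl'⟩
          exact Finset.disjoint_left.1 hJ (S.job_window t ⟨ht.1, h⟩ l hl').1 h1
        · simp [h, hx.trans (not_lt.1 h), not_lt.1 h]
      rw [hset, ← S'.work l h1]
      refine setLIntegral_congr_fun (S'.measurableSet_job l) fun t ht => ?_
      simp [not_lt.2 ht.1.1]
  piecewise_constant := by
    intro t ht
    obtain ⟨b, hb, h⟩ := (S.rightConst_mode.glue S'.rightConst_mode) t ht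
    obtain ⟨b', hb', h'⟩ := (S.rightConst_speed.glue S'.rightConst_speed) t ht
    obtain ⟨b'', hb'', h''⟩ := (S.rightConst_job.glue S'.rightConst_job) t ht
    refine ⟨t, min b (min b' b''), le_rfl, lt_min hb (lt_min hb' hb''), fun z hz => ⟨?_, ?_, ?_⟩⟩
    · exact h z ⟨hz.1.1, hz.1.2.trans_le (min_le_left _ _)⟩ hz.2.2
    · exact h' z ⟨hz.1.1, hz.1.2.trans_le ((min_le_right _ _).trans (min_le_left _ _))⟩ hz.2.2
    · exact h'' z ⟨hz.1.1, hz.1.2.trans_le ((min_le_right _ _).trans (min_le_right _ _))⟩ hz.2.2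

theorem cost_glue_le {τ : ℝ} {J J' : Finset ℕ} (hx : x ≤ τ) (hy : τ ≤ y) (hJ : Disjoint J J')
    (S : P.Schedule (Set.Ico x τ) J) (S' : P.Schedule (Set.Ico τ y) J') :
    (glue hx hy hJ S S').speedCost + (glue hx hy hJ S S').modeCost ≤
      (S.speedCost + S.modeCost) + (S'.speedCost + S'.modeCost) := by
  have h1 : (glue hx hy hJ S S').speedCost = S.speedCost + S'.speedCost := by
    unfold speedCost
    rw [lintegral_Ico_add _ hx hy]
    congr 1
    · refine setLIntegral_congr_fun measurableSet_Ico fun z hz => ?_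
      simp [glue, hz.2]
    · refine setLIntegral_congr_fun measurableSet_Ico fun z hz => ?_
      simp [glue, not_lt.2 hz.1]
  have hon : (glue hx hy hJ S S').onSet ⊆ S.onSet ∪ S'.onSet := by
    rintro t ⟨ht, hm⟩
    by_cases h : t < τ
    · exact Or.inl ⟨⟨ht.1, h⟩, by simpa [glue, h] using hm⟩
    · exact Or.inr ⟨⟨not_lt.1 h, ht.2⟩, by simpa [glue, h] using hm⟩
  have hoff : (glue hx hy hJ S S').offSet = S.offSet ∪ S'.offSet := by
    ext t
    by_cases h : t < τ
    · simp only [offSet, glue, Set.mem_ofPred_eq, h, if_true, Set.mem_union, Set.mem_Ico,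
        and_true, not_le.2 h, false_and, or_false, h.trans_le hy]
    · simp only [offSet, glue, Set.mem_ofPred_eq, h, if_false, Set.mem_union, Set.mem_Ico,
        and_false, false_and, false_or, hx.trans (not_lt.1 h), not_lt.1 h]
  have h2 : (glue hx hy hJ S S').modeCost ≤ S.modeCost + S'.modeCost := by
    unfold modeCost
    rw [hoff]
    have e1 : ((maxIntervals (S.offSet ∪ S'.offSet)).encard : ℝ≥0∞) ≤
        (maxIntervals S.offSet).encard + (maxIntervals S'.offSet).encard := by
      rw [← ENat.toENNReal_add, ENat.toENNReal_le]
      exact encard_maxIntervals_union_le _ _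
    have e2 : volume (glue hx hy hJ S S').onSet ≤ volume S.onSet + volume S'.onSet :=
      (measure_mono hon).trans (measure_union_le _ _)
    calc _ ≤ ((maxIntervals S.offSet).encard + (maxIntervals S'.offSet).encard : ℝ≥0∞) *
          ENNReal.ofReal P.L + ENNReal.ofReal P.g * (volume S.onSet + volume S'.onSet) := by gcongr
      _ = _ := by ring
  calc _ ≤ (S.speedCost + S'.speedCost) + (S.modeCost + S'.modeCost) := by rw [h1]; gcongr
    _ = _ := by ring

end Schedule

theorem HasSched.glue {τ : ℝ} {a b c : ℕ} {k k' : ℝ≥0∞} (hx : x ≤ τ) (hy : τ ≤ y) (hab : a ≤ b)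
    (hbc : b ≤ c) (h : P.HasSched (Set.Ico x τ) (Finset.Ico a b) k)
    (h' : P.HasSched (Set.Ico τ y) (Finset.Ico b c) k') :
    P.HasSched (Set.Ico x y) (Finset.Ico a c) (k + k') := by
  obtain ⟨S, hS⟩ := h
  obtain ⟨S', hS'⟩ := h'
  rw [← Finset.Ico_union_Ico_eq_Ico hab hbc]
  exact ⟨Schedule.glue hx hy (Finset.Ico_disjoint_Ico_consecutive a b c) S S',
    (Schedule.cost_glue_le hx hy _ S S').trans (add_le_add hS hS')⟩

theorem HasSched.mono {T : Set ℝ} {k k' : ℝ≥0∞} (h : P.HasSched T J k) (hk : k ≤ k') :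
    P.HasSched T J k' :=
  h.imp fun _ hS => hS.trans hk

/-- The schedule without jobs in constant mode. -/
def Schedule.idle (P : AgreeableInstance) (x y : ℝ) (μ : Mode) (a : ℕ) :
    P.Schedule (Set.Ico x y) (Finset.Ico a a) where
  mode _ := μ
  speed _ := 0
  job _ := none
  on_of_speed_pos := by simp
  speed_eq_zero_iff := by simp
  job_window := by simp
  work := by simp
  piecewise_constant t ht := ⟨t, t + 1, le_rfl, by linarith, by simp⟩

theorem Schedule.speedCost_idle (x y : ℝ) (μ : Mode) (a : ℕ) :
    (Schedule.idle P x y μ a).speedCost = 0 := by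
  have : 0 < P.α := by linarith [P.two_le_α]
  simp [Schedule.speedCost, Schedule.idle, this]

theorem hasSched_off (x y : ℝ) (a : ℕ) :
    P.HasSched (Set.Ico x y) (Finset.Ico a a) (ENNReal.ofReal P.L) := by
  refine ⟨Schedule.idle P x y Mode.off a, ?_⟩
  have h1 : (Schedule.idle P x y Mode.off a).offSet = Set.Ico x y := by
    ext t
    simp [Schedule.offSet, Schedule.idle]
  have h2 : (Schedule.idle P x y Mode.off a).onSet = ∅ := by
    simp [Schedule.onSet, Schedule.idle]
  rw [Schedule.speedCost_idle, Schedule.modeCost, h1, h2, measure_empty, mul_zero, zero_add,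
    add_zero]
  have : ((maxIntervals (Set.Ico x y)).encard : ℝ≥0∞) ≤ 1 := by
    exact_mod_cast encard_maxIntervals_le_one Set.ordConnected_Ico
  calc _ ≤ 1 * ENNReal.ofReal P.L := by gcongr
    _ = _ := one_mul _

/-- The cost of a schedule that is on all the time. -/
theorem Schedule.modeCost_of_on (S : P.Schedule (Set.Ico x y) J)
    (h : ∀ t ∈ Set.Ico x y, S.mode t = Mode.on) :
    S.modeCost = ENNReal.ofReal (P.g * (y - x)) := by
  have h1 : S.offSet = ∅ := by
    ext t
    simp only [Schedule.offSet, Set.mem_ofPred_eq, Set.mem_empty_iff_false, iff_false, not_and]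
    intro ht
    simp [h t ht]
  have h2 : S.onSet = Set.Ico x y := by
    ext t
    simp only [Schedule.onSet, Set.mem_ofPred_eq, and_iff_left_iff_imp]
    exact h t
  rw [Schedule.modeCost, h1, h2, encard_maxIntervals_empty, Real.volume_Ico,
    ENNReal.ofReal_mul P.g_pos.le]
  simp

theorem hasSched_on (x y : ℝ) (a : ℕ) :
    P.HasSched (Set.Ico x y) (Finset.Ico a a) (ENNReal.ofReal (P.g * (y - x))) := by
  refine ⟨Schedule.idle P x y Mode.on a, ?_⟩
  rw [Schedule.speedCost_idle, Schedule.modeCost_of_on _ fun t _ => rfl, zero_add]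

/-- A feasible flow yields a schedule that is on all the time. -/
theorem Feasible.exists_schedule_on {a m : ℕ} {σ : ℝ → ℝ≥0} {V : ℝ → ℝ}
    (hV : P.Feasible x y a m V) (hF : IsFlow x y σ V) (h1 : 1 ≤ a) (ham : a ≤ m)
    (hm : m ≤ P.n + 1) (hxy : x ≤ y) :
    ∃ S : P.Schedule (Set.Ico x y) (Finset.Ico a m), S.speed = σ ∧
      S.modeCost = ENNReal.ofReal (P.g * (y - x)) := by
  obtain ⟨S, hS, hSm⟩ := hV.exists_schedule hF h1 ham hm hxy
    (μ := fun _ => Mode.on) (RightConstOn.const _) (fun _ _ _ => rfl)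
  exact ⟨S, hS, S.modeCost_of_on fun t _ => by rw [hSm]⟩

/-- Processing jobs at critical speed costs `g*` per unit of work. -/
theorem hasSched_crit {a m : ℕ} {v p : ℝ}
    (hV : P.Feasible x y a m (fun t => v + P.sStar * (t - p))) (h1 : 1 ≤ a) (ham : a ≤ m)
    (hm : m ≤ P.n + 1) (hxy : x ≤ y) :
    P.HasSched (Set.Ico x y) (Finset.Ico a m)
      (ENNReal.ofReal (P.gStar * (P.cw m - P.cw a))) := by
  have hF : IsFlow x y (fun _ => P.sCrit) (fun t => v + P.sStar * (t - p)) :=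
    IsFlow.const x y P.sCrit v p
  obtain ⟨S, hS, hSm⟩ := hV.exists_schedule_on hF h1 ham hm hxy
  refine ⟨S, ?_⟩
  have hα0 : 0 ≤ P.α := by linarith [P.two_le_α]
  have hs := P.sStar_pos
  have hg := P.g_pos
  have hlen : 0 ≤ y - x := by linarith
  have hw : P.cw m - P.cw a = P.sStar * (y - x) := by
    have h2 := hV.left
    have h3 := hV.right
    rw [← h2, ← h3]; ring
  rw [hSm, Schedule.speedCost, hS, setLIntegral_const, Real.volume_Ico,
    ← ENNReal.ofReal_coe_nnreal (p := P.sCrit), ENNReal.ofReal_rpow_of_nonneg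
    (NNReal.coe_nonneg _) hα0, coe_sCrit, ← ENNReal.ofReal_mul (by positivity),
    ← ENNReal.ofReal_add (by positivity) (by positivity), hw, ← mul_assoc, gStar_mul_sStar]
  apply le_of_eq
  congr 1; ring

/-- The value of the subinstances without jobs. -/
theorem O_empty {i : ℕ} (hi : 1 ≤ i) :
    P.O i (i - 1) =
      min (ENNReal.ofReal P.L) (ENNReal.ofReal (P.g * (P.rel i - P.dl (i - 1)))) := by
  have hi' : i - 1 + 1 = i := by omega
  have hJ : Finset.Icc i (i - 1) = Finset.Ico i i := by
    rw [← Finset.Ico_add_one_right_eq_Icc, hi']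
  have hle : ∀ c, P.HasSched (Set.Ico (P.dl (i - 1)) (P.rel i)) (Finset.Ico i i) c →
      P.O i (i - 1) ≤ c := by
    intro c h
    rw [← hJ] at h
    unfold O SubSchedule
    rw [hi']
    obtain ⟨S, hS⟩ := h
    exact (iInf_le _ S).trans hS
  refine le_antisymm (le_min (hle _ (hasSched_off _ _ _)) (hle _ (hasSched_on _ _ _))) ?_
  unfold O SubSchedule
  rw [hi']
  refine le_iInf fun S => ?_
  by_cases hoff : S.offSet.Nonempty
  · refine (min_le_left _ _).trans ?_
    have : (1 : ℝ≥0∞) ≤ ((maxIntervals S.offSet).encard : ℝ≥0∞) := by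
      exact_mod_cast one_le_encard_maxIntervals hoff
    calc ENNReal.ofReal P.L = 1 * ENNReal.ofReal P.L := (one_mul _).symm
      _ ≤ ((maxIntervals S.offSet).encard : ℝ≥0∞) * ENNReal.ofReal P.L := by gcongr
      _ ≤ S.modeCost := le_self_add
      _ ≤ _ := le_add_self
  · refine (min_le_right _ _).trans ?_
    rw [← S.modeCost_of_on]
    · exact le_add_self
    · intro t ht
      by_contra h
      exact hoff ⟨t, ht, Schedule.mode_eq_off_of_ne h⟩

end AgreeableInstance

/-! ### Blocks of the earliest and of the latest schedule at critical speed -/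

namespace AgreeableInstance

variable {P : AgreeableInstance} {i j : ℕ}

theorem dl_eq {m : ℕ} (hm : 1 ≤ m) : P.dl m = P.d m := by
  rw [dl, if_neg (by omega)]

theorem rel_eq {m : ℕ} (hm : m ≤ P.n) : P.rel m = P.r m := by
  rw [rel, if_neg (by omega)]

theorem rRestr_mono {a b : ℕ} (h1 : 1 ≤ a) (hab : a ≤ b) (hb : b ≤ P.n) :
    P.rRestr i a ≤ P.rRestr i b :=
  max_le_max_right _ (P.r_le h1 hab hb)

theorem dRestr_mono {a b : ℕ} (h1 : 1 ≤ a) (hab : a ≤ b) (hb : b ≤ P.n) :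
    P.dRestr j a ≤ P.dRestr j b :=
  min_le_min_right _ (P.d_le h1 hab hb)

/-- In a sparse subinstance, consecutive jobs `a, …, b` can be processed at critical speed within
less than the time between the release of `a` and the deadline of `b`. -/
theorem Sparse.cw_sub_lt (hsp : P.Sparse i j) (hi : 1 ≤ i) (hj : j ≤ P.n) {a b : ℕ} (hia : i ≤ a)
    (hab : a ≤ b) (hbj : b ≤ j) :
    P.cw (b + 1) - P.cw a < P.sStar * (P.dRestr j b - P.rRestr i a) := by
  classical
  have hs := P.sStar_pos
  have hw : ∀ l ∈ Finset.Icc i j, 0 ≤ P.w l := fun l hl => by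
    rw [Finset.mem_Icc] at hl
    exact (P.w_pos l (by omega) (by omega)).le
  rcases lt_or_ge (P.rRestr i a) (P.dRestr j b) with hlt | hge
  · have h := hsp.2 (P.rRestr i a) (P.dRestr j b) (le_max_right _ _) hlt (min_le_right _ _)
    rw [density, div_lt_iff₀ (by linarith)] at h
    refine lt_of_le_of_lt ?_ h
    rw [← P.sum_Icc_w (by omega)]
    refine Finset.sum_le_sum_of_subset_of_nonneg ?_ fun l hl _ => hw l (Finset.mem_filter.1 hl).1
    intro l hl
    rw [Finset.mem_Icc] at hl
    rw [Finset.mem_filter, Finset.mem_Icc]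
    exact ⟨⟨by omega, by omega⟩, Set.Ico_subset_Ico
      (rRestr_mono (by omega) hl.1 (by omega)) (dRestr_mono (by omega) hl.2 (by omega))⟩
  · -- job `a` would have an empty window, so that arbitrarily short intervals contain it
    exfalso
    have hwa := P.w_pos a (by omega) (by omega)
    set ε := min (P.rel (j + 1) - P.dl (i - 1)) (P.w a / P.sStar) with hε
    have hε0 : 0 < ε := lt_min (by linarith [hsp.1]) (div_pos hwa hs)
    have h := hsp.2 (P.dl (i - 1)) (P.dl (i - 1) + ε) le_rfl (by linarith)
      (by have := min_le_left (P.rel (j + 1) - P.dl (i - 1)) (P.w a / P.sStar)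
          linarith)
    rw [density, div_lt_iff₀ (by linarith)] at h
    have h1 : P.w a ≤ ∑ l ∈ Finset.Icc i j with
        Set.Ico (P.rRestr i l) (P.dRestr j l) ⊆
          Set.Ico (P.dl (i - 1)) (P.dl (i - 1) + ε), P.w l := by
      refine Finset.single_le_sum (fun l hl => hw l (Finset.mem_filter.1 hl).1) ?_
      rw [Finset.mem_filter, Finset.mem_Icc, Set.Ico_eq_empty]
      · exact ⟨⟨by omega, by omega⟩, Set.empty_subset _⟩
      · exact not_lt.2 ((dRestr_mono (by omega) hab (by omega)).trans hge)
    have h2 : P.sStar * ε ≤ P.w a := by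
      have := min_le_right (P.rel (j + 1) - P.dl (i - 1)) (P.w a / P.sStar)
      rw [le_div_iff₀ hs] at this
      linarith
    have h3 : P.sStar * (P.dl (i - 1) + ε - P.dl (i - 1)) = P.sStar * ε := by ring
    linarith

theorem le_h {k : ℕ} (hk : k ≤ j) : k ≤ P.h j k := by
  classical
  exact Nat.le_findGreatest hk ⟨le_rfl, fun l h1 h2 => by omega⟩

theorem h_le (k : ℕ) : P.h j k ≤ j := by
  classical
  exact Nat.findGreatest_le _

/-- The jobs `k, …, h k` form a contiguous block when processed as late as possible. -/
theorem h_block {k l : ℕ} (hk : k ≤ j) (hkl : k < l) (hl : l ≤ P.h j k) :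
    P.sStar * (P.dRestr j (P.h j k) - P.dRestr j (l - 1)) ≤ P.cw (P.h j k + 1) - P.cw l := by
  classical
  have hspec := Nat.findGreatest_spec (P := fun c => k ≤ c ∧ ∀ l, k < l → l ≤ c →
    P.dRestr j c - (∑ m ∈ Finset.Icc l c, P.w m) / P.sStar ≤ P.dRestr j (l - 1)) hk
    ⟨le_rfl, fun l h1 h2 => by omega⟩
  have h1 := hspec.2 l hkl hl
  change P.dRestr j (P.h j k) - (∑ m ∈ Finset.Icc l (P.h j k), P.w m) / P.sStar ≤ _ at h1
  rw [P.sum_Icc_w (by omega), sub_le_comm, le_div_iff₀ P.sStar_pos] at h1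
  linarith

/-- In the latest schedule at critical speed, the jobs after `h k` start after the deadline of
`h k`. -/
theorem cw_sub_lt_of_h_lt {k : ℕ} (hk1 : 1 ≤ k) (hk : k ≤ j) :
    ∀ l, P.h j k < l → l ≤ j →
      P.cw (l + 1) - P.cw (P.h j k + 1) < P.sStar * (P.dRestr j l - P.dRestr j (P.h j k)) := by
  classical
  have hs := P.sStar_pos
  have hkh : k ≤ P.h j k := le_h hk
  intro l
  induction l using Nat.strong_induction_on with
  | _ l ih =>
    intro hl hlj
    by_contra hcon
    rw [not_lt] at hcon
    refine Nat.findGreatest_is_greatest (P := fun c => k ≤ c ∧ ∀ l, k < l → l ≤ c →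
      P.dRestr j c - (∑ m ∈ Finset.Icc l c, P.w m) / P.sStar ≤ P.dRestr j (l - 1))
      (n := j) (k := l) hl hlj ⟨by omega, fun m hkm hml => ?_⟩
    rw [P.sum_Icc_w (by omega), sub_le_comm, le_div_iff₀ hs]
    rcases lt_trichotomy m (P.h j k + 1) with h | h | h
    · have := h_block (P := P) hk hkm (by omega : m ≤ P.h j k)
      linarith
    · subst h
      rw [Nat.add_sub_cancel]
      linarith
    · have := ih (m - 1) (by omega) (by omega) (by omega)
      rw [Nat.sub_add_cancel (by omega)] at this
      linarith

/-- If `h k` is not the last job, its deadline precedes the end of the subinstance. -/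
theorem d_h_lt {k : ℕ} (hk1 : 1 ≤ k) (hk : k ≤ j) (hj : j ≤ P.n) (hlt : P.h j k < j) :
    P.d (P.h j k) < P.rel (j + 1) := by
  have h1 := cw_sub_lt_of_h_lt (P := P) hk1 hk (P.h j k + 1) (by omega) (by omega)
  have h2 := P.cw_lt_succ (l := P.h j k + 1) (by omega) (by omega)
  have h3 : 0 < P.dRestr j (P.h j k + 1) - P.dRestr j (P.h j k) := by
    by_contra hcon
    have := mul_nonpos_of_nonneg_of_nonpos P.sStar_pos.le (not_lt.1 hcon)
    linarith
  have h4 : P.dRestr j (P.h j k + 1) ≤ P.rel (j + 1) := min_le_right _ _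
  by_contra hcon
  have : P.dRestr j (P.h j k) = P.rel (j + 1) := min_eq_right (not_lt.1 hcon)
  linarith

theorem dRestr_h {k : ℕ} (hk1 : 1 ≤ k) (hk : k ≤ j) (hj : j ≤ P.n) (hlt : P.h j k < j) :
    P.dRestr j (P.h j k) = P.d (P.h j k) :=
  min_eq_left (d_h_lt hk1 hk hj hlt).le

theorem le_f {a : ℕ} (ha : a ≤ j) : a ≤ P.f i j a := by
  classical
  exact Nat.le_findGreatest ha ⟨le_rfl, fun l h1 h2 => by omega⟩

theorem f_le (a : ℕ) : P.f i j a ≤ j := by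
  classical
  exact Nat.findGreatest_le _

theorem le_f_of {a b : ℕ} (hab : a ≤ b) (hb : b ≤ j) (h : ∀ k, a ≤ k → k < b →
    P.sStar * (P.rRestr i (k + 1) - P.rRestr i a) ≤ P.cw (k + 1) - P.cw a) : b ≤ P.f i j a := by
  classical
  refine Nat.le_findGreatest hb ⟨hab, fun k h1 h2 => ?_⟩
  have := h k h1 h2
  rw [P.sum_Icc_w (by omega), ← sub_le_iff_le_add', le_div_iff₀ P.sStar_pos]
  linarith

/-- The jobs `a, …, f a` form a contiguous block when processed as early as possible. -/
theorem f_block {a k : ℕ} (ha : a ≤ j) (hak : a ≤ k) (hk : k < P.f i j a) :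
    P.sStar * (P.rRestr i (k + 1) - P.rRestr i a) ≤ P.cw (k + 1) - P.cw a := by
  classical
  have hspec := Nat.findGreatest_spec (P := fun b => a ≤ b ∧ ∀ k, a ≤ k → k < b →
    P.rRestr i (k + 1) ≤ P.rRestr i a + (∑ l ∈ Finset.Icc a k, P.w l) / P.sStar) ha
    ⟨le_rfl, fun l h1 h2 => by omega⟩
  have h1 := hspec.2 k hak hk
  rw [P.sum_Icc_w (by omega), ← sub_le_iff_le_add', le_div_iff₀ P.sStar_pos] at h1
  linarith

theorem cw_sub_lt_of_f_lt {a : ℕ} (ha : a ≤ j) (hlt : P.f i j a < j) :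
    P.cw (P.f i j a + 1) - P.cw a < P.sStar * (P.rRestr i (P.f i j a + 1) - P.rRestr i a) := by
  by_contra hcon
  have haf : a ≤ P.f i j a := le_f ha
  have : P.f i j a + 1 ≤ P.f i j a := by
    refine le_f_of (by omega) hlt fun k hk1 hk2 => ?_
    rcases (Nat.lt_succ_iff.1 hk2).eq_or_lt with rfl | h
    · exact not_lt.1 hcon
    · exact f_block ha hk1 h
  omega

theorem f_self_right : P.f i j j = j :=
  le_antisymm (f_le j) (le_f le_rfl)

theorem fInv_spec (hij : i ≤ j) :
    i ≤ P.fInv i j j ∧ P.fInv i j j ≤ j ∧ P.f i j (P.fInv i j j) = j :=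
  Nat.sInf_mem (s := {a | i ≤ a ∧ a ≤ j ∧ P.f i j a = j}) ⟨j, hij, le_rfl, f_self_right⟩

/-- Every job `m` belongs to a block of the earliest schedule at critical speed; if the block starts
with job `a`, then all jobs preceding `a` are completed before the release of `a`. -/
theorem exists_block_start {m : ℕ} (him : i ≤ m) (hmj : m ≤ j) :
    ∃ a, i ≤ a ∧ a ≤ m ∧ m ≤ P.f i j a ∧ a = P.fInv i j (P.f i j a) ∧
      ∀ l, i ≤ l → l < a → P.cw a - P.cw l < P.sStar * (P.rRestr i a - P.rRestr i l) := by
  classical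
  have hex : ∃ a, i ≤ a ∧ m ≤ P.f i j a := ⟨m, him, le_f hmj⟩
  set a := Nat.find hex with ha
  obtain ⟨ha1, ha2⟩ : i ≤ a ∧ m ≤ P.f i j a := Nat.find_spec hex
  have hmin : ∀ l, i ≤ l → l < a → P.f i j l < m := fun l hl hla => by
    by_contra hcon
    exact Nat.find_min hex hla ⟨hl, not_lt.1 hcon⟩
  have ham : a ≤ m := Nat.find_min' hex ⟨him, le_f hmj⟩
  refine ⟨a, ha1, ham, ha2, ?_, ?_⟩
  · refine le_antisymm (le_csInf ⟨a, ha1, ham.trans hmj, rfl⟩ ?_)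
      (Nat.sInf_le ⟨ha1, ham.trans hmj, rfl⟩)
    rintro b ⟨hb1, _, hb3⟩
    by_contra hcon
    have := hmin b hb1 (not_le.1 hcon)
    omega
  · -- downward induction: a job violating the claim would lie in a block reaching beyond `m`
    have key : ∀ d l, a - l = d → i ≤ l → l < a →
        P.cw a - P.cw l < P.sStar * (P.rRestr i a - P.rRestr i l) := by
      intro d
      induction d using Nat.strong_induction_on with
      | _ d ih =>
        intro l hd hl hla
        by_contra hcon
        rw [not_lt] at hcon
        have : m ≤ P.f i j l := by
          refine le_f_of (by omega) hmj fun k hk1 hk2 => ?_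
          rcases lt_trichotomy (k + 1) a with h | h | h
          · have := ih (a - (k + 1)) (by omega) (k + 1) rfl (by omega) h
            linarith
          · rw [h]; exact hcon
          · have := f_block (P := P) (i := i) (j := j) (a := a) (k := k) (by omega) (by omega)
              (by omega)
            linarith
        have := hmin l hl hla
        omega
    exact fun l hl hla => key _ l rfl hl hla

/-- Cutting a sparse subinstance after a block of the latest schedule leaves a sparse
subinstance. -/
theorem Sparse.of_h (hsp : P.Sparse i j) (hi : 1 ≤ i) (hj : j ≤ P.n) {a : ℕ} (hia : i ≤ a)
    (haj : a ≤ j) (hlt : P.h j a < j) : P.Sparse (P.h j a + 1) j := by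
  classical
  have hs := P.sStar_pos
  set c := P.h j a with hc
  have hac : a ≤ c := le_h haj
  have hdc : P.dl (c + 1 - 1) = P.d c := by rw [Nat.add_sub_cancel, dl_eq (by omega)]
  have hdR : P.dRestr j c = P.d c := dRestr_h (by omega) haj hj hlt
  have hw : ∀ l ∈ Finset.Icc (c + 1) j, 0 ≤ P.w l := fun l hl => by
    rw [Finset.mem_Icc] at hl
    exact (P.w_pos l (by omega) (by omega)).le
  have hstart : P.dl (i - 1) < P.d c := by
    have h1 := hsp.cw_sub_lt hi hj (a := c) (b := c) (by omega) le_rfl hlt.le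
    have h2 := P.cw_lt_succ (l := c) (by omega) (by omega)
    have h3 : P.dl (i - 1) ≤ P.rRestr i c := le_max_right _ _
    by_contra hcon
    have := mul_nonpos_of_nonneg_of_nonpos hs.le
      (by rw [hdR]; linarith : P.dRestr j c - P.rRestr i c ≤ 0)
    linarith
  refine ⟨by rw [hdc]; exact d_h_lt (by omega) haj hj hlt, fun x y hx hxy hy => ?_⟩
  rw [hdc] at hx
  rw [density, div_lt_iff₀ (by linarith)]
  set F := {l ∈ Finset.Icc (c + 1) j | Set.Ico (P.rRestr (c + 1) l) (P.dRestr j l) ⊆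
    Set.Ico x y} with hF
  rcases F.eq_empty_or_nonempty with hE | hE
  · rw [hE, Finset.sum_empty]
    exact mul_pos hs (by linarith)
  · obtain ⟨p, hp, hpmin⟩ := F.exists_min_image id hE
    obtain ⟨q, hq, hqmax⟩ := F.exists_max_image id hE
    simp only [id] at hpmin hqmax
    have hp' := (Finset.mem_filter.1 hp)
    have hq' := (Finset.mem_filter.1 hq)
    rw [Finset.mem_Icc] at hp' hq'
    have hpq : p ≤ q := hpmin q hq
    have hsum : ∑ l ∈ F, P.w l ≤ P.cw (q + 1) - P.cw p := by
      rw [← P.sum_Icc_w (by omega)]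
      refine Finset.sum_le_sum_of_subset_of_nonneg (fun l hl => ?_) fun l hl _ => hw l ?_
      · exact Finset.mem_Icc.2 ⟨hpmin l hl, hqmax l hl⟩
      · rw [Finset.mem_Icc] at hl ⊢
        omega
    have hwin : ∀ l, c + 1 ≤ l → l ≤ j → P.rRestr (c + 1) l < P.dRestr j l := by
      intro l hl hlj
      have e1 := hsp.cw_sub_lt hi hj (a := l) (b := l) (by omega) le_rfl hlj
      have e2 := P.cw_lt_succ (l := l) (by omega) (by omega)
      have e3 := cw_sub_lt_of_h_lt (P := P) (by omega) haj l hl hlj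
      have e4 := P.cw_mono (a := c + 1) (b := l + 1) (by omega) (by omega) (by omega)
      rw [← hc] at e3
      have e5 : P.rRestr i l < P.dRestr j l := by
        by_contra hcon
        have := mul_nonpos_of_nonneg_of_nonpos hs.le (sub_nonpos.2 (not_lt.1 hcon))
        linarith
      have e6 : P.dRestr j c < P.dRestr j l := by
        by_contra hcon
        have := mul_nonpos_of_nonneg_of_nonpos hs.le (sub_nonpos.2 (not_lt.1 hcon))
        linarith
      rw [rRestr, hdc]
      exact max_lt ((le_max_left _ _).trans_lt e5) (hdR ▸ e6)
    have hsubp := (Set.Ico_subset_Ico_iff (hwin p hp'.1.1 hp'.1.2)).1 hp'.2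
    have hsubq := (Set.Ico_subset_Ico_iff (hwin q hq'.1.1 hq'.1.2)).1 hq'.2
    have hfin : P.cw (q + 1) - P.cw p < P.sStar * (P.dRestr j q - P.rRestr (c + 1) p) := by
      rw [rRestr, hdc]
      rcases le_total (P.d c) (P.r p) with h | h
      · rw [max_eq_left h]
        have e1 := hsp.cw_sub_lt hi hj (a := p) (b := q) (by omega) hpq hq'.1.2
        rwa [rRestr, max_eq_left (by linarith)] at e1
      · rw [max_eq_right h, ← hdR]
        have e3 := cw_sub_lt_of_h_lt (P := P) (by omega) haj q (by omega) hq'.1.2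
        have e4 := P.cw_mono (a := c + 1) (b := p) (by omega) (by omega) (by omega)
        rw [← hc] at e3
        linarith
    have hle : P.sStar * (P.dRestr j q - P.rRestr (c + 1) p) ≤ P.sStar * (y - x) :=
      mul_le_mul_of_nonneg_left (by linarith [hsubp.1, hsubq.2]) hs.le
    linarith

end AgreeableInstance

/-! ### Schedules of minimum speed cost -/

/-- A finite set of reals with minimum `x` and maximum `y`, listed in increasing order. -/
theorem exists_enumeration (B : Finset ℝ) {x y : ℝ} (hx : x ∈ B) (hy : y ∈ B)
    (hB : ∀ b ∈ B, x ≤ b ∧ b ≤ y) :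
    ∃ (N : ℕ) (t : ℕ → ℝ), (∀ k, k < N → t k < t (k + 1)) ∧ t 0 = x ∧ t N = y ∧
      ∀ b ∈ B, ∃ k, k ≤ N ∧ t k = b := by
  have hpos : 0 < B.card := Finset.card_pos.2 ⟨x, hx⟩
  set e := B.orderEmbOfFin (k := B.card) rfl with he
  set t : ℕ → ℝ := fun k => if h : k < B.card then e ⟨k, h⟩ else 0 with ht
  have hsurj : ∀ b ∈ B, ∃ k, ∃ h : k < B.card, e ⟨k, h⟩ = b := by
    intro b hb
    have : b ∈ Set.range e := by rw [he, Finset.range_orderEmbOfFin]; exact hb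
    obtain ⟨k, hk⟩ := this
    exact ⟨k.1, k.2, hk⟩
  have hmem : ∀ k, e k ∈ B := fun k => Finset.orderEmbOfFin_mem _ _ _
  refine ⟨B.card - 1, t, ?_, ?_, ?_, ?_⟩
  · intro k hk
    have h1 : k < B.card := by omega
    have h2 : k + 1 < B.card := by omega
    simp only [ht, h1, h2, dif_pos]
    exact e.strictMono (by simp)
  · obtain ⟨k, hk, hkx⟩ := hsurj x hx
    simp only [ht, hpos, dif_pos]
    refine le_antisymm ?_ (hB _ (hmem _)).1
    rw [← hkx]
    exact e.monotone (Fin.mk_le_mk.2 (Nat.zero_le _))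
  · obtain ⟨k, hk, hky⟩ := hsurj y hy
    have h1 : B.card - 1 < B.card := by omega
    simp only [ht, h1, dif_pos]
    refine le_antisymm (hB _ (hmem _)).2 ?_
    rw [← hky]
    exact e.monotone (Fin.mk_le_mk.2 (by omega))
  · intro b hb
    obtain ⟨k, hk, hkb⟩ := hsurj b hb
    exact ⟨k, by omega, by simp only [ht, hk, dif_pos, hkb]⟩

/-- The speed cost of processing the amount `v (k + 1) - v k` of work at constant speed during
`[t k, t (k + 1))`, for all `k < N`. -/
def pieceCost (α : ℝ) (t v : ℕ → ℝ) (N : ℕ) : ℝ :=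
  ∑ k ∈ Finset.range N, ((v (k + 1) - v k) / (t (k + 1) - t k)) ^ α * (t (k + 1) - t k)

theorem pieceCost_nonneg {α : ℝ} {t v : ℕ → ℝ} {N : ℕ} (ht : ∀ k, k < N → t k < t (k + 1))
    (hv : ∀ k, k < N → v k ≤ v (k + 1)) : 0 ≤ pieceCost α t v N := by
  refine Finset.sum_nonneg fun k hk => ?_
  rw [Finset.mem_range] at hk
  have h1 : 0 ≤ t (k + 1) - t k := sub_nonneg.2 (ht k hk).le
  have h2 : 0 ≤ v (k + 1) - v k := sub_nonneg.2 (hv k hk)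
  positivity

theorem pieceCost_succ (α : ℝ) (t v : ℕ → ℝ) (N : ℕ) : pieceCost α t v (N + 1) =
    pieceCost α t v N + ((v (N + 1) - v N) / (t (N + 1) - t N)) ^ α * (t (N + 1) - t N) :=
  Finset.sum_range_succ _ _

theorem continuous_pieceCost {α : ℝ} (hα : 2 ≤ α) (t : ℕ → ℝ) (N : ℕ) :
    Continuous fun v => pieceCost α t v N := by
  unfold pieceCost
  refine continuous_finsetSum _ fun k _ => ?_
  refine Continuous.mul (Continuous.rpow_const ?_ fun _ => Or.inr (by linarith)) continuous_const
  fun_prop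

theorem le_of_steps {t : ℕ → ℝ} {N : ℕ} (ht : ∀ k, k < N → t k ≤ t (k + 1)) :
    ∀ k l, k ≤ l → l ≤ N → t k ≤ t l := by
  intro k l hkl
  induction l, hkl using Nat.le_induction with
  | base => exact fun _ => le_rfl
  | succ l hkl ih => exact fun hl => (ih (by omega)).trans (ht l (by omega))

/-- Averaging the speed between breakpoints does not increase the speed cost. -/
theorem IsFlow.pieceCost_le {α : ℝ} (hα : 2 ≤ α) {x y : ℝ} {σ : ℝ → ℝ≥0} {V : ℝ → ℝ}
    (hF : IsFlow x y σ V) {t : ℕ → ℝ} {N : ℕ} (ht : ∀ k, k < N → t k < t (k + 1))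
    (h0 : t 0 = x) (hN : t N ≤ y) :
    ENNReal.ofReal (pieceCost α t (fun k => V (t k)) N) ≤
      ∫⁻ z in Set.Ico x (t N), (σ z : ℝ≥0∞) ^ α := by
  have htm := le_of_steps fun k hk => (ht k hk).le
  induction N with
  | zero => simp [pieceCost]
  | succ N ih =>
    have hlt := ht N (Nat.lt_succ_self N)
    have hx : x ≤ t N := by rw [← h0]; exact htm 0 N (Nat.zero_le _) (Nat.le_succ _)
    have ih' := ih (fun k hk => ht k (by omega)) (hlt.le.trans hN)
      (le_of_steps fun k hk => (ht k (by omega)).le)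
    have hVle : V (t N) ≤ V (t (N + 1)) :=
      hF.mono ⟨hx, hlt.le.trans hN⟩ ⟨hx.trans hlt.le, hN⟩ hlt.le
    have hlen : 0 < t (N + 1) - t N := sub_pos.2 hlt
    have hc0 : 0 ≤ (V (t (N + 1)) - V (t N)) / (t (N + 1) - t N) :=
      div_nonneg (sub_nonneg.2 hVle) hlen.le
    have hmul : (V (t (N + 1)) - V (t N)) / (t (N + 1) - t N) * (t (N + 1) - t N) =
        V (t (N + 1)) - V (t N) := div_mul_cancel₀ _ hlen.ne'
    set c : ℝ≥0 := ⟨(V (t (N + 1)) - V (t N)) / (t (N + 1) - t N), hc0⟩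
    have hcc : (c : ℝ) = (V (t (N + 1)) - V (t N)) / (t (N + 1) - t N) := rfl
    have hstep := (hF.restrict hx hN).ofReal_rpow_mul_le hα hlt.le c hmul.ge
    rw [hcc, hmul, sub_self, mul_zero, ENNReal.ofReal_zero, add_zero] at hstep
    rw [lintegral_Ico_add _ hx hlt.le, pieceCost_succ]
    exact ENNReal.ofReal_add_le.trans (add_le_add ih' hstep)

/-- A flow that runs at constant speed between breakpoints, with prescribed amounts of processed
work at the breakpoints. -/
theorem exists_flow_of_pieces {α : ℝ} (hα : 2 ≤ α) {t v : ℕ → ℝ} {N : ℕ}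
    (ht : ∀ k, k < N → t k < t (k + 1)) (hv : ∀ k, k < N → v k ≤ v (k + 1)) :
    ∃ σ V, IsFlow (t 0) (t N) σ V ∧ (∀ k, k ≤ N → V (t k) = v k) ∧
      ∫⁻ z in Set.Ico (t 0) (t N), (σ z : ℝ≥0∞) ^ α = ENNReal.ofReal (pieceCost α t v N) := by
  induction N with
  | zero =>
    refine ⟨_, _, IsFlow.const (t 0) (t 0) 0 (v 0) (t 0), ?_, by simp [pieceCost]⟩
    intro k hk
    have : k = 0 := by omega
    simp [this]
  | succ N ih =>
    obtain ⟨σ, V, hF, hV, hint⟩ := ih (fun k hk => ht k (by omega)) (fun k hk => hv k (by omega))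
    have hα0 : 0 ≤ α := by linarith
    have htm := le_of_steps fun k hk => (ht k hk).le
    have hlt := ht N (Nat.lt_succ_self N)
    have hx : t 0 ≤ t N := htm 0 N (Nat.zero_le _) (Nat.le_succ _)
    have hlen : 0 < t (N + 1) - t N := sub_pos.2 hlt
    have hc0 : 0 ≤ (v (N + 1) - v N) / (t (N + 1) - t N) :=
      div_nonneg (sub_nonneg.2 (hv N (Nat.lt_succ_self N))) hlen.le
    set c : ℝ≥0 := ⟨(v (N + 1) - v N) / (t (N + 1) - t N), hc0⟩ with hc
    have hcc : (c : ℝ) = (v (N + 1) - v N) / (t (N + 1) - t N) := rfl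
    have hF' := IsFlow.const (t N) (t (N + 1)) c (v N) (t N)
    refine ⟨_, _, hF.glue hF' (by simp [hV N le_rfl]) hx hlt.le, ?_, ?_⟩
    · intro k hk
      rcases Nat.le_succ_iff.1 hk with h | h
      · have : t k ≤ t N := htm k N h (Nat.le_succ _)
        simp [this, hV k h]
      · subst h
        simp only [not_le.2 hlt, if_false]
        rw [hcc, div_mul_cancel₀ _ hlen.ne']
        ring
    · rw [lintegral_Ico_add _ hx hlt.le, pieceCost_succ, ENNReal.ofReal_add
        (pieceCost_nonneg (fun k hk => ht k (by omega)) fun k hk => hv k (by omega))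
        (by positivity), ← hint]
      congr 1
      · refine setLIntegral_congr_fun measurableSet_Ico fun z hz => ?_
        simp [hz.2]
      · rw [← hcc, ENNReal.ofReal_mul (by positivity), ← Real.volume_Ico, ← setLIntegral_const,
          ← ENNReal.ofReal_rpow_of_nonneg c.coe_nonneg hα0, ENNReal.ofReal_coe_nnreal]
        refine setLIntegral_congr_fun measurableSet_Ico fun z hz => ?_
        simp [not_lt.2 hz.1]

namespace AgreeableInstance

variable {P : AgreeableInstance}

/-- The minimum speed cost is attained: it suffices to consider speeds that are constant between
release times and deadlines, which form a compact family. -/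
theorem exists_min_speedCost {x y : ℝ} {a m : ℕ} (h1 : 1 ≤ a) (ham : a ≤ m) (hm : m ≤ P.n + 1)
    (hS : Nonempty (P.Schedule (Set.Ico x y) (Finset.Ico a m))) :
    ∃ S : P.Schedule (Set.Ico x y) (Finset.Ico a m),
      ∀ S' : P.Schedule (Set.Ico x y) (Finset.Ico a m), S.speedCost ≤ S'.speedCost := by
  classical
  obtain ⟨S₀⟩ := hS
  rcases le_or_gt y x with hyx | hxy
  · refine ⟨S₀, fun S' => ?_⟩
    rw [Schedule.speedCost, lintegral_Ico_eq_zero _ hyx]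
    exact zero_le
  have hα := P.two_le_α
  -- the breakpoints `t 0 < ⋯ < t N` are the release times and deadlines, truncated to `[x, y]`
  set q : ℝ → ℝ := fun u => max x (min u y) with hq
  have hq1 : ∀ u, x ≤ q u ∧ q u ≤ y := fun u => ⟨le_max_left _ _, max_le hxy.le (min_le_right _ _)⟩
  set B : Finset ℝ := {x, y} ∪ ((Finset.Ico a m).image (fun l => q (P.r l)) ∪
    (Finset.Ico a m).image (fun l => q (P.d l))) with hB
  obtain ⟨N, t, ht, ht0, htN, hcov⟩ := exists_enumeration B (x := x) (y := y) (by simp [hB])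
    (by simp [hB]) (by
      intro b hb
      simp only [hB, Finset.mem_union, Finset.mem_insert, Finset.mem_singleton,
        Finset.mem_image] at hb
      rcases hb with (rfl | rfl) | ⟨l, _, rfl⟩ | ⟨l, _, rfl⟩
      · exact ⟨le_rfl, hxy.le⟩
      · exact ⟨hxy.le, le_rfl⟩
      · exact hq1 _
      · exact hq1 _)
  have htm := le_of_steps fun k hk => (ht k hk).le
  have htmem : ∀ k, k ≤ N → t k ∈ Set.Icc x y := fun k hk =>
    ⟨by rw [← ht0]; exact htm 0 k (Nat.zero_le _) hk, by rw [← htN]; exact htm k N hk le_rfl⟩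
  -- the feasible amounts of processed work at the breakpoints; indices beyond `N` are irrelevant
  set K : Set (ℕ → ℝ) := {v | (∀ k, v k ∈ Set.Icc (P.cw a) (P.cw m)) ∧ v 0 = P.cw a ∧
    v N = P.cw m ∧ (∀ k, k < N → v k ≤ v (k + 1)) ∧
    (∀ l k, a ≤ l → l < m → k ≤ N → t k = q (P.r l) → v k ≤ P.cw l) ∧
    (∀ l k, a ≤ l → l < m → k ≤ N → t k = q (P.d l) → P.cw (l + 1) ≤ v k)} with hK
  have hcompact : IsCompact K := by
    refine (isCompact_univ_pi fun _ : ℕ => isCompact_Icc (a := P.cw a)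
      (b := P.cw m)).of_isClosed_subset ?_ fun v hv k _ => hv.1 k
    have hev : ∀ k : ℕ, Continuous fun v : ℕ → ℝ => v k := fun k => continuous_apply k
    simp only [hK, Set.ofPred_and, Set.ofPred_forall]
    refine IsClosed.inter (isClosed_iInter fun k => isClosed_Icc.preimage (hev k)) ?_
    refine IsClosed.inter (isClosed_eq (hev 0) continuous_const) ?_
    refine IsClosed.inter (isClosed_eq (hev N) continuous_const) ?_
    refine IsClosed.inter (isClosed_iInter fun k => isClosed_iInter fun _ =>
      isClosed_le (hev k) (hev (k + 1))) ?_
    refine IsClosed.inter ?_ ?_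
    · exact isClosed_iInter fun l => isClosed_iInter fun k => isClosed_iInter fun _ =>
        isClosed_iInter fun _ => isClosed_iInter fun _ => isClosed_iInter fun _ =>
        isClosed_le (hev k) continuous_const
    · exact isClosed_iInter fun l => isClosed_iInter fun k => isClosed_iInter fun _ =>
        isClosed_iInter fun _ => isClosed_iInter fun _ => isClosed_iInter fun _ =>
        isClosed_le continuous_const (hev k)
  -- every schedule yields a point of `K` that is at most as expensive
  have hto : ∀ S' : P.Schedule (Set.Ico x y) (Finset.Ico a m), ∃ v ∈ K,
      ENNReal.ofReal (pieceCost P.α t v N) ≤ S'.speedCost := by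
    intro S'
    obtain ⟨V, hF, hV⟩ := S'.exists_flow h1 ham hm hxy.le
    set v : ℕ → ℝ := fun k => V (t (min k N)) with hv
    have hvk : ∀ k, k ≤ N → v k = V (t k) := fun k hk => by simp [hv, hk]
    have hx0 : x ∈ Set.Icc x y := ⟨le_rfl, hxy.le⟩
    have hy0 : y ∈ Set.Icc x y := ⟨hxy.le, le_rfl⟩
    refine ⟨v, ⟨?_, ?_, ?_, ?_, ?_, ?_⟩, ?_⟩
    · intro k
      have hk := htmem (min k N) (min_le_right _ _)
      exact ⟨by rw [← hV.left]; exact hF.mono hx0 hk hk.1,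
        by rw [← hV.right]; exact hF.mono hk hy0 hk.2⟩
    · rw [hvk 0 (Nat.zero_le _), ht0, hV.left]
    · rw [hvk N le_rfl, htN, hV.right]
    · intro k hk
      rw [hvk k hk.le, hvk (k + 1) hk]
      exact hF.mono (htmem k hk.le) (htmem (k + 1) hk) (ht k hk).le
    · intro l k hl hlm hk htk
      rw [hvk k hk]
      rcases le_or_gt (t k) (P.r l) with h | h
      · exact hV.rel l hl hlm _ (htmem k hk) h
      · have : t k = x := by
          rw [htk] at h ⊢
          rcases max_choice x (min (P.r l) y) with h' | h'
          · exact h'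
          · simp only [hq] at h
            rw [h'] at h
            exact absurd h (not_lt.2 (min_le_left _ _))
        rw [this, hV.left]
        exact P.cw_mono h1 hl (by omega)
    · intro l k hl hlm hk htk
      rw [hvk k hk]
      rcases le_or_gt (P.d l) (t k) with h | h
      · exact hV.dead l hl hlm _ (htmem k hk) h
      · have : t k = y := by
          rw [htk] at h ⊢
          refine le_antisymm (hq1 _).2 ?_
          rcases min_choice (P.d l) y with h' | h'
          · simp only [hq, h'] at h
            exact absurd h (not_lt.2 (le_max_right _ _))
          · simp only [hq, h']
            exact le_max_right _ _
        rw [this, hV.right]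
        exact P.cw_mono (by omega) hlm hm
    · have h2 := hF.pieceCost_le hα ht ht0 htN.le
      rw [htN] at h2
      refine le_trans (le_of_eq ?_) h2
      congr 1
      refine Finset.sum_congr rfl fun k hk => ?_
      rw [Finset.mem_range] at hk
      rw [hvk k hk.le, hvk (k + 1) hk]
  obtain ⟨v₀, hv₀, _⟩ := hto S₀
  obtain ⟨v, hv, hmin⟩ := hcompact.exists_isMinOn ⟨v₀, hv₀⟩
    (continuous_pieceCost hα t N).continuousOn
  obtain ⟨hv1, hv2, hv3, hv4, hv5, hv6⟩ := hv
  obtain ⟨σ, V, hF, hVt, hint⟩ := exists_flow_of_pieces hα ht hv4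
  rw [ht0, htN] at hF hint
  have hfeas : P.Feasible x y a m V := by
    refine ⟨by rw [← ht0, hVt 0 (Nat.zero_le _), hv2], by rw [← htN, hVt N le_rfl, hv3], ?_, ?_⟩
    · intro l hl hlm s hs hsr
      obtain ⟨k, hk, htk⟩ := hcov (q (P.r l)) (by
        simp only [hB, Finset.mem_union, Finset.mem_image]
        exact Or.inr (Or.inl ⟨l, Finset.mem_Ico.2 ⟨hl, hlm⟩, rfl⟩))
      have h2 : s ≤ t k := by
        rw [htk]
        exact (le_min hsr hs.2).trans (le_max_right _ _)
      exact (hF.mono hs (htmem k hk) h2).trans (by rw [hVt k hk]; exact hv5 l k hl hlm hk htk)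
    · intro l hl hlm s hs hds
      obtain ⟨k, hk, htk⟩ := hcov (q (P.d l)) (by
        simp only [hB, Finset.mem_union, Finset.mem_image]
        exact Or.inr (Or.inr ⟨l, Finset.mem_Ico.2 ⟨hl, hlm⟩, rfl⟩))
      have h2 : t k ≤ s := by
        rw [htk]
        exact max_le hs.1 ((min_le_left _ _).trans hds)
      exact le_trans (by rw [hVt k hk]; exact hv6 l k hl hlm hk htk) (hF.mono (htmem k hk) hs h2)
  obtain ⟨S, hSσ, _⟩ := hfeas.exists_schedule_on hF h1 ham hm hxy.le
  refine ⟨S, fun S' => ?_⟩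
  obtain ⟨v', hv', hle⟩ := hto S'
  rw [Schedule.speedCost, hSσ, hint]
  exact (ENNReal.ofReal_le_ofReal (hmin hv')).trans hle

/-- The same schedule without shutdowns. -/
def Schedule.alwaysOn {T : Set ℝ} {J : Finset ℕ} (S : P.Schedule T J) : P.Schedule T J where
  mode _ := Mode.on
  speed := S.speed
  job := S.job
  on_of_speed_pos _ _ _ := rfl
  speed_eq_zero_iff := S.speed_eq_zero_iff
  job_window := S.job_window
  work := S.work
  piecewise_constant t ht := by
    obtain ⟨a, b, ha, hb, h⟩ := S.piecewise_constant t ht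
    exact ⟨a, b, ha, hb, fun z hz => ⟨rfl, (h z hz).2⟩⟩

/-- `Y` is the cost of an optimal schedule without shutdowns. -/
theorem hasSched_Y {i j : ℕ} (hi : 1 ≤ i) (hij : i ≤ j + 1) (hj : j ≤ P.n)
    (hY : P.Y i j ≠ ⊤) :
    P.HasSched (Set.Ico (P.dl (i - 1)) (P.rel (j + 1))) (Finset.Ico i (j + 1)) (P.Y i j) := by
  have hne : Nonempty (P.SubSchedule i j) := by
    by_contra h
    rw [not_nonempty_iff] at h
    exact hY (by simp [Y])
  unfold SubSchedule at hne
  rw [← Finset.Ico_add_one_right_eq_Icc] at hne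
  obtain ⟨S, hS⟩ := exists_min_speedCost hi hij (by omega) hne
  refine ⟨S.alwaysOn, ?_⟩
  rw [Schedule.modeCost_of_on _ fun _ _ => rfl]
  unfold Y SubSchedule
  rw [← Finset.Ico_add_one_right_eq_Icc]
  gcongr
  exact le_iInf fun S' => hS S'

theorem Y_le {i a : ℕ} {x y : ℝ} {c : ℝ≥0∞} (ha : 1 ≤ a) (hx : P.dl (i - 1) = x)
    (hy : P.rel a = y) (S : P.Schedule (Set.Ico x y) (Finset.Ico i a)) (hS : S.speedCost ≤ c) :
    P.Y i (a - 1) ≤ c + ENNReal.ofReal (P.g * (y - x)) := by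
  obtain ⟨j, rfl⟩ : ∃ j, a = j + 1 := ⟨a - 1, by omega⟩
  subst hx hy
  rw [Nat.add_sub_cancel]
  unfold Y SubSchedule
  rw [← Finset.Ico_add_one_right_eq_Icc]
  gcongr
  exact (iInf_le _ S).trans hS

theorem O_le {i j : ℕ} {c : ℝ≥0∞}
    (h : P.HasSched (Set.Ico (P.dl (i - 1)) (P.rel (j + 1))) (Finset.Ico i (j + 1)) c) :
    P.O i j ≤ c := by
  unfold O SubSchedule
  rw [← Finset.Ico_add_one_right_eq_Icc]
  obtain ⟨S, hS⟩ := h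
  exact (iInf_le _ S).trans hS

end AgreeableInstance

/-! ### Upper bounds: schedules realising the terms of the recursion -/

namespace AgreeableInstance

variable {P : AgreeableInstance} {i j : ℕ}

theorem critCost_eq {a b : ℕ} (hab : a ≤ b + 1) :
    P.critCost a b = ENNReal.ofReal (P.gStar * (P.cw (b + 1) - P.cw a)) := by
  rw [critCost, P.sum_Icc_w hab]

/-- The block starting with job `a`, processed as early as possible. -/
theorem Sparse.hasSched_early (hsp : P.Sparse i j) (hi : 1 ≤ i) (hj : j ≤ P.n) {a : ℕ}
    (hia : i ≤ a) (haj : a ≤ j) :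
    P.HasSched (Set.Ico (P.rRestr i a)
      (P.rRestr i a + (P.cw (P.f i j a + 1) - P.cw a) / P.sStar))
      (Finset.Ico a (P.f i j a + 1)) (P.critCost a (P.f i j a)) := by
  have hs := P.sStar_pos
  have haf : a ≤ P.f i j a := le_f haj
  have hfj : P.f i j a ≤ j := f_le a
  have hcw := P.cw_mono (a := a) (b := P.f i j a + 1) (by omega) (by omega) (by omega)
  rw [critCost_eq (by omega)]
  refine hasSched_crit (v := P.cw a) (p := P.rRestr i a) ⟨by simp, ?_, ?_, ?_⟩ (by omega) (by omega)
    (by omega) (le_add_of_nonneg_right (div_nonneg (sub_nonneg.2 hcw) hs.le))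
  · field_simp
    ring
  · intro l hal hl t _ htr
    have h1 : t ≤ P.rRestr i l := htr.trans (le_max_left _ _)
    have h2 : P.sStar * t ≤ P.sStar * P.rRestr i l := mul_le_mul_of_nonneg_left h1 hs.le
    rcases hal.eq_or_lt with rfl | hal
    · linarith
    · have := f_block (P := P) (i := i) haj (k := l - 1) (by omega) (by omega)
      rw [Nat.sub_add_cancel (by omega)] at this
      linarith
  · intro l hal hl t _ htd
    have h1 : P.dRestr j l ≤ t := (min_le_left _ _).trans htd
    have h2 : P.sStar * P.dRestr j l ≤ P.sStar * t := mul_le_mul_of_nonneg_left h1 hs.le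
    have := hsp.cw_sub_lt hi hj hia hal (by omega)
    linarith

/-- The block starting with job `k`, processed as late as possible. -/
theorem Sparse.hasSched_late (hsp : P.Sparse i j) (hi : 1 ≤ i) (hj : j ≤ P.n) {k : ℕ}
    (hik : i ≤ k) (hkj : k ≤ j) :
    P.HasSched (Set.Ico
      (P.dRestr j (P.h j k) - (P.cw (P.h j k + 1) - P.cw k) / P.sStar) (P.dRestr j (P.h j k)))
      (Finset.Ico k (P.h j k + 1)) (P.critCost k (P.h j k)) := by
  have hs := P.sStar_pos
  have hkh : k ≤ P.h j k := le_h hkj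
  have hhj : P.h j k ≤ j := h_le k
  have hcw := P.cw_mono (a := k) (b := P.h j k + 1) (by omega) (by omega) (by omega)
  rw [critCost_eq (by omega)]
  refine hasSched_crit (v := P.cw (P.h j k + 1)) (p := P.dRestr j (P.h j k)) ⟨?_, by simp, ?_, ?_⟩
    (by omega) (by omega) (by omega) (sub_le_self _ (div_nonneg (sub_nonneg.2 hcw) hs.le))
  · field_simp
    ring
  · intro l hkl hl t _ htr
    have h1 : t ≤ P.rRestr i l := htr.trans (le_max_left _ _)
    have h2 : P.sStar * t ≤ P.sStar * P.rRestr i l := mul_le_mul_of_nonneg_left h1 hs.le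
    have := hsp.cw_sub_lt hi hj (hik.trans hkl) (Nat.lt_succ_iff.1 hl) hhj
    linarith
  · intro l hkl hl t _ htd
    have h1 : P.dRestr j l ≤ t := (min_le_left _ _).trans htd
    have h2 : P.sStar * P.dRestr j l ≤ P.sStar * t := mul_le_mul_of_nonneg_left h1 hs.le
    rcases (Nat.lt_succ_iff.1 hl).eq_or_lt with rfl | hl
    · linarith
    · have := h_block (P := P) hkj (l := l + 1) (by omega) (by omega)
      rw [Nat.add_sub_cancel] at this
      linarith

/-- The interval of `(i, a - 1)` ends at `r a`, even if that precedes its start; with the restricted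
release time of `a` as its end it is the same set. -/
theorem hasSched_Y_restr (hi : 1 ≤ i) {a : ℕ} (hia : i ≤ a) (ha : a ≤ P.n)
    (hY : P.Y i (a - 1) ≠ ⊤) :
    P.HasSched (Set.Ico (P.dl (i - 1)) (P.rRestr i a)) (Finset.Ico i a) (P.Y i (a - 1)) := by
  have h := hasSched_Y hi (by omega) (by omega) hY
  rw [Nat.sub_add_cancel (by omega), rel_eq ha] at h
  convert h using 1
  ext t
  simp only [rRestr, Set.mem_Ico, lt_max_iff]
  constructor
  · rintro ⟨h1, h2 | h2⟩
    · exact ⟨h1, h2⟩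
    · exact absurd h2 (not_lt.2 h1)
  · rintro ⟨h1, h2⟩
    exact ⟨h1, Or.inl h2⟩

/-- The interval of `(c + 1, j)` starts at `d c`; with the restricted deadline of `c` as its start it
is the same set. -/
theorem hasSched_O_restr {c : ℕ} (hc : 1 ≤ c)
    (hO : P.HasSched (Set.Ico (P.dl c) (P.rel (j + 1))) (Finset.Ico (c + 1) (j + 1))
      (P.O (c + 1) j)) :
    P.HasSched (Set.Ico (P.dRestr j c) (P.rel (j + 1))) (Finset.Ico (c + 1) (j + 1))
      (P.O (c + 1) j) := by
  convert hO using 1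
  ext t
  simp only [dRestr, Set.mem_Ico, min_le_iff, dl_eq hc]
  constructor
  · rintro ⟨h1 | h1, h2⟩
    · exact ⟨h1, h2⟩
    · exact absurd h2 (not_lt.2 h1)
  · rintro ⟨h1, h2⟩
    exact ⟨Or.inl h1, h2⟩

theorem hasSched_O_empty (hj : 1 ≤ j) :
    P.HasSched (Set.Ico (P.dl j) (P.rel (j + 1))) (Finset.Ico (j + 1) (j + 1))
      (P.O (j + 1) j) := by
  have h := O_empty (P := P) (i := j + 1) (by omega)
  rw [Nat.add_sub_cancel] at h
  rw [h]
  rcases min_choice (ENNReal.ofReal P.L) (ENNReal.ofReal (P.g * (P.rel (j + 1) - P.dl j)))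
    with h' | h' <;> rw [h']
  · exact hasSched_off _ _ _
  · exact hasSched_on _ _ _

/-- In a sparse subinstance, the latest start at critical speed of a block is after the release of
its first job. -/
theorem Sparse.rRestr_lt_late (hsp : P.Sparse i j) (hi : 1 ≤ i) (hj : j ≤ P.n) {k : ℕ}
    (hik : i ≤ k) (hkj : k ≤ j) :
    P.rRestr i k < P.dRestr j (P.h j k) - (P.cw (P.h j k + 1) - P.cw k) / P.sStar := by
  have h := hsp.cw_sub_lt hi hj hik (le_h (P := P) hkj) (h_le k)
  rw [lt_sub_comm, div_lt_iff₀ P.sStar_pos]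
  linarith

/-- A schedule that is off before the first block, which is processed as late as possible. -/
theorem Sparse.hasSched_off_first (hsp : P.Sparse i j) (hi : 1 ≤ i) (hij : i ≤ j) (hj : j ≤ P.n)
    (hO : P.HasSched (Set.Ico (P.dl (P.h j i)) (P.rel (j + 1)))
      (Finset.Ico (P.h j i + 1) (j + 1)) (P.O (P.h j i + 1) j)) :
    P.HasSched (Set.Ico (P.dl (i - 1)) (P.rel (j + 1))) (Finset.Ico i (j + 1))
      (ENNReal.ofReal P.L + P.critCost i (P.h j i) + P.O (P.h j i + 1) j) := by
  have hih : i ≤ P.h j i := le_h hij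
  have hhj : P.h j i ≤ j := h_le i
  have h1 := hsp.rRestr_lt_late hi hj le_rfl hij
  have h2 : P.dl (i - 1) ≤ P.rRestr i i := le_max_right _ _
  have hcw := P.cw_mono (a := i) (b := P.h j i + 1) (by omega) (by omega) (by omega)
  have h3 : P.dRestr j (P.h j i) - (P.cw (P.h j i + 1) - P.cw i) / P.sStar ≤
    P.dRestr j (P.h j i) := sub_le_self _ (div_nonneg (sub_nonneg.2 hcw) P.sStar_pos.le)
  refine HasSched.glue (τ := P.dRestr j (P.h j i)) (by linarith) (min_le_right _ _) (by omega)
    (by omega) ?_ (hasSched_O_restr (by omega) hO)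
  exact HasSched.glue (by linarith) h3 le_rfl (by omega) (hasSched_off _ _ _)
    (hsp.hasSched_late hi hj le_rfl hij)

/-- A schedule that is off after the last block, which is processed as early as possible. -/
theorem Sparse.hasSched_off_last (hsp : P.Sparse i j) (hi : 1 ≤ i) (hj : j ≤ P.n) {a : ℕ}
    (hia : i ≤ a) (haj : a ≤ j) (hf : P.f i j a = j) (hY : P.Y i (a - 1) ≠ ⊤) :
    P.HasSched (Set.Ico (P.dl (i - 1)) (P.rel (j + 1))) (Finset.Ico i (j + 1))
      (P.Y i (a - 1) + P.critCost a j + ENNReal.ofReal P.L) := by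
  have h1 := hsp.hasSched_early hi hj hia haj
  have hcw := P.cw_mono (a := a) (b := j + 1) (by omega) (by omega) (by omega)
  rw [hf] at h1
  have h2 : 0 ≤ (P.cw (j + 1) - P.cw a) / P.sStar :=
    div_nonneg (sub_nonneg.2 hcw) P.sStar_pos.le
  have h3 : P.rRestr i a + (P.cw (j + 1) - P.cw a) / P.sStar ≤ P.rel (j + 1) := by
    have h4 := hsp.cw_sub_lt hi hj hia haj le_rfl
    have h5 : P.dRestr j j ≤ P.rel (j + 1) := min_le_right _ _
    have h6 : (P.cw (j + 1) - P.cw a) / P.sStar ≤ P.dRestr j j - P.rRestr i a := by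
      rw [div_le_iff₀ P.sStar_pos]
      linarith
    linarith
  have h4 : P.dl (i - 1) ≤ P.rRestr i a := le_max_right _ _
  refine HasSched.glue (by linarith) h3 (by omega) le_rfl ?_ (hasSched_off _ _ _)
  exact HasSched.glue h4 (by linarith) hia (by omega)
    (hasSched_Y_restr hi hia (by omega) hY) h1

/-- A schedule that is off between the block `a, …, b`, processed as early as possible, and the
block `b + 1, …, c`, processed as late as possible. -/
theorem Sparse.hasSched_off_between (hsp : P.Sparse i j) (hi : 1 ≤ i) (hj : j ≤ P.n) {a b c : ℕ}
    (hia : i ≤ a) (haj : a ≤ j) (hf : b = P.f i j a) (hb : b < j) (hc : c = P.h j (b + 1))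
    (hY : P.Y i (a - 1) ≠ ⊤)
    (hO : P.HasSched (Set.Ico (P.dl c) (P.rel (j + 1)))
      (Finset.Ico (c + 1) (j + 1)) (P.O (c + 1) j)) :
    P.HasSched (Set.Ico (P.dl (i - 1)) (P.rel (j + 1))) (Finset.Ico i (j + 1))
      (P.Y i (a - 1) + P.critCost a b + ENNReal.ofReal P.L + P.critCost (b + 1) c +
        P.O (c + 1) j) := by
  have hs := P.sStar_pos
  have hab : a ≤ b := hf ▸ le_f haj
  have hbc : b + 1 ≤ c := hc ▸ le_h hb
  have hcj : c ≤ j := hc ▸ h_le _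
  have e1 := hsp.hasSched_early hi hj hia haj
  have e2 := hsp.hasSched_late hi hj (k := b + 1) (by omega) hb
  have e3 := hsp.rRestr_lt_late hi hj (k := b + 1) (by omega) hb
  have e4 := cw_sub_lt_of_f_lt (P := P) (i := i) haj (hf ▸ hb)
  rw [← hf] at e1 e4
  rw [← hc] at e2 e3
  have e5 : 0 ≤ (P.cw (b + 1) - P.cw a) / P.sStar :=
    div_nonneg (sub_nonneg.2 (P.cw_mono (by omega) (by omega) (by omega))) hs.le
  have e6 : 0 ≤ (P.cw (c + 1) - P.cw (b + 1)) / P.sStar :=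
    div_nonneg (sub_nonneg.2 (P.cw_mono (by omega) (by omega) (by omega))) hs.le
  have e7 : (P.cw (b + 1) - P.cw a) / P.sStar ≤ P.rRestr i (b + 1) - P.rRestr i a := by
    rw [div_le_iff₀ hs]
    linarith
  have e8 : P.dl (i - 1) ≤ P.rRestr i a := le_max_right _ _
  refine HasSched.glue (τ := P.dRestr j c) (by linarith) (min_le_right _ _) (by omega)
    (by omega) ?_ (hasSched_O_restr (by omega) hO)
  refine HasSched.glue (by linarith) (by linarith) (by omega) (by omega) ?_ e2
  refine HasSched.glue (τ := P.rRestr i a + (P.cw (b + 1) - P.cw a) / P.sStar) (by linarith)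
    (by linarith) (by omega) le_rfl ?_ (hasSched_off _ _ _)
  exact HasSched.glue e8 (by linarith) hia (by omega)
    (hasSched_Y_restr hi hia (by omega) hY) e1

end AgreeableInstance

/-! ### Lower bounds: exchange arguments around the first shutdown -/

theorem exists_first_zero {F : ℝ → ℝ} {p q : ℝ} (hpq : p ≤ q) (hF : ContinuousOn F (Set.Icc p q))
    (hp : 0 ≤ F p) (hq : F q ≤ 0) :
    ∃ τ ∈ Set.Icc p q, F τ = 0 ∧ ∀ t ∈ Set.Icc p τ, 0 ≤ F t := by
  have hclosed : IsCompact (Set.Icc p q ∩ F ⁻¹' {0}) :=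
    isCompact_Icc.of_isClosed_subset (hF.preimage_isClosed_of_isClosed isClosed_Icc
      isClosed_singleton) Set.inter_subset_left
  obtain ⟨t₀, ht₀, h₀⟩ := intermediate_value_Icc' hpq hF ⟨hq, hp⟩
  obtain ⟨τ, ⟨hτ, hτ0⟩, hmin⟩ := hclosed.exists_isLeast ⟨t₀, ht₀, h₀⟩
  refine ⟨τ, hτ, hτ0, fun t ht => ?_⟩
  by_contra hcon
  rw [not_le] at hcon
  obtain ⟨z, hz, hz0⟩ := intermediate_value_Icc' ht.1
    (hF.mono (Set.Icc_subset_Icc_right (ht.2.trans hτ.2))) ⟨hcon.le, hp⟩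
  have h1 : τ ≤ z := hmin ⟨⟨hz.1, hz.2.trans (ht.2.trans hτ.2)⟩, hz0⟩
  have h2 : t = τ := le_antisymm ht.2 (h1.trans hz.2)
  rw [h2] at hcon
  exact hcon.ne hτ0

theorem exists_last_zero {F : ℝ → ℝ} {p q : ℝ} (hpq : p ≤ q) (hF : ContinuousOn F (Set.Icc p q))
    (hp : 0 ≤ F p) (hq : F q ≤ 0) :
    ∃ τ ∈ Set.Icc p q, F τ = 0 ∧ ∀ t ∈ Set.Icc τ q, F t ≤ 0 := by
  have hclosed : IsCompact (Set.Icc p q ∩ F ⁻¹' {0}) :=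
    isCompact_Icc.of_isClosed_subset (hF.preimage_isClosed_of_isClosed isClosed_Icc
      isClosed_singleton) Set.inter_subset_left
  obtain ⟨t₀, ht₀, h₀⟩ := intermediate_value_Icc' hpq hF ⟨hq, hp⟩
  obtain ⟨τ, ⟨hτ, hτ0⟩, hmax⟩ := hclosed.exists_isGreatest ⟨t₀, ht₀, h₀⟩
  refine ⟨τ, hτ, hτ0, fun t ht => ?_⟩
  by_contra hcon
  rw [not_le] at hcon
  obtain ⟨z, hz, hz0⟩ := intermediate_value_Icc' ht.2
    (hF.mono (Set.Icc_subset_Icc_left (hτ.1.trans ht.1))) ⟨hq, hcon.le⟩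
  have h1 : z ≤ τ := hmax ⟨⟨hτ.1.trans (ht.1.trans hz.1), hz.2⟩, hz0⟩
  have h2 : t = τ := le_antisymm (hz.1.trans h1) ht.1
  rw [h2] at hcon
  exact hcon.ne' hτ0

namespace AgreeableInstance

variable {P : AgreeableInstance} {i j : ℕ} {x y : ℝ} {J : Finset ℕ}

namespace Schedule

/-- The speed cost and the on-time cost during `[s, t)`. -/
def energy (S : P.Schedule (Set.Ico x y) J) (s t : ℝ) : ℝ≥0∞ :=
  (∫⁻ z in Set.Ico s t, (S.speed z : ℝ≥0∞) ^ P.α) +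
    ENNReal.ofReal P.g * volume (S.onSet ∩ Set.Ico s t)

theorem energy_add (S : P.Schedule (Set.Ico x y) J) {s t u : ℝ} (hst : s ≤ t) (htu : t ≤ u) :
    S.energy s t + S.energy t u = S.energy s u := by
  have h : volume (S.onSet ∩ Set.Ico s u) =
      volume (S.onSet ∩ Set.Ico s t) + volume (S.onSet ∩ Set.Ico t u) := by
    rw [← Set.Ico_union_Ico_eq_Ico hst htu, Set.inter_union_distrib_left, measure_union]
    · rw [Set.disjoint_left]
      exact fun z hz hz' => not_lt.2 hz'.2.1 hz.2.2
    · exact S.measurableSet_onSet.inter measurableSet_Ico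
  rw [energy, energy, energy, h, lintegral_Ico_add _ hst htu]
  ring

theorem cost_eq (S : P.Schedule (Set.Ico x y) J) : S.speedCost + S.modeCost =
    S.energy x y + ((maxIntervals S.offSet).encard : ℝ≥0∞) * ENNReal.ofReal P.L := by
  have : S.onSet ∩ Set.Ico x y = S.onSet := Set.inter_eq_left.2 fun z hz => hz.1
  rw [energy, this, speedCost, modeCost]
  ring

theorem energy_of_on (S : P.Schedule (Set.Ico x y) J) {s t : ℝ} (hs : x ≤ s) (ht : t ≤ y)
    (h : ∀ z ∈ Set.Ico s t, S.mode z = Mode.on) :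
    S.energy s t = (∫⁻ z in Set.Ico s t, (S.speed z : ℝ≥0∞) ^ P.α) +
      ENNReal.ofReal (P.g * (t - s)) := by
  have : S.onSet ∩ Set.Ico s t = Set.Ico s t :=
    Set.inter_eq_right.2 fun z hz => ⟨⟨hs.trans hz.1, hz.2.trans_le ht⟩, h z hz⟩
  rw [energy, this, Real.volume_Ico, ENNReal.ofReal_mul P.g_pos.le]

end Schedule

/-- Before the first shutdown, at time `u`, the jobs preceding a block cost at least `Y`, and
all other work done before `u` costs at least `g*` per unit. If not all of the preceding jobs are
completed by the release of the block, then their speed is increased to the critical speed during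
a final part of the time before that release. -/
theorem Y_add_le_energy (S : P.Schedule (Set.Ico x y) (Finset.Ico i (j + 1)))
    (hx : P.dl (i - 1) = x) (hi : 1 ≤ i) (hj : j ≤ P.n) {V : ℝ → ℝ} (hF : IsFlow x y S.speed V)
    (hV : P.Feasible x y i (j + 1) V) {a : ℕ} (hia : i ≤ a) (haj : a ≤ j)
    (hblock : ∀ l, i ≤ l → l < a → P.cw a - P.cw l < P.sStar * (P.rRestr i a - P.rRestr i l))
    {u : ℝ} (hu : x ≤ u) (huy : u ≤ y) (hau : P.r a ≤ u) (hVu : P.cw a ≤ V u)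
    (hon : ∀ t ∈ Set.Ico x u, S.mode t = Mode.on) :
    P.Y i (a - 1) + ENNReal.ofReal (P.gStar * (V u - P.cw a)) ≤ S.energy x u := by
  have hs := P.sStar_pos
  have hg := P.g_pos
  have hα := P.two_le_α
  have hgs := P.gStar_nonneg
  have hrel : P.rel a = P.r a := rel_eq (by omega)
  rcases le_or_gt (P.r a) x with hle | hlt
  · have hai : a = i := by
      by_contra hne
      have h1 := hblock i le_rfl (by omega)
      have h2 : P.rRestr i a = x := by rw [rRestr, hx]; exact max_eq_right hle
      have h3 : P.rRestr i i = x := by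
        rw [rRestr, hx]
        exact max_eq_right ((P.r_le hi hia (by omega)).trans hle)
      have h4 := P.cw_mono hi hia (by omega)
      rw [h2, h3] at h1
      linarith
    subst hai
    have hY : P.Y a (a - 1) = 0 := by
      rw [← nonpos_iff_eq_zero]
      have h1 : P.g * (P.r a - x) ≤ 0 :=
        mul_nonpos_of_nonneg_of_nonpos hg.le (sub_nonpos.2 hle)
      have h3 := Y_le hi hx hrel (Schedule.idle P x (P.r a) Mode.on a)
        (Schedule.speedCost_idle _ _ _ _).le
      rwa [ENNReal.ofReal_of_nonpos h1, add_zero] at h3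
    rw [hY, zero_add, ← hV.left]
    exact S.ofReal_gStar_mul_le hF le_rfl hu huy
  · set ρ := P.r a with hρ
    have hrR : P.rRestr i a = ρ := by rw [rRestr, hx]; exact max_eq_left hlt.le
    have hρy : ρ ≤ y := hau.trans huy
    have hVρ : V ρ ≤ P.cw a := hV.rel a hia (by omega) ρ ⟨hlt.le, hρy⟩ le_rfl
    -- `ℓ` is the latest way to complete the jobs preceding `a` at critical speed by the
    -- release `ρ` of `a`;
    -- from the last time `τ` at which `V` meets `ℓ`, the flow is replaced by `ℓ`
    set ℓ : ℝ → ℝ := fun t => P.cw a + P.sStar * (t - ρ) with hℓ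
    have hstart : 0 ≤ V x - ℓ x := by
      simp only [hℓ]
      rw [hV.left]
      rcases hia.eq_or_lt with h | h
      · rw [h]
        have := mul_pos hs (sub_pos.2 hlt)
        linarith
      · have h1 := hblock i le_rfl h
        have h2 : x ≤ P.rRestr i i := hx ▸ le_max_right _ _
        have h3 := mul_le_mul_of_nonneg_left h2 hs.le
        rw [hrR] at h1
        linarith
    have hend : V ρ - ℓ ρ ≤ 0 := by simp only [hℓ]; linarith
    obtain ⟨τ, hτ, hτ0, hneg⟩ := exists_last_zero (F := fun t => V t - ℓ t) hlt.le
      (((hF.cont.mono (Set.Icc_subset_Icc_right hρy))).sub (by fun_prop)) hstart hend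
    have hVτ : V τ = ℓ τ := sub_eq_zero.1 hτ0
    have hGlue := (hF.restrict le_rfl (hτ.2.trans hρy)).glue
      (IsFlow.const τ ρ P.sCrit (P.cw a) ρ) hVτ hτ.1 hτ.2
    simp only [coe_sCrit] at hGlue
    have hr : ∀ t, τ ≤ t → (if t ≤ τ then V t else P.cw a + P.sStar * (t - ρ)) = ℓ t := by
      intro t ht
      rcases ht.eq_or_lt with rfl | h
      · simp [hVτ]
      · simp [not_le.2 h, hℓ]
    have hl : ∀ t, t ≤ τ → (if t ≤ τ then V t else P.cw a + P.sStar * (t - ρ)) = V t :=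
      fun t ht => by simp [ht]
    have hfeas : P.Feasible x ρ i a
        (fun t => if t ≤ τ then V t else P.cw a + P.sStar * (t - ρ)) := by
      refine ⟨?_, ?_, ?_, ?_⟩
      · exact (hl x hτ.1).trans hV.left
      · exact (hr ρ hτ.2).trans (by simp [hℓ])
      · intro l hil hla t ht htr
        rcases le_total t τ with h | h
        · rw [hl t h]
          exact hV.rel l hil (by omega) t ⟨ht.1, ht.2.trans hρy⟩ htr
        · rw [hr t h]
          have h1 := hblock l hil hla
          have h2 : t ≤ P.rRestr i l := htr.trans (le_max_left _ _)
          have h3 := mul_le_mul_of_nonneg_left h2 hs.le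
          rw [hrR] at h1
          simp only [hℓ]
          linarith
      · intro l hil hla t ht htd
        have h1 := hV.dead l hil (by omega) t ⟨ht.1, ht.2.trans hρy⟩ htd
        rcases le_total t τ with h | h
        · rwa [hl t h]
        · rw [hr t h]
          have := hneg t ⟨h, ht.2⟩
          linarith
    obtain ⟨S', hS', _⟩ := hfeas.exists_schedule_on hGlue hi hia (by omega) hlt.le
    have hcost : S'.speedCost = (∫⁻ z in Set.Ico x τ, (S.speed z : ℝ≥0∞) ^ P.α) +
        ENNReal.ofReal (P.sStar ^ P.α * (ρ - τ)) := by
      rw [Schedule.speedCost, hS', lintegral_Ico_add _ hτ.1 hτ.2]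
      congr 1
      · refine setLIntegral_congr_fun measurableSet_Ico fun z hz => ?_
        simp [hz.2]
      · rw [ENNReal.ofReal_mul (by positivity), ← Real.volume_Ico, ← setLIntegral_const,
          ← coe_sCrit, ← ENNReal.ofReal_rpow_of_nonneg (NNReal.coe_nonneg _) (by linarith),
          ENNReal.ofReal_coe_nnreal]
        refine setLIntegral_congr_fun measurableSet_Ico fun z hz => ?_
        simp [not_lt.2 hz.1]
    have hYle : P.Y i (a - 1) ≤ (∫⁻ z in Set.Ico x τ, (S.speed z : ℝ≥0∞) ^ P.α) +
        ENNReal.ofReal (P.sStar ^ P.α * (ρ - τ)) + ENNReal.ofReal (P.g * (ρ - x)) := by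
      rw [← hcost]
      exact Y_le (by omega) hx hrel S' le_rfl
    have htan := (hF.restrict hτ.1 hρy).ofReal_rpow_mul_le hα hτ.2 P.sCrit
      (by rw [coe_sCrit]; have := hVτ; simp only [hℓ] at this; linarith)
    have hgap : P.sStar * (ρ - τ) - (V ρ - V τ) = P.cw a - V ρ := by
      rw [hVτ]; simp only [hℓ]; ring
    rw [coe_sCrit, ← gStar_eq, hgap] at htan
    have hmono : V ρ ≤ V u := hF.mono ⟨hlt.le, hρy⟩ ⟨hu, huy⟩ hau
    have hrest := S.ofReal_gStar_mul_le hF hlt.le hau huy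
    rw [← Schedule.energy] at hrest
    have hen := S.energy_of_on le_rfl hρy fun z hz => hon z ⟨hz.1, hz.2.trans_le hau⟩
    rw [lintegral_Ico_add _ hτ.1 hτ.2] at hen
    have hsum : ENNReal.ofReal (P.gStar * (P.cw a - V ρ)) +
        ENNReal.ofReal (P.gStar * (V u - P.cw a)) = ENNReal.ofReal (P.gStar * (V u - V ρ)) := by
      rw [← ENNReal.ofReal_add (mul_nonneg hgs (sub_nonneg.2 hVρ))
        (mul_nonneg hgs (sub_nonneg.2 hVu))]
      congr 1; ring
    rw [← S.energy_add hlt.le hau, hen]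
    calc P.Y i (a - 1) + ENNReal.ofReal (P.gStar * (V u - P.cw a))
        ≤ ((∫⁻ z in Set.Ico x τ, (S.speed z : ℝ≥0∞) ^ P.α) +
          ((∫⁻ z in Set.Ico τ ρ, (S.speed z : ℝ≥0∞) ^ P.α) +
            ENNReal.ofReal (P.gStar * (P.cw a - V ρ))) + ENNReal.ofReal (P.g * (ρ - x))) +
          ENNReal.ofReal (P.gStar * (V u - P.cw a)) := by
          gcongr
          exact hYle.trans (by gcongr)
      _ = (∫⁻ z in Set.Ico x τ, (S.speed z : ℝ≥0∞) ^ P.α) +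
          (∫⁻ z in Set.Ico τ ρ, (S.speed z : ℝ≥0∞) ^ P.α) + ENNReal.ofReal (P.g * (ρ - x)) +
          (ENNReal.ofReal (P.gStar * (P.cw a - V ρ)) +
            ENNReal.ofReal (P.gStar * (V u - P.cw a))) := by ring
      _ ≤ _ := by rw [hsum]; gcongr

/-- After the deadline `d c` of a block, the remaining jobs cost at least `O`, up to the energy
`g*` per unit of the work on them that is done before `d c`. That work is moved to the beginning
of `[d c, y)`, where the machine is run at critical speed until it has caught up. -/
theorem O_le_energy_add (S : P.Schedule (Set.Ico x y) (Finset.Ico i (j + 1)))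
    (hy : P.rel (j + 1) = y) (hi : 1 ≤ i) (hj : j ≤ P.n) {V : ℝ → ℝ} (hF : IsFlow x y S.speed V)
    (hV : P.Feasible x y i (j + 1) V) {c : ℕ} (hic : i ≤ c) (hcj : c ≤ j)
    (hblock : ∀ l, c < l → l ≤ j →
      P.cw (l + 1) - P.cw (c + 1) < P.sStar * (P.dRestr j l - P.d c))
    (hxc : x ≤ P.d c) (hcy : P.d c < y) :
    P.O (c + 1) j ≤ S.energy (P.d c) y +
      ((maxIntervals (S.offSet ∩ Set.Ici (P.d c))).encard : ℝ≥0∞) * ENNReal.ofReal P.L +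
      ENNReal.ofReal (P.gStar * (V (P.d c) - P.cw (c + 1))) := by
  have hs := P.sStar_pos
  have hg := P.g_pos
  have hα := P.two_le_α
  have hgs := P.gStar_nonneg
  set z := P.d c with hz
  have hVz : P.cw (c + 1) ≤ V z := hV.dead c hic (by omega) z ⟨hxc, hcy.le⟩ le_rfl
  set ℓ : ℝ → ℝ := fun t => P.cw (c + 1) + P.sStar * (t - z) with hℓ
  -- from `z` until the first time `τ` at which `V` meets `ℓ`, the flow is replaced by `ℓ`, that is,
  -- the jobs after `c` are processed at critical speed
  have hend : V y - ℓ y ≤ 0 := by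
    simp only [hℓ]
    rw [hV.right]
    rcases hcj.eq_or_lt with h | h
    · rw [h]
      have := mul_pos hs (sub_pos.2 hcy)
      linarith
    · have h1 := hblock j h le_rfl
      have h2 : P.dRestr j j ≤ y := hy ▸ min_le_right _ _
      have h3 := mul_le_mul_of_nonneg_left h2 hs.le
      linarith
  obtain ⟨τ, hτ, hτ0, hpos⟩ := exists_first_zero (F := fun t => V t - ℓ t) hcy.le
    ((hF.cont.mono (Set.Icc_subset_Icc_left hxc)).sub (by fun_prop))
    (by simp only [hℓ]; linarith) hend
  have hVτ : V τ = ℓ τ := sub_eq_zero.1 hτ0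
  have hGlue := (IsFlow.const z τ P.sCrit (P.cw (c + 1)) z).glue
    (hF.restrict (hxc.trans hτ.1) le_rfl) hVτ.symm hτ.1 hτ.2
  simp only [coe_sCrit] at hGlue
  have hl : ∀ t, t ≤ τ → (if t ≤ τ then P.cw (c + 1) + P.sStar * (t - z) else V t) = ℓ t :=
    fun t ht => by simp [ht, hℓ]
  have hr : ∀ t, τ ≤ t → (if t ≤ τ then P.cw (c + 1) + P.sStar * (t - z) else V t) = V t := by
    intro t ht
    rcases ht.eq_or_lt with rfl | h
    · simp [hVτ, hℓ]
    · simp [not_le.2 h]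
  have hfeas : P.Feasible z y (c + 1) (j + 1)
      (fun t => if t ≤ τ then P.cw (c + 1) + P.sStar * (t - z) else V t) := by
    refine ⟨?_, ?_, ?_, ?_⟩
    · exact (hl z hτ.1).trans (by simp [hℓ])
    · exact (hr y hτ.2).trans hV.right
    · intro l hcl hlj t ht htr
      have h1 := hV.rel l (by omega) hlj t ⟨hxc.trans ht.1, ht.2⟩ htr
      rcases le_total t τ with h | h
      · rw [hl t h]
        have := hpos t ⟨ht.1, h⟩
        linarith
      · rwa [hr t h]
    · intro l hcl hlj t ht htd
      rcases le_total t τ with h | h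
      · rw [hl t h]
        have h1 := hblock l (by omega) (by omega)
        have h2 : P.dRestr j l ≤ t := (min_le_left _ _).trans htd
        have h3 := mul_le_mul_of_nonneg_left h2 hs.le
        simp only [hℓ]
        linarith
      · rw [hr t h]
        exact hV.dead l (by omega) hlj t ⟨hxc.trans ht.1, ht.2⟩ htd
  obtain ⟨S', hS', hSm⟩ := hfeas.exists_schedule hGlue (by omega) (by omega) (by omega) hcy.le
    (μ := fun t => if t < τ then Mode.on else S.mode t)
    ((RightConstOn.const Mode.on).glue (S.rightConst_mode.mono (hxc.trans hτ.1) le_rfl)) (by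
      intro t ht hσ
      by_cases h : t < τ
      · simp [h]
      · simp only [h, if_false] at hσ ⊢
        exact S.on_of_speed_pos t ⟨hxc.trans ht.1, ht.2⟩ hσ)
  have hspeed : S'.speedCost = ENNReal.ofReal (P.sStar ^ P.α * (τ - z)) +
      ∫⁻ t in Set.Ico τ y, (S.speed t : ℝ≥0∞) ^ P.α := by
    rw [Schedule.speedCost, hS', lintegral_Ico_add _ hτ.1 hτ.2]
    congr 1
    · rw [ENNReal.ofReal_mul (by positivity), ← Real.volume_Ico, ← setLIntegral_const,
        ← coe_sCrit, ← ENNReal.ofReal_rpow_of_nonneg (NNReal.coe_nonneg _) (by linarith),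
        ENNReal.ofReal_coe_nnreal]
      refine setLIntegral_congr_fun measurableSet_Ico fun t ht => ?_
      simp [ht.2]
    · refine setLIntegral_congr_fun measurableSet_Ico fun t ht => ?_
      simp [not_lt.2 ht.1]
  have honS : S'.onSet ⊆ Set.Ico z τ ∪ (S.onSet ∩ Set.Ico τ y) := by
    rintro t ⟨ht, hm⟩
    rw [hSm] at hm
    by_cases h : t < τ
    · exact Or.inl ⟨ht.1, h⟩
    · simp only [h, if_false] at hm
      exact Or.inr ⟨⟨⟨hxc.trans ht.1, ht.2⟩, hm⟩, not_lt.1 h, ht.2⟩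
  have hoffS : S'.offSet = (S.offSet ∩ Set.Ici z) ∩ Set.Ici τ := by
    ext t
    constructor
    · rintro ⟨ht, hm⟩
      rw [hSm] at hm
      by_cases h : t < τ
      · simp [h] at hm
      · simp only [h, if_false] at hm
        exact ⟨⟨⟨⟨hxc.trans ht.1, ht.2⟩, hm⟩, ht.1⟩, not_lt.1 h⟩
    · rintro ⟨⟨⟨ht, hm⟩, hzt⟩, hτt⟩
      refine ⟨⟨hzt, ht.2⟩, ?_⟩
      rw [hSm]
      simpa [not_lt.2 (show τ ≤ t from hτt)] using hm
  have hcount : ((maxIntervals S'.offSet).encard : ℝ≥0∞) ≤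
      (maxIntervals (S.offSet ∩ Set.Ici z)).encard := by
    rw [hoffS, ENat.toENNReal_le]
    exact encard_maxIntervals_inter_le_self _ Set.ordConnected_Ici
  have hvol : ENNReal.ofReal P.g * volume S'.onSet ≤ ENNReal.ofReal (P.g * (τ - z)) +
      ENNReal.ofReal P.g * volume (S.onSet ∩ Set.Ico τ y) := by
    rw [ENNReal.ofReal_mul hg.le, ← Real.volume_Ico, ← mul_add]
    gcongr
    exact (measure_mono honS).trans (measure_union_le _ _)
  have hcrit : ENNReal.ofReal (P.sStar ^ P.α * (τ - z)) + ENNReal.ofReal (P.g * (τ - z)) =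
      ENNReal.ofReal (P.gStar * (V τ - V z)) +
        ENNReal.ofReal (P.gStar * (V z - P.cw (c + 1))) := by
    have h1 : 0 ≤ τ - z := sub_nonneg.2 hτ.1
    have h2 : V z ≤ V τ := hF.mono ⟨hxc, hcy.le⟩ ⟨hxc.trans hτ.1, hτ.2⟩ hτ.1
    rw [← ENNReal.ofReal_add (by positivity) (by positivity), ← ENNReal.ofReal_add
      (mul_nonneg hgs (sub_nonneg.2 h2)) (mul_nonneg hgs (sub_nonneg.2 hVz)), hVτ]
    congr 1
    simp only [hℓ]
    linear_combination -(τ - z) * P.gStar_mul_sStar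
  have hrest := S.ofReal_gStar_mul_le hF hxc hτ.1 hτ.2
  rw [← Schedule.energy] at hrest
  have hO : P.O (c + 1) j ≤ S'.speedCost + S'.modeCost := by
    have hdl : P.dl (c + 1 - 1) = z := by rw [Nat.add_sub_cancel, dl_eq (by omega)]
    refine O_le ?_
    rw [hdl, hy]
    exact ⟨S', le_rfl⟩
  refine hO.trans ?_
  rw [← S.energy_add hτ.1 hτ.2, hspeed, Schedule.modeCost]
  calc _ ≤ ENNReal.ofReal (P.sStar ^ P.α * (τ - z)) +
        (∫⁻ t in Set.Ico τ y, (S.speed t : ℝ≥0∞) ^ P.α) +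
        (((maxIntervals (S.offSet ∩ Set.Ici z)).encard : ℝ≥0∞) * ENNReal.ofReal P.L +
        (ENNReal.ofReal (P.g * (τ - z)) +
          ENNReal.ofReal P.g * volume (S.onSet ∩ Set.Ico τ y))) := by gcongr
    _ = (ENNReal.ofReal (P.sStar ^ P.α * (τ - z)) + ENNReal.ofReal (P.g * (τ - z))) +
        S.energy τ y +
        ((maxIntervals (S.offSet ∩ Set.Ici z)).encard : ℝ≥0∞) * ENNReal.ofReal P.L := by
        rw [Schedule.energy]; ring
    _ = ENNReal.ofReal (P.gStar * (V τ - V z)) + S.energy τ y +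
        ((maxIntervals (S.offSet ∩ Set.Ici z)).encard : ℝ≥0∞) * ENNReal.ofReal P.L +
        ENNReal.ofReal (P.gStar * (V z - P.cw (c + 1))) := by rw [hcrit]; ring
    _ ≤ _ := by gcongr

end AgreeableInstance

/-! ### The recursion -/

namespace AgreeableInstance

variable {P : AgreeableInstance} {i j : ℕ} {x y : ℝ} {J : Finset ℕ}

/-- The first shutdown begins at a well-defined time, before which the machine is on. -/
theorem Schedule.exists_first_off (S : P.Schedule (Set.Ico x y) J) (h : S.offSet.Nonempty) :
    ∃ u ∈ S.offSet, (∀ t ∈ Set.Ico x u, S.mode t = Mode.on) ∧ ∀ t ∈ S.offSet, u ≤ t := by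
  obtain ⟨s, hs⟩ := h
  obtain ⟨u, hu, hus, hne⟩ := S.rightConst_mode.exists_next le_rfl hs.1.1 hs.1.2
  have huy : u < y := hu.2.trans_lt hs.1.2
  rw [hs.2] at hus hne
  refine ⟨u, ⟨⟨hu.1, huy⟩, hus⟩, fun t ht => ?_, fun t ht => ?_⟩
  · by_contra h
    exact hne t ht (Schedule.mode_eq_off_of_ne h)
  · by_contra h
    exact hne t ⟨ht.1.1, not_le.1 h⟩ ht.2

/-- No work is done during a shutdown. -/
theorem Schedule.work_le_of_off (S : P.Schedule (Set.Ico x y) J) {V : ℝ → ℝ}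
    (hF : IsFlow x y S.speed V)
    {u q : ℝ} (huq : u ≤ q) (hoff : Set.Icc u q ⊆ S.offSet) : V q ≤ V u := by
  have hu := (hoff ⟨le_rfl, huq⟩).1
  have hq := (hoff ⟨huq, le_rfl⟩).1
  have h := hF.mass u q hu.1 huq hq.2.le
  have h0 : ∫⁻ z in Set.Ico u q, (S.speed z : ℝ≥0∞) = ∫⁻ _ in Set.Ico u q, 0 := by
    refine setLIntegral_congr_fun measurableSet_Ico fun z hz => ?_
    have hz' := hoff ⟨hz.1, hz.2.le⟩
    have : S.speed z = 0 := by
      by_contra hne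
      have := S.on_of_speed_pos z hz'.1 (pos_iff_ne_zero.2 hne)
      rw [hz'.2] at this
      exact Mode.noConfusion this
    simp [this]
  rw [h0, lintegral_zero] at h
  have := ENNReal.ofReal_eq_zero.1 h.symm
  linarith

/-- From the first shutdown on: the jobs up to `c = h k` cost at least `g*` per unit of work, the
following jobs at least `O`, and the first shutdown is over before the deadline of `c`, so that it
is not accounted for in `O`. -/
theorem O_add_le_energy_of_first_off (S : P.Schedule (Set.Ico x y) (Finset.Ico i (j + 1)))
    (hy : P.rel (j + 1) = y) (hi : 1 ≤ i) (hj : j ≤ P.n) {V : ℝ → ℝ} (hF : IsFlow x y S.speed V)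
    (hV : P.Feasible x y i (j + 1) V) {u : ℝ} (hu : u ∈ S.offSet) (hfirst : ∀ t ∈ S.offSet, u ≤ t)
    {k c : ℕ} (hik : i ≤ k) (hkj : k ≤ j) (hc : c = P.h j k) (hVu : V u < P.cw (c + 1)) :
    ENNReal.ofReal (P.gStar * (P.cw (c + 1) - V u)) + P.O (c + 1) j + ENNReal.ofReal P.L ≤
      S.energy u y + ((maxIntervals S.offSet).encard : ℝ≥0∞) * ENNReal.ofReal P.L := by
  have hgs := P.gStar_nonneg
  have hkc : k ≤ c := hc ▸ le_h hkj
  have hcj : c ≤ j := hc ▸ h_le k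
  have huT := hu.1
  have hxy : x ≤ y := huT.1.trans huT.2.le
  rcases lt_or_ge (P.d c) y with hlt | hge
  · have hucd : u ≤ P.d c := by
      by_contra hcon
      have := hV.dead c (by omega) (by omega) u ⟨huT.1, huT.2.le⟩ (not_le.1 hcon).le
      linarith
    have hxc : x ≤ P.d c := huT.1.trans hucd
    have hdR : P.dRestr j c = P.d c := by rw [dRestr, hy]; exact min_eq_left hlt.le
    have hO := O_le_energy_add S hy hi hj hF hV (hik.trans hkc) hcj (fun l hl hlj => by
      have := cw_sub_lt_of_h_lt (P := P) (by omega : 1 ≤ k) hkj l (hc ▸ hl) hlj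
      rwa [← hc, hdR] at this) hxc hlt
    have hVz : P.cw (c + 1) ≤ V (P.d c) :=
      hV.dead c (by omega) (by omega) _ ⟨hxc, hlt.le⟩ le_rfl
    have hwork := S.ofReal_gStar_mul_le hF huT.1 hucd hlt.le
    rw [← Schedule.energy] at hwork
    -- a shutdown lasting from `u` to the deadline of `c` would leave work of job `c` undone
    have hcount : ((maxIntervals (S.offSet ∩ Set.Ici (P.d c))).encard : ℝ≥0∞) + 1 ≤
        (maxIntervals S.offSet).encard := by
      have h1 : 1 ≤ (maxIntervals (S.offSet ∩ Set.Iic u)).encard :=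
        one_le_encard_maxIntervals ⟨u, hu, Set.mem_Iic.2 le_rfl⟩
      have h2 := encard_maxIntervals_inter_add_le (X := S.offSet) (K := Set.Iic u)
        (K' := Set.Ici (P.d c)) Set.ordConnected_Iic Set.ordConnected_Ici (by
          intro p hp q hq
          have hpu : p = u := le_antisymm hp.2 (hfirst p hp.1)
          refine ⟨hp.2.trans (hucd.trans hq.2), ?_⟩
          by_contra hcon
          push Not at hcon
          have h3 := S.work_le_of_off hF (u := u) (q := q) (hucd.trans hq.2)
            fun z hz => hcon z (hpu ▸ hz)
          have h4 := hV.dead c (by omega) (by omega) q ⟨hq.1.1.1, hq.1.1.2.le⟩ hq.2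
          linarith)
      have h3 := (add_le_add_left h1 (maxIntervals (S.offSet ∩ Set.Ici (P.d c))).encard).trans h2
      rw [add_comm] at h3
      exact_mod_cast h3
    have hsum : ENNReal.ofReal (P.gStar * (P.cw (c + 1) - V u)) +
        ENNReal.ofReal (P.gStar * (V (P.d c) - P.cw (c + 1))) =
        ENNReal.ofReal (P.gStar * (V (P.d c) - V u)) := by
      rw [← ENNReal.ofReal_add (mul_nonneg hgs (sub_nonneg.2 hVu.le))
        (mul_nonneg hgs (sub_nonneg.2 hVz))]
      congr 1; ring
    rw [← S.energy_add hucd hlt.le]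
    set N : ℝ≥0∞ := ((maxIntervals (S.offSet ∩ Set.Ici (P.d c))).encard : ℝ≥0∞)
    calc _ ≤ ENNReal.ofReal (P.gStar * (P.cw (c + 1) - V u)) +
          (S.energy (P.d c) y + N * ENNReal.ofReal P.L +
            ENNReal.ofReal (P.gStar * (V (P.d c) - P.cw (c + 1)))) + ENNReal.ofReal P.L := by
          gcongr
      _ = (ENNReal.ofReal (P.gStar * (P.cw (c + 1) - V u)) +
            ENNReal.ofReal (P.gStar * (V (P.d c) - P.cw (c + 1)))) + S.energy (P.d c) y +
          (N + 1) * ENNReal.ofReal P.L := by ring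
      _ ≤ _ := by rw [hsum]; gcongr
  -- the block reaches the end of the subinstance, and `(c + 1, j)` is empty of value `0`
  · have hcj' : c = j := by
      by_contra hne
      have := d_h_lt (P := P) (by omega : 1 ≤ k) hkj hj (by omega)
      rw [← hc, hy] at this
      linarith
    subst hcj'
    have hO : P.O (c + 1) c = 0 := by
      have h := O_empty (P := P) (i := c + 1) (by omega)
      rw [Nat.add_sub_cancel, hy, dl_eq (by omega)] at h
      rw [h, ENNReal.ofReal_of_nonpos
        (mul_nonpos_of_nonneg_of_nonpos P.g_pos.le (sub_nonpos.2 hge))]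
      exact min_eq_right zero_le
    have hwork := S.ofReal_gStar_mul_le hF huT.1 huT.2.le le_rfl
    rw [← Schedule.energy, hV.right] at hwork
    have h1 : (1 : ℝ≥0∞) ≤ ((maxIntervals S.offSet).encard : ℝ≥0∞) := by
      exact_mod_cast one_le_encard_maxIntervals ⟨u, hu⟩
    rw [hO, add_zero]
    gcongr
    calc ENNReal.ofReal P.L = 1 * ENNReal.ofReal P.L := (one_mul _).symm
      _ ≤ _ := by gcongr

variable (P) in
/-- The right-hand side of the recursion. -/
def recValue (i j : ℕ) : ℝ≥0∞ :=
  min (P.Y i j)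
    (min (ENNReal.ofReal P.L + P.critCost i (P.h j i) + P.O (P.h j i + 1) j)
      (min
        (P.Y i (P.fInv i j j - 1) + P.critCost (P.fInv i j j) j + ENNReal.ofReal P.L)
        (⨅ (a : ℕ) (b : ℕ) (c : ℕ) (_ : i ≤ a ∧ a ≤ j ∧ b = P.f i j a ∧
            a = P.fInv i j b ∧ b < j ∧ c = P.h j (b + 1)),
          P.Y i (a - 1) + P.critCost a b + ENNReal.ofReal P.L + P.critCost (b + 1) c
            + P.O (c + 1) j)))

/-- Every schedule costs at least as much as some term of the recursion: the one determined by the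
block of the job that is processed last before the first shutdown. -/
theorem recValue_le (hi : 1 ≤ i) (hij : i ≤ j) (hj : j ≤ P.n) (S : P.SubSchedule i j) :
    P.recValue i j ≤ S.speedCost + S.modeCost := by
  have hgs := P.gStar_nonneg
  suffices H : ∀ x y, P.dl (i - 1) = x → P.rel (j + 1) = y →
      ∀ S : P.Schedule (Set.Ico x y) (Finset.Ico i (j + 1)),
      P.recValue i j ≤ S.speedCost + S.modeCost by
    have key : ∀ K, K = Finset.Ico i (j + 1) →
        ∀ S : P.Schedule (Set.Ico (P.dl (i - 1)) (P.rel (j + 1))) K,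
        P.recValue i j ≤ S.speedCost + S.modeCost := by
      rintro K rfl S
      exact H _ _ rfl rfl S
    exact key _ (Finset.Ico_add_one_right_eq_Icc i j).symm S
  intro x y hx hy S
  rcases S.offSet.eq_empty_or_nonempty with hoff | hoff
  · refine (min_le_left _ _).trans ?_
    rw [S.modeCost_of_on fun t ht => by
      by_contra hne
      have : t ∈ S.offSet := ⟨ht, Schedule.mode_eq_off_of_ne hne⟩
      rw [hoff] at this
      exact this]
    have := Y_le (a := j + 1) (by omega) hx hy S le_rfl
    rwa [Nat.add_sub_cancel] at this
  · refine (min_le_right _ _).trans ?_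
    obtain ⟨u, hu, hon, hfirst⟩ := S.exists_first_off hoff
    have hxy : x ≤ y := hu.1.1.trans hu.1.2.le
    obtain ⟨V, hF, hV⟩ := S.exists_flow hi (by omega) (by omega) hxy
    have huI : u ∈ Set.Icc x y := ⟨hu.1.1, hu.1.2.le⟩
    have hVu_le : V u ≤ P.cw (j + 1) := by
      rw [← hV.right]; exact hF.mono huI ⟨hxy, le_rfl⟩ huI.2
    rw [S.cost_eq, ← S.energy_add huI.1 huI.2]
    set N : ℝ≥0∞ := ((maxIntervals S.offSet).encard : ℝ≥0∞) with hN
    rcases le_or_gt (V u) (P.cw i) with hzero | hpos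
    · -- nothing is processed before the first shutdown
      refine (min_le_left _ _).trans ?_
      have hVu : V u = P.cw i := by
        refine le_antisymm hzero ?_
        rw [← hV.left]; exact hF.mono ⟨le_rfl, hxy⟩ huI huI.1
      have hih : i ≤ P.h j i := le_h hij
      have hhj : P.h j i ≤ j := h_le i
      have h := O_add_le_energy_of_first_off S hy hi hj hF hV hu hfirst le_rfl hij rfl (by
        rw [hVu]; exact P.cw_lt hi (by omega) (by omega))
      rw [hVu, ← critCost_eq (by omega)] at h
      calc _ = P.critCost i (P.h j i) + P.O (P.h j i + 1) j + ENNReal.ofReal P.L := by ring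
        _ ≤ _ := h
        _ ≤ _ := by gcongr; exact le_add_self
    · refine (min_le_right _ _).trans ?_
      classical
      -- `m` is the job processed last before the first shutdown
      have hex : ∃ m, i ≤ m ∧ V u ≤ P.cw (m + 1) := ⟨j, hij, hVu_le⟩
      set m := Nat.find hex with hm
      obtain ⟨him, hVm⟩ : i ≤ m ∧ V u ≤ P.cw (m + 1) := Nat.find_spec hex
      have hmj : m ≤ j := Nat.find_min' hex ⟨hij, hVu_le⟩
      have hmV : P.cw m < V u := by
        rcases him.eq_or_lt with h | h
        · rwa [← h]
        · by_contra hcon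
          refine Nat.find_min hex (m := m - 1) (by omega) ⟨by omega, ?_⟩
          rw [Nat.sub_add_cancel (by omega)]
          exact not_lt.1 hcon
      have hrm : P.r m ≤ u := by
        by_contra hcon
        have := hV.rel m him (by omega) u huI (not_le.1 hcon).le
        linarith
      obtain ⟨a, hia, ham, hmf, hfInv, hblock⟩ := exists_block_start (P := P) him hmj
      have haj : a ≤ j := ham.trans hmj
      have hVa : P.cw a ≤ V u := (P.cw_mono (by omega) ham (by omega)).trans hmV.le
      have hpre := Y_add_le_energy S hx hi hj hF hV hia haj hblock huI.1 huI.2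
        ((P.r_le (by omega) ham (by omega)).trans hrm) hVa hon
      set b := P.f i j a with hb
      have hbj : b ≤ j := f_le a
      rcases hbj.eq_or_lt with hbeq | hblt
      · refine (min_le_left _ _).trans ?_
        rw [hbeq] at hfInv
        rw [← hfInv]
        have hwork := S.ofReal_gStar_mul_le hF huI.1 huI.2 le_rfl
        rw [← Schedule.energy, hV.right] at hwork
        have h1 : (1 : ℝ≥0∞) ≤ N := by
          rw [hN]
          exact_mod_cast one_le_encard_maxIntervals hoff
        have hsum : P.critCost a j = ENNReal.ofReal (P.gStar * (V u - P.cw a)) +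
            ENNReal.ofReal (P.gStar * (P.cw (j + 1) - V u)) := by
          rw [critCost_eq (by omega), ← ENNReal.ofReal_add (mul_nonneg hgs (sub_nonneg.2 hVa))
            (mul_nonneg hgs (sub_nonneg.2 hVu_le))]
          congr 1; ring
        calc _ = (P.Y i (a - 1) + ENNReal.ofReal (P.gStar * (V u - P.cw a))) +
              ENNReal.ofReal (P.gStar * (P.cw (j + 1) - V u)) + 1 * ENNReal.ofReal P.L := by
              rw [hsum]; ring
          _ ≤ _ := by gcongr
      · refine (min_le_right _ _).trans ?_
        set c := P.h j (b + 1) with hc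
        have hbc : b + 1 ≤ c := le_h hblt
        have hcj : c ≤ j := h_le _
        refine (iInf_le _ a).trans ((iInf_le _ b).trans ((iInf_le _ c).trans
          ((iInf_le _ ⟨hia, haj, rfl, hfInv, hblt, rfl⟩).trans ?_)))
        have hVc : V u < P.cw (c + 1) :=
          hVm.trans_lt (P.cw_lt (by omega) (by omega) (by omega))
        have h := O_add_le_energy_of_first_off S hy hi hj hF hV hu hfirst (k := b + 1) (c := c)
          (by omega) hblt rfl hVc
        have hsum : P.critCost a b + P.critCost (b + 1) c =
            ENNReal.ofReal (P.gStar * (V u - P.cw a)) +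
              ENNReal.ofReal (P.gStar * (P.cw (c + 1) - V u)) := by
          have e1 := P.cw_mono (a := a) (b := b + 1) (by omega) (by omega) (by omega)
          have e2 := P.cw_mono (a := b + 1) (b := c + 1) (by omega) (by omega) (by omega)
          rw [critCost_eq (by omega), critCost_eq (by omega),
            ← ENNReal.ofReal_add (mul_nonneg hgs (sub_nonneg.2 e1))
            (mul_nonneg hgs (sub_nonneg.2 e2)), ← ENNReal.ofReal_add
            (mul_nonneg hgs (sub_nonneg.2 hVa)) (mul_nonneg hgs (sub_nonneg.2 hVc.le))]
          congr 1; ring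
        calc _ = P.Y i (a - 1) + (P.critCost a b + P.critCost (b + 1) c) + P.O (c + 1) j +
              ENNReal.ofReal P.L := by ring
          _ = (P.Y i (a - 1) + ENNReal.ofReal (P.gStar * (V u - P.cw a))) +
              (ENNReal.ofReal (P.gStar * (P.cw (c + 1) - V u)) + P.O (c + 1) j +
                ENNReal.ofReal P.L) := by rw [hsum]; ring
          _ ≤ S.energy x u + (S.energy u y + N * ENNReal.ofReal P.L) := add_le_add hpre h
          _ = _ := by ring

/-- If the values of `O` to which the recursion refers are attained, then some schedule costs at
most the right-hand side of the recursion. -/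
theorem Sparse.hasSched_recValue (hsp : P.Sparse i j) (hi : 1 ≤ i) (hij : i ≤ j) (hj : j ≤ P.n)
    (hO : ∀ k, i ≤ k → k ≤ j → P.HasSched (Set.Ico (P.dl (P.h j k)) (P.rel (j + 1)))
      (Finset.Ico (P.h j k + 1) (j + 1)) (P.O (P.h j k + 1) j)) :
    P.HasSched (Set.Ico (P.dl (i - 1)) (P.rel (j + 1))) (Finset.Ico i (j + 1))
      (P.recValue i j) := by
  classical
  have hfirst := hsp.hasSched_off_first hi hij hj (hO i le_rfl hij)
  rcases eq_or_ne (P.recValue i j) ⊤ with htop | htop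
  · rw [htop]; exact hfirst.mono le_top
  have hmin : ∀ p q : ℝ≥0∞, min p q ≠ ⊤ → (p ≠ ⊤ → P.HasSched (Set.Ico (P.dl (i - 1))
      (P.rel (j + 1))) (Finset.Ico i (j + 1)) p) → (q ≠ ⊤ → P.HasSched (Set.Ico (P.dl (i - 1))
      (P.rel (j + 1))) (Finset.Ico i (j + 1)) q) → P.HasSched (Set.Ico (P.dl (i - 1))
      (P.rel (j + 1))) (Finset.Ico i (j + 1)) (min p q) := by
    intro p q hpq hp hq
    rcases min_choice p q with h | h <;> rw [h] at hpq ⊢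
    · exact hp hpq
    · exact hq hpq
  refine hmin _ _ htop (fun hY => hasSched_Y hi (by omega) hj hY) fun htop => ?_
  refine hmin _ _ htop (fun _ => hfirst) fun htop => ?_
  refine hmin _ _ htop (fun hne => ?_) fun hne => ?_
  · obtain ⟨h1, h2, h3⟩ := fInv_spec (P := P) hij
    exact hsp.hasSched_off_last hi hj h1 h2 h3 fun hY => hne (by rw [hY]; simp)
  · -- the infimum ranges over finitely many `a`, hence is attained
    set F : Finset ℕ := {a ∈ Finset.Icc i j | a = P.fInv i j (P.f i j a) ∧ P.f i j a < j} with hF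
    set T : ℕ → ℝ≥0∞ := fun a => P.Y i (a - 1) + P.critCost a (P.f i j a) + ENNReal.ofReal P.L +
      P.critCost (P.f i j a + 1) (P.h j (P.f i j a + 1)) +
      P.O (P.h j (P.f i j a + 1) + 1) j with hT
    have hmem : ∀ a, a ∈ F ↔ (i ≤ a ∧ a ≤ j) ∧ a = P.fInv i j (P.f i j a) ∧ P.f i j a < j :=
      fun a => by rw [hF, Finset.mem_filter, Finset.mem_Icc]
    rcases F.eq_empty_or_nonempty with hE | hE
    · exfalso
      refine hne (iInf_eq_top.2 fun a => iInf_eq_top.2 fun b => iInf_eq_top.2 fun c =>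
        iInf_eq_top.2 ?_)
      rintro ⟨h1, h2, rfl, h3, h4, _⟩
      have : a ∈ F := (hmem a).2 ⟨⟨h1, h2⟩, h3, h4⟩
      rw [hE] at this
      exact absurd this (Finset.notMem_empty a)
    · obtain ⟨a, ha, hmina⟩ := F.exists_min_image T hE
      have hle : T a ≤ ⨅ (a : ℕ) (b : ℕ) (c : ℕ) (_ : i ≤ a ∧ a ≤ j ∧ b = P.f i j a ∧
            a = P.fInv i j b ∧ b < j ∧ c = P.h j (b + 1)),
          P.Y i (a - 1) + P.critCost a b + ENNReal.ofReal P.L + P.critCost (b + 1) c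
            + P.O (c + 1) j := by
        refine le_iInf fun a' => le_iInf fun b => le_iInf fun c => le_iInf ?_
        rintro ⟨h1, h2, rfl, h3, h4, rfl⟩
        exact hmina a' ((hmem a').2 ⟨⟨h1, h2⟩, h3, h4⟩)
      obtain ⟨⟨h1, h2⟩, h3, h4⟩ := (hmem a).1 ha
      have hTne : T a ≠ ⊤ := ne_top_of_le_ne_top hne hle
      refine HasSched.mono (hsp.hasSched_off_between hi hj h1 h2 rfl h4 rfl
        (fun hY => hTne (by simp [hT, hY])) (hO _ ?_ h4)) hle
      have : a ≤ P.f i j a := le_f h2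
      omega

theorem O_eq_recValue (hi : 1 ≤ i) (hij : i ≤ j) (hj : j ≤ P.n)
    (h : P.HasSched (Set.Ico (P.dl (i - 1)) (P.rel (j + 1))) (Finset.Ico i (j + 1))
      (P.recValue i j)) : P.O i j = P.recValue i j :=
  le_antisymm (O_le h) (le_iInf fun S => recValue_le hi hij hj S)

/-- In a sparse subinstance, the recursion holds and the minimum is attained. -/
theorem Sparse.hasSched_O (hj : j ≤ P.n) : ∀ (i : ℕ), 1 ≤ i → i ≤ j → P.Sparse i j →
    P.O i j = P.recValue i j ∧
    P.HasSched (Set.Ico (P.dl (i - 1)) (P.rel (j + 1))) (Finset.Ico i (j + 1)) (P.O i j) := by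
  suffices H : ∀ d i, j - i = d → 1 ≤ i → i ≤ j → P.Sparse i j → P.O i j = P.recValue i j ∧
      P.HasSched (Set.Ico (P.dl (i - 1)) (P.rel (j + 1))) (Finset.Ico i (j + 1)) (P.O i j) from
    fun i => H _ i rfl
  intro d
  induction d using Nat.strong_induction_on with
  | _ d ih =>
    intro i hd hi hij hsp
    have h := hsp.hasSched_recValue hi hij hj fun k hik hkj => by
      have hkh : k ≤ P.h j k := le_h hkj
      rcases (h_le (P := P) (j := j) k).eq_or_lt with heq | hlt
      · rw [heq]
        exact hasSched_O_empty (by omega)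
      · have h1 := (ih (j - (P.h j k + 1)) (by omega) (P.h j k + 1) rfl (by omega) hlt
          (hsp.of_h hi hj hik hkj hlt)).2
        rwa [Nat.add_sub_cancel] at h1
    have hO := O_eq_recValue hi hij hj h
    exact ⟨hO, hO ▸ h⟩

theorem Sparse.exists_subSchedule (hsp : P.Sparse i j) (hi : 1 ≤ i) (hij : i ≤ j) (hj : j ≤ P.n) :
    ∃ S : P.SubSchedule i j, S.speedCost + S.modeCost = P.O i j := by
  have h := (Sparse.hasSched_O hj i hi hij hsp).2
  rw [Finset.Ico_add_one_right_eq_Icc] at h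
  obtain ⟨S, hS⟩ := h
  exact ⟨S, le_antisymm hS (iInf_le _ S)⟩

end AgreeableInstance

/-! ### The complete instance -/

namespace AgreeableInstance

variable {P : AgreeableInstance} {x y : ℝ} {J : Finset ℕ}

namespace Schedule

theorem disjoint_onSet_offSet (S : P.Schedule (Set.Ico x y) J) : Disjoint S.onSet S.offSet := by
  rw [Set.disjoint_left]
  rintro t ⟨_, h⟩ ⟨_, h'⟩
  rw [h] at h'
  exact Mode.noConfusion h'

/-- Shutting the machine down during an idle interval on which staying on costs as much as a
wake-up does not increase the cost: if the interval meets a shutdown, no new shutdown arises, and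
otherwise the energy saved pays for the new shutdown. -/
theorem exists_turnOff (S : P.Schedule (Set.Ico x y) J) {p q : ℝ} (hp : x ≤ p) (hpq : p ≤ q)
    (hq : q ≤ y) (hlen : P.g * (q - p) = P.L) (hidle : ∀ t ∈ Set.Ico p q, S.job t = none) :
    ∃ S' : P.Schedule (Set.Ico x y) J, S'.speedCost = S.speedCost ∧ S'.modeCost ≤ S.modeCost ∧
      (∀ t ∈ Set.Ico p q, S'.mode t = Mode.off) ∧
      ∀ t, S.mode t = Mode.off → S'.mode t = Mode.off := by
  have hsub : Set.Ico p q ⊆ Set.Ico x y := Set.Ico_subset_Ico hp hq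
  set μ : ℝ → Mode := fun t => if t < p then S.mode t else if t < q then Mode.off else S.mode t
    with hμ
  have hμ_in : ∀ t ∈ Set.Ico p q, μ t = Mode.off := fun t ht => by
    simp [hμ, not_lt.2 ht.1, ht.2]
  have hμ_out : ∀ t, t ∉ Set.Ico p q → μ t = S.mode t := fun t ht => by
    simp only [hμ]
    by_cases h1 : t < p
    · simp [h1]
    · by_cases h2 : t < q
      · exact absurd ⟨not_lt.1 h1, h2⟩ ht
      · simp [h1, h2]
  have hrc : RightConstOn μ x y :=
    (S.rightConst_mode.mono le_rfl (hpq.trans hq)).glue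
      ((RightConstOn.const Mode.off).glue (S.rightConst_mode.mono (hp.trans hpq) le_rfl))
  let S' : P.Schedule (Set.Ico x y) J :=
    { mode := μ
      speed := S.speed
      job := S.job
      on_of_speed_pos := by
        intro t ht hpos
        by_cases h : t ∈ Set.Ico p q
        · exact absurd ((S.speed_eq_zero_iff t ht).2 (hidle t h)) hpos.ne'
        · rw [hμ_out t h]; exact S.on_of_speed_pos t ht hpos
      speed_eq_zero_iff := S.speed_eq_zero_iff
      job_window := S.job_window
      work := S.work
      piecewise_constant := by
        intro t ht
        obtain ⟨a, b, ha, hb, h⟩ := S.piecewise_constant t ht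
        obtain ⟨b', hb', h'⟩ := hrc t ht
        refine ⟨t, min b b', le_rfl, lt_min hb hb', fun z hz => ?_⟩
        have h1 := h z ⟨⟨ha.trans hz.1.1, hz.1.2.trans_le (min_le_left _ _)⟩, hz.2⟩
        exact ⟨h' z ⟨hz.1.1, hz.1.2.trans_le (min_le_right _ _)⟩ hz.2.2, h1.2⟩ }
  have hoff : S'.offSet = S.offSet ∪ Set.Ico p q := by
    ext t
    by_cases h : t ∈ Set.Ico p q
    · exact ⟨fun _ => Or.inr h, fun _ => ⟨hsub h, hμ_in t h⟩⟩
    · constructor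
      · rintro ⟨ht, hm⟩
        exact Or.inl ⟨ht, by rw [← hμ_out t h]; exact hm⟩
      · rintro (⟨ht, hm⟩ | h')
        · exact ⟨ht, by rw [← hm]; exact hμ_out t h⟩
        · exact absurd h' h
  have hon : S'.onSet = S.onSet \ Set.Ico p q := by
    ext t
    by_cases h : t ∈ Set.Ico p q
    · refine iff_of_false ?_ fun h' => h'.2 h
      rintro ⟨_, hm⟩
      rw [show S'.mode t = Mode.off from hμ_in t h] at hm
      exact Mode.noConfusion hm
    · constructor
      · rintro ⟨ht, hm⟩
        exact ⟨⟨ht, by rw [← hμ_out t h]; exact hm⟩, h⟩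
      · rintro ⟨⟨ht, hm⟩, _⟩
        exact ⟨ht, by rw [← hm]; exact hμ_out t h⟩
  refine ⟨S', rfl, ?_, hμ_in, fun t ht => ?_⟩
  · unfold modeCost
    rw [hoff, hon]
    by_cases hmeet : (S.offSet ∩ Set.Ico p q).Nonempty
    · obtain ⟨t, ht1, ht2⟩ := hmeet
      have h1 : ((maxIntervals (S.offSet ∪ Set.Ico p q)).encard : ℝ≥0∞) ≤
          (maxIntervals S.offSet).encard := by
        rw [ENat.toENNReal_le]
        exact encard_maxIntervals_union_le_of_meets Set.ordConnected_Ico ht1 ht2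
      gcongr
      exact Set.sdiff_subset
    · have h1 : ((maxIntervals (S.offSet ∪ Set.Ico p q)).encard : ℝ≥0∞) ≤
          (maxIntervals S.offSet).encard + 1 := by
        have h2 := (encard_maxIntervals_union_le S.offSet (Set.Ico p q)).trans
          (add_le_add le_rfl (encard_maxIntervals_le_one Set.ordConnected_Ico))
        exact_mod_cast h2
      -- the machine is on during all of `[p, q)`
      have hKon : Set.Ico p q ⊆ S.onSet := fun t ht => by
        refine ⟨hsub ht, ?_⟩
        by_contra hne
        exact hmeet ⟨t, ⟨hsub ht, mode_eq_off_of_ne hne⟩, ht⟩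
      have h3 : volume (S.onSet \ Set.Ico p q) + volume (Set.Ico p q) = volume S.onSet := by
        have := measure_sdiff_add_inter (μ := volume) S.onSet
          (measurableSet_Ico (a := p) (b := q))
        rwa [Set.inter_eq_right.2 hKon] at this
      calc _ ≤ (((maxIntervals S.offSet).encard : ℝ≥0∞) + 1) * ENNReal.ofReal P.L +
            ENNReal.ofReal P.g * volume (S.onSet \ Set.Ico p q) := by gcongr
        _ = ((maxIntervals S.offSet).encard : ℝ≥0∞) * ENNReal.ofReal P.L +
            ENNReal.ofReal P.g *
              (volume (S.onSet \ Set.Ico p q) + volume (Set.Ico p q)) := by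
            rw [Real.volume_Ico, mul_add, ← ENNReal.ofReal_mul P.g_pos.le, hlen]
            ring
        _ = _ := by rw [h3]
  · by_cases h : t ∈ Set.Ico p q
    · exact hμ_in t h
    · exact (hμ_out t h).trans ht

/-- If the machine is off at both ends, there are more shutdowns than on-intervals. -/
theorem encard_onSet_add_one_le (S : P.Schedule (Set.Ico x y) J) {q : ℝ} (hx : x ∈ S.offSet)
    (hq : q < y) (hoff : ∀ t ∈ Set.Ico q y, S.mode t = Mode.off) :
    (maxIntervals S.onSet).encard + 1 ≤ (maxIntervals S.offSet).encard := by
  -- the half-line before `x` serves as one more on-interval; each of them is followed by a shutdown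
  set U : Set ℝ := S.onSet ∪ Set.Iio x with hU
  have hxU : x ∉ U := by
    rintro (h | h)
    · exact Set.disjoint_left.1 S.disjoint_onSet_offSet h hx
    · exact lt_irrefl x h
  have h1 : (maxIntervals S.onSet).encard + 1 ≤ (maxIntervals U).encard := by
    have h2 := encard_maxIntervals_inter_add_le (X := U) (K := Set.Iio x) (K' := Set.Ici x)
      Set.ordConnected_Iio Set.ordConnected_Ici fun p hp t ht =>
        ⟨(lt_of_lt_of_le hp.2 ht.2).le, x, ⟨(show p < x from hp.2).le, ht.2⟩, hxU⟩
    have h3 : U ∩ Set.Ici x = S.onSet := by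
      ext t
      constructor
      · rintro ⟨h | h, h'⟩
        · exact h
        · exact absurd (show t < x from h) (not_lt.2 h')
      · exact fun h => ⟨Or.inl h, h.1.1⟩
    have h4 : 1 ≤ (maxIntervals (U ∩ Set.Iio x)).encard :=
      one_le_encard_maxIntervals ⟨x - 1, Or.inr (by simp), by simp⟩
    rw [h3] at h2
    rw [add_comm]
    exact (add_le_add h4 le_rfl).trans h2
  refine h1.trans (encard_maxIntervals_le_of_followed ?_ ?_)
  · rw [hU, Set.disjoint_union_left]
    refine ⟨S.disjoint_onSet_offSet, ?_⟩
    rw [Set.disjoint_left]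
    exact fun t ht ht' => not_lt.2 ht'.1.1 ht
  · rintro t (ht | ht)
    · have htq : t < q := by
        by_contra hcon
        have := hoff t ⟨not_lt.1 hcon, ht.1.2⟩
        rw [ht.2] at this
        exact Mode.noConfusion this
      obtain ⟨u, hu, huq, hne⟩ := S.rightConst_mode.exists_next ht.1.1 htq.le hq
      rw [hoff q ⟨le_rfl, hq⟩] at huq hne
      have huy : u < y := hu.2.trans_lt hq
      refine ⟨u, ⟨⟨ht.1.1.trans hu.1, huy⟩, huq⟩, ?_, fun z hz => Or.inl ?_⟩
      · refine lt_of_le_of_ne hu.1 fun h => ?_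
        rw [← h, ht.2] at huq
        exact Mode.noConfusion huq
      · refine ⟨⟨ht.1.1.trans hz.1, hz.2.trans huy⟩, ?_⟩
        by_contra h
        exact hne z hz (mode_eq_off_of_ne h)
    · exact ⟨x, hx, ht, fun z hz => Or.inr hz.2⟩

/-- Between two shutdowns there is an on-interval. -/
theorem encard_offSet_le (S : P.Schedule (Set.Ico x y) J) :
    (maxIntervals S.offSet).encard ≤ (maxIntervals S.onSet).encard + 1 := by
  -- the half-line from `y` on serves as an on-interval following the last shutdown
  have h1 : (maxIntervals (S.onSet ∪ Set.Ici y)).encard ≤ (maxIntervals S.onSet).encard + 1 :=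
    (encard_maxIntervals_union_le _ _).trans
      (add_le_add le_rfl (encard_maxIntervals_le_one Set.ordConnected_Ici))
  refine le_trans (encard_maxIntervals_le_of_followed ?_ ?_) h1
  · rw [Set.disjoint_union_right]
    refine ⟨S.disjoint_onSet_offSet.symm, ?_⟩
    rw [Set.disjoint_left]
    exact fun t ht ht' => not_lt.2 ht' ht.1.2
  · intro t ht
    by_cases hex : ∃ s, t ≤ s ∧ s < y ∧ S.mode s = Mode.on
    · obtain ⟨s, hts, hsy, hs⟩ := hex
      obtain ⟨u, hu, hus, hne⟩ := S.rightConst_mode.exists_next ht.1.1 hts hsy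
      rw [hs] at hus hne
      have huy : u < y := hu.2.trans_lt hsy
      refine ⟨u, Or.inl ⟨⟨ht.1.1.trans hu.1, huy⟩, hus⟩, ?_, fun z hz => ?_⟩
      · refine lt_of_le_of_ne hu.1 fun h => ?_
        rw [← h, ht.2] at hus
        exact Mode.noConfusion hus
      · exact ⟨⟨ht.1.1.trans hz.1, hz.2.trans huy⟩, mode_eq_off_of_ne (hne z hz)⟩
    · push Not at hex
      refine ⟨y, Or.inr (Set.mem_Ici.2 le_rfl), ht.1.2, fun z hz => ?_⟩
      exact ⟨⟨ht.1.1.trans hz.1, hz.2⟩, mode_eq_off_of_ne (hex z hz.1 hz.2)⟩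

end Schedule

/-- Jobs are processed between the first release time and the last deadline only. -/
theorem Schedule.mem_Ico_of_job {T : Set ℝ} (S : P.Schedule T (Finset.Icc 1 P.n)) {t : ℝ}
    (ht : t ∈ T) (h : S.job t ≠ none) : t ∈ Set.Ico (P.r 1) (P.d P.n) := by
  obtain ⟨l, hl⟩ := Option.ne_none_iff_exists'.1 h
  obtain ⟨hlJ, h1, h2⟩ := S.job_window t ht l hl
  rw [Finset.mem_Icc] at hlJ
  exact ⟨(P.r_le le_rfl hlJ.1 hlJ.2).trans h1, h2.trans_le (P.d_le hlJ.1 hlJ.2 le_rfl)⟩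

theorem Schedule.r_one_lt_d {T : Set ℝ} (S : P.Schedule T (Finset.Icc 1 P.n)) :
    P.r 1 < P.d P.n := by
  have hn := P.one_le_n
  by_contra hcon
  have hempty : {t | t ∈ T ∧ S.job t = some 1} = ∅ := by
    ext t
    simp only [Set.mem_ofPred_eq, Set.mem_empty_iff_false, iff_false, not_and]
    intro ht hj
    have := S.mem_Ico_of_job ht (by rw [hj]; simp)
    exact hcon (this.1.trans_lt this.2)
  have h := S.work 1 (Finset.mem_Icc.2 ⟨le_rfl, hn⟩)
  rw [hempty, Measure.restrict_empty, lintegral_zero_measure] at h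
  have := ENNReal.ofReal_eq_zero.1 h.symm
  linarith [P.w_pos 1 le_rfl hn]

/-- A schedule on an interval, extended to all times by the machine being off. -/
def Schedule.extend (S : P.Schedule (Set.Ico x y) J) : P.Schedule Set.univ J where
  mode t := if t < x then Mode.off else if t < y then S.mode t else Mode.off
  speed t := if t < x then 0 else if t < y then S.speed t else 0
  job t := if t < x then none else if t < y then S.job t else none
  on_of_speed_pos := by
    intro t _
    by_cases h1 : t < x
    · simp [h1]
    · by_cases h2 : t < y
      · simpa [h1, h2] using S.on_of_speed_pos t ⟨not_lt.1 h1, h2⟩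
      · simp [h1, h2]
  speed_eq_zero_iff := by
    intro t _
    by_cases h1 : t < x
    · simp [h1]
    · by_cases h2 : t < y
      · simpa [h1, h2] using S.speed_eq_zero_iff t ⟨not_lt.1 h1, h2⟩
      · simp [h1, h2]
  job_window := by
    intro t _ l
    by_cases h1 : t < x
    · simp [h1]
    · by_cases h2 : t < y
      · simpa [h1, h2] using S.job_window t ⟨not_lt.1 h1, h2⟩ l
      · simp [h1, h2]
  work := by
    intro l hl
    have hset : {t | t ∈ Set.univ ∧ (if t < x then none else if t < y then S.job t else none) =
        some l} = {t | t ∈ Set.Ico x y ∧ S.job t = some l} := by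
      ext t
      by_cases h1 : t < x
      · simp [not_le.2 h1]
      · by_cases h2 : t < y
        · simp [h2, not_lt.1 h1]
        · simp [h2]
    rw [hset, ← S.work l hl]
    refine setLIntegral_congr_fun (S.measurableSet_job l) fun t ht => ?_
    simp [not_lt.2 ht.1.1, ht.1.2]
  piecewise_constant := by
    intro t _
    have hT : t ∈ Set.Ico (min t x) (max (t + 1) y) :=
      ⟨min_le_left _ _, lt_max_of_lt_left (by linarith)⟩
    have aux : ∀ {β : Type} (f : ℝ → β) (c : β), RightConstOn f x y → RightConstOn
        (fun t => if t < x then c else if t < y then f t else c) (min t x) (max (t + 1) y) :=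
      fun f c hf => (RightConstOn.const c).glue (hf.glue (RightConstOn.const c))
    obtain ⟨b, hb, h⟩ := aux S.mode Mode.off S.rightConst_mode t hT
    obtain ⟨b', hb', h'⟩ := aux S.speed 0 S.rightConst_speed t hT
    obtain ⟨b'', hb'', h''⟩ := aux S.job none S.rightConst_job t hT
    refine ⟨t, min (t + 1) (min b (min b' b'')), le_rfl,
      lt_min (by linarith) (lt_min hb (lt_min hb' hb'')), fun z hz => ?_⟩
    obtain ⟨⟨hz1, hz2⟩, _⟩ := hz
    rw [lt_min_iff, lt_min_iff, lt_min_iff] at hz2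
    have hzT : z < max (t + 1) y := lt_max_of_lt_left hz2.1
    exact ⟨h z ⟨hz1, hz2.2.1⟩ hzT, h' z ⟨hz1, hz2.2.2.1⟩ hzT, h'' z ⟨hz1, hz2.2.2.2⟩ hzT⟩

theorem Schedule.speedCost_extend (S : P.Schedule (Set.Ico x y) J) :
    S.extend.speedCost = S.speedCost := by
  have hα : 0 < P.α := by linarith [P.two_le_α]
  unfold Schedule.speedCost
  rw [Measure.restrict_univ, ← lintegral_indicator measurableSet_Ico]
  refine lintegral_congr fun t => ?_
  by_cases h1 : t < x
  · simp [Schedule.extend, h1, hα]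
  · by_cases h2 : t < y
    · simp [Schedule.extend, h1, h2, not_lt.1 h1]
    · simp [Schedule.extend, h1, h2, hα]

theorem Schedule.onSet_extend (S : P.Schedule (Set.Ico x y) J) :
    S.extend.onSet = S.onSet := by
  ext t
  by_cases h1 : t < x
  · simp [Schedule.onSet, Schedule.extend, h1]
  · by_cases h2 : t < y
    · simp [Schedule.onSet, Schedule.extend, h1, h2, not_lt.1 h1]
    · simp [Schedule.onSet, Schedule.extend, h1, h2]

/-- A schedule of `(1, n)` yields a schedule of the complete instance that is at most as expensive:
the machine is shut down before the first release time and after the last deadline. -/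
theorem exists_fullSchedule (S : P.Schedule (Set.Ico x y) (Finset.Icc 1 P.n))
    (hx : P.r 1 - P.L / P.g = x) (hy : P.d P.n + P.L / P.g = y) :
    ∃ F : P.FullSchedule, F.speedCost + F.fullModeCost ≤ S.speedCost + S.modeCost := by
  have hg := P.g_pos
  have hLg : 0 < P.L / P.g := div_pos P.L_pos hg
  have hrd := S.r_one_lt_d
  have hmul : P.g * (P.L / P.g) = P.L := mul_div_cancel₀ _ hg.ne'
  have hidle : ∀ S' : P.Schedule (Set.Ico x y) (Finset.Icc 1 P.n), ∀ t ∈ Set.Ico x y,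
      t ∉ Set.Ico (P.r 1) (P.d P.n) → S'.job t = none := by
    intro S' t ht hnot
    by_contra h
    exact hnot (S'.mem_Ico_of_job ht h)
  obtain ⟨S₁, h1a, h1b, h1c, _⟩ := S.exists_turnOff (p := x) (q := P.r 1) le_rfl (by linarith)
    (by linarith) (by rw [← hmul]; congr 1; linarith) fun t ht =>
      hidle S t ⟨ht.1, by linarith [ht.2]⟩ fun h => not_lt.2 h.1 ht.2
  obtain ⟨S₂, h2a, h2b, h2c, h2d⟩ := S₁.exists_turnOff (p := P.d P.n) (q := y) (by linarith)
    (by linarith) le_rfl (by rw [← hmul]; congr 1; linarith) fun t ht =>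
      hidle S₁ t ⟨by linarith [ht.1], ht.2⟩ fun h => not_lt.2 ht.1 h.2
  have hxy : x < y := by linarith
  have hxoff : x ∈ S₂.offSet :=
    ⟨⟨le_rfl, hxy⟩, h2d x (h1c x ⟨le_rfl, by linarith⟩)⟩
  have hcount : ((maxIntervals S₂.onSet).encard : ℝ≥0∞) + 1 ≤ (maxIntervals S₂.offSet).encard := by
    have := S₂.encard_onSet_add_one_le hxoff (q := P.d P.n) (by linarith) h2c
    exact_mod_cast this
  refine ⟨S₂.extend, ?_⟩
  rw [Schedule.speedCost_extend, Schedule.fullModeCost, Schedule.onSet_extend, ← h1a, ← h2a]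
  gcongr
  refine le_trans ?_ (h2b.trans h1b)
  rw [Schedule.modeCost, mul_comm]
  gcongr

/-- A schedule of the complete instance yields a schedule of `(1, n)` that is at most as
expensive. -/
theorem exists_subSchedule_le (F : P.FullSchedule) (hx : P.r 1 - P.L / P.g = x)
    (hy : P.d P.n + P.L / P.g = y) :
    ∃ S : P.Schedule (Set.Ico x y) (Finset.Icc 1 P.n),
      S.speedCost + S.modeCost ≤ F.speedCost + F.fullModeCost := by
  have hg := P.g_pos
  have hLg : 0 < P.L / P.g := div_pos P.L_pos hg
  have hrd := F.r_one_lt_d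
  have hsub : Set.Ico (P.r 1) (P.d P.n) ⊆ Set.Ico x y :=
    Set.Ico_subset_Ico (by linarith) (by linarith)
  have hrc : ∀ {β : Type} (f : ℝ → β), (∀ t, ∃ b, t < b ∧ ∀ z ∈ Set.Ico t b, f z = f t) →
      ∀ a b, RightConstOn f a b := by
    intro β f hf a b t _
    obtain ⟨c, hc, h⟩ := hf t
    exact ⟨c, hc, fun z hz _ => h z hz⟩
  have hpc : ∀ t, ∃ b, t < b ∧ ∀ z ∈ Set.Ico t b,
      F.mode z = F.mode t ∧ F.speed z = F.speed t ∧ F.job z = F.job t := by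
    intro t
    obtain ⟨a, b, ha, hb, h⟩ := F.piecewise_constant t (Set.mem_univ t)
    exact ⟨b, hb, fun z hz => h z ⟨⟨ha.trans hz.1, hz.2⟩, Set.mem_univ z⟩⟩
  have hmode : ∀ a b, RightConstOn F.mode a b := hrc F.mode fun t => by
    obtain ⟨b, hb, h⟩ := hpc t
    exact ⟨b, hb, fun z hz => (h z hz).1⟩
  -- switch off outside of the time between the first release and the last deadline
  set μ : ℝ → Mode := fun t => if t < P.r 1 then Mode.off else
    if t < P.d P.n then F.mode t else Mode.off with hμ
  have hμ_in : ∀ t ∈ Set.Ico (P.r 1) (P.d P.n), μ t = F.mode t := fun t ht => by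
    simp [hμ, not_lt.2 ht.1, ht.2]
  have hμ_out : ∀ t, t ∉ Set.Ico (P.r 1) (P.d P.n) → μ t = Mode.off := fun t ht => by
    simp only [hμ]
    by_cases h1 : t < P.r 1
    · simp [h1]
    · by_cases h2 : t < P.d P.n
      · exact absurd ⟨not_lt.1 h1, h2⟩ ht
      · simp [h1, h2]
  have hμ_rc : RightConstOn μ x y :=
    (RightConstOn.const Mode.off).glue ((hmode _ _).glue (RightConstOn.const Mode.off))
  let S : P.Schedule (Set.Ico x y) (Finset.Icc 1 P.n) :=
    { mode := μ
      speed := F.speed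
      job := F.job
      on_of_speed_pos := by
        intro t _ hpos
        have hj : F.job t ≠ none := fun h =>
          hpos.ne' ((F.speed_eq_zero_iff t (Set.mem_univ t)).2 h)
        rw [hμ_in t (F.mem_Ico_of_job (Set.mem_univ t) hj)]
        exact F.on_of_speed_pos t (Set.mem_univ t) hpos
      speed_eq_zero_iff := fun t _ => F.speed_eq_zero_iff t (Set.mem_univ t)
      job_window := fun t _ => F.job_window t (Set.mem_univ t)
      work := by
        intro l hl
        rw [← F.work l hl]
        congr 2
        ext t
        constructor
        · rintro ⟨_, h⟩
          exact ⟨Set.mem_univ t, h⟩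
        · rintro ⟨_, h⟩
          exact ⟨hsub (F.mem_Ico_of_job (Set.mem_univ t) (by rw [h]; simp)), h⟩
      piecewise_constant := by
        intro t ht
        obtain ⟨b, hb, h⟩ := hpc t
        obtain ⟨b', hb', h'⟩ := hμ_rc t ht
        refine ⟨t, min b b', le_rfl, lt_min hb hb', fun z hz => ?_⟩
        exact ⟨h' z ⟨hz.1.1, hz.1.2.trans_le (min_le_right _ _)⟩ hz.2.2,
          (h z ⟨hz.1.1, hz.1.2.trans_le (min_le_left _ _)⟩).2⟩ }
  have hon : S.onSet = F.onSet ∩ Set.Ico (P.r 1) (P.d P.n) := by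
    ext t
    by_cases h : t ∈ Set.Ico (P.r 1) (P.d P.n)
    · constructor
      · rintro ⟨_, hm⟩
        exact ⟨⟨Set.mem_univ t, by rw [← hμ_in t h]; exact hm⟩, h⟩
      · rintro ⟨⟨_, hm⟩, _⟩
        exact ⟨hsub h, by rw [← hm]; exact hμ_in t h⟩
    · refine iff_of_false ?_ fun h' => h h'.2
      rintro ⟨_, hm⟩
      rw [show S.mode t = Mode.off from hμ_out t h] at hm
      exact Mode.noConfusion hm
  have hcount : ((maxIntervals S.offSet).encard : ℝ≥0∞) ≤ (maxIntervals F.onSet).encard + 1 := by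
    have h1 := S.encard_offSet_le
    rw [hon] at h1
    have h2 := h1.trans (add_le_add
      (encard_maxIntervals_inter_le_self F.onSet Set.ordConnected_Ico) le_rfl)
    exact_mod_cast h2
  refine ⟨S, add_le_add (lintegral_mono_set (Set.subset_univ _)) ?_⟩
  rw [Schedule.modeCost, Schedule.fullModeCost, mul_comm (ENNReal.ofReal P.L), hon]
  gcongr
  exact Set.inter_subset_left

theorem opt_eq_O : P.opt = P.O 1 P.n := by
  have hx : P.r 1 - P.L / P.g = P.dl (1 - 1) := by simp [dl]
  have hy : P.d P.n + P.L / P.g = P.rel (P.n + 1) := by simp [rel]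
  refine le_antisymm (le_iInf fun S => ?_) (le_iInf fun F => ?_)
  · obtain ⟨F, hF⟩ := exists_fullSchedule S hx hy
    exact (iInf_le _ F).trans hF
  · obtain ⟨S, hS⟩ := exists_subSchedule_le F hx hy
    exact (iInf_le _ S).trans hS

theorem Sparse.exists_fullSchedule (hsp : P.Sparse 1 P.n) :
    ∃ S : P.FullSchedule, S.speedCost + S.fullModeCost = P.O 1 P.n := by
  have hx : P.r 1 - P.L / P.g = P.dl (1 - 1) := by simp [dl]
  have hy : P.d P.n + P.L / P.g = P.rel (P.n + 1) := by simp [rel]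
  obtain ⟨S, hS⟩ := hsp.exists_subSchedule le_rfl P.one_le_n le_rfl
  obtain ⟨F, hF⟩ := AgreeableInstance.exists_fullSchedule S hx hy
  refine ⟨F, le_antisymm (hF.trans hS.le) ?_⟩
  rw [← opt_eq_O]
  exact iInf_le _ F

end AgreeableInstance

end SpeedScaling

end

theorem mainTheorem1 (P : SpeedScaling.AgreeableInstance) :
    -- the empty subinstances
    (∀ i, 1 ≤ i → i ≤ P.n + 1 →
      P.O i (i - 1) =
        min (ENNReal.ofReal P.L) (ENNReal.ofReal (P.g * (P.rel i - P.dl (i - 1))))) ∧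
    -- the subinstances without dense intervals
    (∀ i j, 1 ≤ i → i ≤ j → j ≤ P.n → P.Sparse i j →
      -- the minimum is attained
      (∃ S : P.SubSchedule i j, S.speedCost + S.modeCost = P.O i j) ∧
      -- the recursion
      P.O i j =
        min (P.Y i j)
          (min (ENNReal.ofReal P.L + P.critCost i (P.h j i) + P.O (P.h j i + 1) j)
            (min
              (P.Y i (P.fInv i j j - 1) + P.critCost (P.fInv i j j) j + ENNReal.ofReal P.L)
              (⨅ (a : ℕ) (b : ℕ) (c : ℕ) (_ : i ≤ a ∧ a ≤ j ∧ b = P.f i j a ∧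
                  a = P.fInv i j b ∧ b < j ∧ c = P.h j (b + 1)),
                P.Y i (a - 1) + P.critCost a b + ENNReal.ofReal P.L + P.critCost (b + 1) c
                  + P.O (c + 1) j))) ∧
      -- the recursion applies again to the nonempty subinstances it refers to
      (∀ a, i ≤ a → a ≤ j → P.h j a < j → P.Sparse (P.h j a + 1) j)) ∧
    -- the complete instance
    P.opt = P.O 1 P.n ∧
    (P.Sparse 1 P.n →
      ∃ S : P.FullSchedule, S.speedCost + S.fullModeCost = P.O 1 P.n) := by
  refine ⟨fun i hi _ => SpeedScaling.AgreeableInstance.O_empty hi, fun i j hi hij hj hsp =>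
    ⟨hsp.exists_subSchedule hi hij hj, ?_, fun a hia haj hlt => hsp.of_h hi hj hia haj hlt⟩,
    SpeedScaling.AgreeableInstance.opt_eq_O, fun hsp => hsp.exists_fullSchedule⟩
  exact (SpeedScaling.AgreeableInstance.Sparse.hasSched_O hj i hi hij hsp).1
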